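/- **Conventions.** Let $X$ be a locally finite simplicial complex (every vertex lies in finitely many simplices), and write $\sigma\le\tau$ when $\sigma$ is a face of $\tau$. The *standard metric* on the geometric realisation $|X|$ is the path metric in which each simplex has the Euclidean metric in barycentric coordinates; points of different components have distance $\infty$. $Sd\,X$ is the barycentric subdivision (its simplices are the non-empty finite flags of simplices of $X$) and $Sd^iX$ the $i$-fold one; its simplices $s$ have barycentres $\hat s\in|X|$. Let $\mathbb A$ be an additive category. $\mathbb G_X(\mathbb A)$ has as objects families $M=(M(\sigma))_{\sigma\in X}$ of objects of $\mathbb A$, and as morphisms $M\to N$ the matrices $f=(f_{\tau,\sigma}:M(\sigma)\to N(\tau))$ with finitely many non-zero entries $f_{\tau,\sigma}$ for each $\sigma$, composed as matrices. $\mathbb A(X)$ denotes either of its subcategories $\mathbb A^*(X)$, $\mathbb A_*(X)$ with the same objects and with the morphisms satisfying $f_{\tau,\sigma}=0$ unless $\tau\le\sigma$, respectively unless $\sigma\le\tau$. Chain complexes are graded by $\mathbb Z$ and *finite*, i.e. zero in all but finitely many degrees. The *bound*, measured in $X$, of a morphism $f$ of $\mathbb G_{Sd^iX}(\mathbb A)$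 is $\sup\{d(\hat s,\hat t): f_{t,s}\neq0\}$, with $d$ the standard metric of $|X|$. A chain equivalence (given with its inverse and the two homotopies) has *control $<\epsilon$* if the supremum of the bounds of all components of the two chain maps and of the two chain homotopies is $<\epsilon$. **Subdivision of chain complexes.** Let $r:Sd\,X\to X$ be a simplicial approximation to the identity, i.e. a choice for every simplex $\sigma$ of $X$ of one of its vertices $r(\hat\sigma)$. For a simplex $s$ of $Sd\,X$ let $r(s)$ be the simplex of $X$ onto which $r$ maps it and $\delta(s)=|s|-|r(s)|\ge0$, where $|\cdot|$ is the number of vertices. Fix orientations by a strict partial order of the vertices of $X$ which is total on each simplex. For $a\in s$ with $r(s\setminus a)=r(s)$ put $$[s:s\setminus a]=(-1)^{\#\{b\in s\,:\,b\prec a\}+\#\{x\in r(s)\,:\,x<r(a)\}},$$ where $b\prec a$ means that $r(b)<r(a)$, or that $r(b)=r(a)$ and $b$ is, as a simplex of $X$, a proper face of $a$; put $[s:t]=0$ for all other $t$. For $C$ in $\mathbb A^*(X)$ the complex $Sd\,C=Sd_r\,C$ in $\mathbb A^*(Sd\,X)$ has $(Sd\,C)_n(s)=C_{n-\delta(s)}(r(s))$,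 and the $(t,s)$ component of its differential $d_n$ is the sum of * $(d_C)_{r(t),r(s)}$ if $t\le s$ and $\delta(t)=\delta(s)$, and $0$ otherwise; * $(-1)^n[s:t]$ times the identity of $C_{n-\delta(s)}(r(s))$ if $r(t)=r(s)$ and $[s:t]\neq 0$, and $0$ otherwise. For $C$ in $\mathbb A_*(X)$ the definition is dual: $(Sd\,C)_n(s)=C_{n+\delta(s)}(r(s))$ in $\mathbb A_*(Sd\,X)$, with first term $(d_C)_{r(t),r(s)}$ if $s\le t$ and $\delta(s)=\delta(t)$, and second term $(-1)^n[t:s]$ times the identity. Given simplicial approximations to the identity $r_j:Sd^{j+1}X\to Sd^jX$ for all $j\ge0$, $Sd^i\,C=Sd_{r_{i-1}}\cdots Sd_{r_0}\,C$ is a complex in $\mathbb A(Sd^iX)$, where the vertices of $Sd^jX$ with $j\ge1$ are ordered by the face relation of $Sd^{j-1}X$. **Theorem (Squeezing Theorem).** Let $X$ be a finite-dimensional locally finite simplicial complex. There are a real number $\epsilon=\epsilon(X)>0$, an integer $i(X)\ge 0$ and simplicial approximations to the identity $r_j:Sd^{j+1}X\to Sd^jX$ ($j\ge0$), all depending only on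 $X$, such that the following holds for every integer $i\ge i(X)$, every vertex order on $X$ as above, every additive category $\mathbb A$, for $\mathbb A(X)$ equal to $\mathbb A^*(X)$ or to $\mathbb A_*(X)$, and for all finite chain complexes $C,D$ in $\mathbb A(X)$. If there is a chain equivalence $Sd^i\,C\to Sd^i\,D$ in $\mathbb G_{Sd^iX}(\mathbb A)$ with control $<\epsilon$ measured in $X$, then $C$ and $D$ are chain equivalent in $\mathbb A(X)$. -/

import Mathlib

open CategoryTheory CategoryTheory.Limits
open scoped ENNReal

universe u v w

noncomputable section

namespace Squeezing

/-- A locally finite simplicial complex. -/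
structure LFComplex : Type (u + 1) where
  /-- the type of vertices -/
  V : Type u
  /-- the underlying abstract simplicial complex -/
  K : AbstractSimplicialComplex V
  /-- every vertex lies in only finitely many simplices -/
  locallyFinite : ∀ x : V, {s | s ∈ K.faces ∧ x ∈ s}.Finite

namespace LFComplex

/-- The simplices of `X`, ordered by the face relation. -/
abbrev Simplex (X : LFComplex.{u}) : Type u := {s : Finset X.V // s ∈ X.K.faces}

theorem Simplex.nonempty {X : LFComplex.{u}} (s : X.Simplex) : s.1.Nonempty :=
  (X.K.isRelLowerSet_faces s.2).1

theorem mem_faces_of_subset {X : LFComplex.{u}} (s : X.Simplex) {t : Finset X.V}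
    (h : t ⊆ s.1) (ht : t.Nonempty) : t ∈ X.K.faces :=
  (X.K.isRelLowerSet_faces s.2).2 h ht

/-- `X` is finite-dimensional: the number of vertices of its simplices is bounded. -/
def FiniteDimensional (X : LFComplex.{u}) : Prop :=
  ∃ n : ℕ, ∀ s : X.Simplex, s.1.card ≤ n + 1

theorem finite_faces {X : LFComplex.{u}} (s : X.Simplex) : {t : X.Simplex | t ≤ s}.Finite := by
  exact (s.1.powerset.finite_toSet.preimage Subtype.val_injective.injOn).subset fun t ht =>
    Finset.mem_coe.2 (Finset.mem_powerset.2 ht)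

theorem finite_meeting {X : LFComplex.{u}} (s : X.Simplex) :
    {t : X.Simplex | ∃ x ∈ s.1, x ∈ t.1}.Finite := by
  have h : (⋃ x ∈ s.1, {t | t ∈ X.K.faces ∧ x ∈ t}).Finite :=
    s.1.finite_toSet.biUnion fun x _ => X.locallyFinite x
  refine (h.preimage Subtype.val_injective.injOn).subset ?_
  rintro t ⟨x, hx, hxt⟩
  simp only [Set.mem_preimage, Set.mem_iUnion]
  exact ⟨x, hx, t.2, hxt⟩

theorem finite_cofaces {X : LFComplex.{u}} (s : X.Simplex) : {t : X.Simplex | s ≤ t}.Finite := by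
  refine (finite_meeting s).subset fun t ht => ?_
  obtain ⟨x, hx⟩ := s.nonempty
  exact ⟨x, hx, ht hx⟩

/-- The barycentric subdivision: its vertices are (the barycentres of) the simplices of `X`, its
simplices are the nonempty finite flags `σ₀ < … < σₖ` of simplices of `X`. -/
abbrev sd (X : LFComplex.{u}) : LFComplex.{u} where
  V := X.Simplex
  K :=
    { faces := {c | c.Nonempty ∧ IsChain (· ≤ ·) (c : Set X.Simplex)}
      isRelLowerSet_faces := fun {c} hc =>
        ⟨hc.1, fun t ht hn => ⟨hn, hc.2.mono (Finset.coe_subset.2 ht)⟩⟩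
      singleton_mem := fun s => ⟨Finset.singleton_nonempty s, by simp⟩ }
  locallyFinite := fun s => by
    have h := finite_meeting s
    refine (h.toFinset.powerset.finite_toSet).subset ?_
    rintro c ⟨hc, hs⟩
    simp only [Finset.coe_powerset, Set.mem_preimage, Set.mem_powerset_iff]
    intro t ht
    simp only [Set.Finite.coe_toFinset, Set.mem_ofPred_eq]
    rcases hc.2.total hs ht with h1 | h1
    · obtain ⟨x, hx⟩ := s.nonempty
      exact ⟨x, hx, h1 hx⟩
    · obtain ⟨x, hx⟩ := t.nonempty
      exact ⟨x, h1 hx, hx⟩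

/-- The iterated barycentric subdivisions `Sd^i X`. -/
def sdIter (X : LFComplex.{u}) : ℕ → LFComplex.{u}
  | 0 => X
  | i + 1 => (X.sdIter i).sd

/-- A simplicial approximation `r : Sd X → X` to the identity (equivalently, a choice of chain
inverse of the subdivision map): the barycentre of every simplex is sent to one of the vertices
of that simplex. -/
structure Approx (X : LFComplex.{u}) where
  toFun : X.Simplex → X.V
  mem : ∀ s, toFun s ∈ s.1

/-- An ordering of the vertices that is total on every simplex; it fixes orientations. -/
structure VertexOrder (X : LFComplex.{u}) where
  lt : X.V → X.V → Prop
  irrefl : ∀ a, ¬ lt a a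
  trans : ∀ a b c, lt a b → lt b c → lt a c
  total : ∀ s : X.Simplex, ∀ a ∈ s.1, ∀ b ∈ s.1, a ≠ b → lt a b ∨ lt b a

/-- The vertices of `Sd X` are ordered by the face relation. -/
def sdOrder (X : LFComplex.{u}) : X.sd.VertexOrder where
  lt := fun (a b : X.Simplex) => a < b
  irrefl := fun (a : X.Simplex) => lt_irrefl a
  trans := fun (a b c : X.Simplex) => lt_trans
  total := fun s a ha b hb hab => by
    rcases s.2.2.total ha hb with h | h
    · exact Or.inl (lt_of_le_of_ne h hab)
    · exact Or.inr (lt_of_le_of_ne h (Ne.symm hab))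

/-- The vertex orders used on `Sd^i X`: a given one on `X`, and the face relation for `i ≥ 1`. -/
def orderIter {X : LFComplex.{u}} (o : X.VertexOrder) : ∀ i, (X.sdIter i).VertexOrder
  | 0 => o
  | i + 1 => (X.sdIter i).sdOrder

/-! ### The standard metric -/

/-- The points of the geometric realisation, in barycentric coordinates. -/
def realization (X : LFComplex.{u}) : Set (X.V →₀ ℝ) :=
  {x | x.support ∈ X.K.faces ∧ (∀ a, 0 ≤ x a) ∧ (x.sum fun _ t => t) = 1}

/-- The closed simplex spanned by `s`, as a subset of the geometric realisation. -/
def closedSimplex (X : LFComplex.{u}) (s : X.Simplex) : Set (X.V →₀ ℝ) :=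
  {x | x ∈ X.realization ∧ x.support ⊆ s.1}

/-- The Euclidean distance of barycentric coordinate vectors. On each closed simplex this is the
metric of the standard embedding of that simplex. -/
def euclDist {X : LFComplex.{u}} (x y : X.V →₀ ℝ) : ℝ :=
  Real.sqrt ((x - y).sum fun _ t => t ^ 2)

/-- The standard metric on the geometric realisation: the path metric obtained from the standard
metrics of the simplices, that is, the infimum of the lengths of the polygonal paths from `x` to
`y` each of whose finitely many segments lies in a closed simplex. It is `∞` for points in
different components. -/
def stdDist (X : LFComplex.{u}) (x y : X.V →₀ ℝ) : ℝ≥0∞ :=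
  ⨅ (k : ℕ) (p : ℕ → X.V →₀ ℝ) (_ : p 0 = x ∧ p k = y ∧
    ∀ j < k, ∃ s : X.Simplex, p j ∈ X.closedSimplex s ∧ p (j + 1) ∈ X.closedSimplex s),
    ∑ j ∈ Finset.range k, ENNReal.ofReal (euclDist (p j) (p (j + 1)))

/-- The position in the geometric realisation of `X` of the vertices of `Sd^i X`: a vertex of
`Sd^(i+1) X` is placed at the barycentre of the corresponding simplex of `Sd^i X`. -/
def vertexPos (X : LFComplex.{u}) : ∀ i, (X.sdIter i).V → (X.V →₀ ℝ)
  | 0 => fun a => Finsupp.single a 1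
  | i + 1 => fun s => ((s : (X.sdIter i).Simplex).1.card : ℝ)⁻¹ • ∑ a ∈ s.1, X.vertexPos i a

/-- The barycentre, in the geometric realisation of `X`, of a simplex of `Sd^i X`. -/
def barycentre (X : LFComplex.{u}) (i : ℕ) (s : (X.sdIter i).Simplex) : X.V →₀ ℝ :=
  (s.1.card : ℝ)⁻¹ • ∑ a ∈ s.1, X.vertexPos i a

end LFComplex

/-! ### Graded categories -/

/-- A reflexive and transitive relation; `rel t s` says that a morphism may have a nonzero
component from `s` to `t`. -/
structure SuppRel (ι : Type u) where
  rel : ι → ι → Prop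
  refl : ∀ s, rel s s
  trans : ∀ q t s, rel q t → rel t s → rel q s

/-- No restriction on the components. -/
def SuppRel.all (ι : Type u) : SuppRel ι := ⟨fun _ _ => True, fun _ => trivial, fun _ _ _ _ _ => trivial⟩

/-- Objects of `A` indexed by `ι`, thought of as a formal direct sum; the morphisms will be the
column-finite matrices with components allowed by `R`. -/
structure Graded {ι : Type u} (R : SuppRel ι) (A : Type w) where
  obj : ι → A

namespace Graded

variable {ι : Type u} {R : SuppRel ι} {A : Type w} [Category.{v} A] [Preadditive A]

/-- Matrices `f t s : M s ⟶ N t` with finitely many nonzero entries in each column `s`, and with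
`f t s = 0` unless `R.rel t s`. -/
@[ext]
structure Hom (M N : Graded R A) where
  f : ∀ t s : ι, M.obj s ⟶ N.obj t
  supp : ∀ t s, ¬ R.rel t s → f t s = 0
  fin : ∀ s, {t | f t s ≠ 0}.Finite

open Classical in
/-- The identity matrix. -/
def Hom.id (M : Graded R A) : Hom M M where
  f := fun t s => if h : s = t then eqToHom (congrArg M.obj h) else 0
  supp := fun t s h => by
    rw [dif_neg]
    rintro rfl
    exact h (R.refl s)
  fin := fun s => (Set.finite_singleton s).subset fun t ht => by
    by_contra h
    exact ht (dif_neg fun e => h e.symm)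

theorem Hom.comp_finite {M N P : Graded R A} (f : Hom M N) (g : Hom N P) (q s : ι) :
    (Function.support fun t => f.f t s ≫ g.f q t).Finite :=
  (f.fin s).subset fun t ht h => ht (by simp [h])

/-- Matrix multiplication: `(g ∘ f) q s = ∑ t, g q t ∘ f t s`, a finite sum. -/
def Hom.comp {M N P : Graded R A} (f : Hom M N) (g : Hom N P) : Hom M P where
  f := fun q s => ∑ᶠ t, f.f t s ≫ g.f q t
  supp := fun q s h => by
    refine (finsum_congr fun t => ?_).trans finsum_zero
    by_cases h1 : R.rel t s
    · have h2 : ¬ R.rel q t := fun h2 => h (R.trans _ _ _ h2 h1)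
      rw [g.supp _ _ h2, comp_zero]
    · rw [f.supp _ _ h1, zero_comp]
  fin := fun s => by
    refine ((f.fin s).biUnion fun t _ => g.fin t).subset fun q hq => ?_
    by_contra h
    simp only [Set.mem_iUnion, not_exists] at h
    refine hq ((finsum_congr fun t => ?_).trans finsum_zero)
    by_cases h1 : f.f t s = 0
    · rw [h1, zero_comp]
    · have : g.f q t = 0 := by
        by_contra h2
        exact h t h1 h2
      rw [this, comp_zero]

theorem Hom.comp_eq_sum {M N P : Graded R A} (f : Hom M N) (g : Hom N P) (q s : ι)
    (T : Finset ι) (hT : ∀ t, f.f t s ≠ 0 → t ∈ T) :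
    (f.comp g).f q s = ∑ t ∈ T, f.f t s ≫ g.f q t :=
  finsum_eq_sum_of_support_subset _ fun t ht => hT t fun h => ht (by simp [h])

instance : Category (Graded R A) where
  Hom := Hom
  id := Hom.id
  comp := Hom.comp
  id_comp := fun {M N} f => by
    ext t s
    change ∑ᶠ x, (Hom.id M).f x s ≫ f.f t x = f.f t s
    rw [finsum_eq_single _ s fun x hx => by
      have : (Hom.id M).f x s = 0 := dif_neg fun e => hx e.symm
      rw [this, zero_comp]]
    simp [Hom.id]
  comp_id := fun {M N} f => by
    ext t s
    change ∑ᶠ x, f.f x s ≫ (Hom.id N).f t x = f.f t s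
    rw [finsum_eq_single _ t fun x hx => by
      have : (Hom.id N).f t x = 0 := dif_neg fun e => hx e
      rw [this, comp_zero]]
    simp [Hom.id]
  assoc := fun {M N P Q} f g h => by
    ext q s
    let T := (f.fin s).toFinset
    have hT : ∀ t, f.f t s ≠ 0 → t ∈ T := fun t ht => (f.fin s).mem_toFinset.2 ht
    let U := ((f.fin s).biUnion fun t _ => g.fin t).toFinset
    have hU : ∀ t ∈ T, ∀ x, g.f x t ≠ 0 → x ∈ U := fun t ht x hx => by
      refine (Set.Finite.mem_toFinset _).2 ?_
      simp only [Set.mem_iUnion]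
      exact ⟨t, (f.fin s).mem_toFinset.1 ht, hx⟩
    have hfg : ∀ x, (f.comp g).f x s ≠ 0 → x ∈ U := fun x hx => by
      by_contra hxU
      refine hx ?_
      rw [Hom.comp_eq_sum f g x s T hT]
      refine Finset.sum_eq_zero fun t ht => ?_
      have : g.f x t = 0 := by
        by_contra h2
        exact hxU (hU t ht x h2)
      rw [this, comp_zero]
    change ((f.comp g).comp h).f q s = (f.comp (g.comp h)).f q s
    rw [Hom.comp_eq_sum _ h q s U hfg, Hom.comp_eq_sum f _ q s T hT]
    calc ∑ x ∈ U, (f.comp g).f x s ≫ h.f q x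
        = ∑ x ∈ U, ∑ t ∈ T, (f.f t s ≫ g.f x t) ≫ h.f q x := by
          refine Finset.sum_congr rfl fun x _ => ?_
          rw [Hom.comp_eq_sum f g x s T hT, Preadditive.sum_comp]
      _ = ∑ t ∈ T, ∑ x ∈ U, (f.f t s ≫ g.f x t) ≫ h.f q x := Finset.sum_comm
      _ = ∑ t ∈ T, f.f t s ≫ (g.comp h).f q t := by
          refine Finset.sum_congr rfl fun t ht => ?_
          rw [Hom.comp_eq_sum g h q t U (hU t ht), Preadditive.comp_sum]
          simp

@[ext]
theorem hom_ext {M N : Graded R A} (f g : M ⟶ N) (h : ∀ t s, Hom.f f t s = Hom.f g t s) : f = g :=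
  Hom.ext (funext fun t => funext fun s => h t s)

theorem comp_f {M N P : Graded R A} (f : M ⟶ N) (g : N ⟶ P) (q s : ι) :
    Hom.f (f ≫ g) q s = ∑ᶠ t, Hom.f f t s ≫ Hom.f g q t := rfl

theorem comp_f_eq_sum {M N P : Graded R A} (f : M ⟶ N) (g : N ⟶ P) (q s : ι)
    (T : Finset ι) (hT : ∀ t, Hom.f f t s ≠ 0 → t ∈ T) :
    Hom.f (f ≫ g) q s = ∑ t ∈ T, Hom.f f t s ≫ Hom.f g q t :=
  Hom.comp_eq_sum f g q s T hT

section AddGroup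

variable (M N : Graded R A)

instance : Zero (M ⟶ N) := ⟨⟨fun _ _ => 0, fun _ _ _ => rfl, fun _ => by simp⟩⟩

instance : Add (M ⟶ N) := ⟨fun f g =>
  ⟨fun t s => Hom.f f t s + Hom.f g t s,
   fun t s h => by rw [Hom.supp f t s h, Hom.supp g t s h, add_zero],
   fun s => ((Hom.fin f s).union (Hom.fin g s)).subset fun t ht => by
      by_contra h
      simp only [Set.mem_union, Set.mem_ofPred_eq, not_or, not_not] at h
      exact ht (by rw [h.1, h.2, add_zero])⟩⟩

instance : Neg (M ⟶ N) := ⟨fun f =>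
  ⟨fun t s => - Hom.f f t s, fun t s h => by rw [Hom.supp f t s h, neg_zero],
   fun s => (Hom.fin f s).subset fun t ht h => ht (by rw [h, neg_zero])⟩⟩

instance : Sub (M ⟶ N) := ⟨fun f g =>
  ⟨fun t s => Hom.f f t s - Hom.f g t s,
   fun t s h => by rw [Hom.supp f t s h, Hom.supp g t s h, sub_zero],
   fun s => ((Hom.fin f s).union (Hom.fin g s)).subset fun t ht => by
      by_contra h
      simp only [Set.mem_union, Set.mem_ofPred_eq, not_or, not_not] at h
      exact ht (by rw [h.1, h.2, sub_zero])⟩⟩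

instance : SMul ℕ (M ⟶ N) := ⟨fun n f =>
  ⟨fun t s => n • Hom.f f t s, fun t s h => by rw [Hom.supp f t s h, smul_zero],
   fun s => (Hom.fin f s).subset fun t ht h => ht (by rw [h, smul_zero])⟩⟩

instance : SMul ℤ (M ⟶ N) := ⟨fun n f =>
  ⟨fun t s => n • Hom.f f t s, fun t s h => by rw [Hom.supp f t s h, smul_zero],
   fun s => (Hom.fin f s).subset fun t ht h => ht (by rw [h, smul_zero])⟩⟩

instance : AddCommGroup (M ⟶ N) :=
  Function.Injective.addCommGroup (fun f : M ⟶ N => (Hom.f f : ∀ t s, M.obj s ⟶ N.obj t))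
    (fun _ _ h => Hom.ext h) rfl (fun _ _ => rfl) (fun _ => rfl) (fun _ _ => rfl)
    (fun _ _ => rfl) (fun _ _ => rfl)

end AddGroup

theorem add_f {M N : Graded R A} (f g : M ⟶ N) (t s : ι) :
    Hom.f (f + g) t s = Hom.f f t s + Hom.f g t s := rfl

theorem zero_f {M N : Graded R A} (t s : ι) : Hom.f (0 : M ⟶ N) t s = 0 := rfl

instance : Preadditive (Graded R A) where
  homGroup := fun M N => inferInstance
  add_comp := fun M N P f g h => by
    ext q s
    rw [add_f, comp_f, comp_f, comp_f,
      ← finsum_add_distrib (Hom.comp_finite f h q s) (Hom.comp_finite g h q s)]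
    exact finsum_congr fun t => by rw [add_f, Preadditive.add_comp]
  comp_add := fun M N P f g h => by
    ext q s
    rw [add_f, comp_f, comp_f, comp_f,
      ← finsum_add_distrib (Hom.comp_finite f g q s) (Hom.comp_finite f h q s)]
    exact finsum_congr fun t => by rw [add_f, Preadditive.comp_add]

variable (R A) in
/-- The inclusion into the category in which all components are allowed. -/
def forget : Graded R A ⥤ Graded (SuppRel.all ι) A where
  obj := fun M => ⟨M.obj⟩
  map := fun {M N} f => ⟨fun t s => Hom.f (M := M) (N := N) f t s,
    fun _ _ h => (h trivial).elim, Hom.fin f⟩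
  map_id := fun _ => rfl
  map_comp := fun _ _ => rfl

instance : (forget R A).Additive where
  map_add := rfl

end Graded

/-! ### Combinatorics of a map between vertex sets -/

namespace Comb

variable {α β : Type*}

open Classical in
/-- The image of a finite set. -/
def img (r : α → β) (s : Finset α) : Finset β := s.image r

/-- `|s| - |r(s)|` -/
def depth (r : α → β) (s : Finset α) : ℤ := (s.card : ℤ) - ((img r s).card : ℤ)

/-- `t` is a subset of `s` with `|t| - |r(t)| = |s| - |r(s)|`. -/
def IsParallel (r : α → β) (t s : Finset α) : Prop := t ⊆ s ∧ depth r t = depth r s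

/-- The order in which vertices are listed: fibre by fibre over the vertices of the image. -/
def Before (r : α → β) (la : α → α → Prop) (lb : β → β → Prop) (b a : α) : Prop :=
  lb (r b) (r a) ∨ (r b = r a ∧ la b a)

open Classical in
/-- The exponent of the sign of the face of `s` opposite to its vertex `a`: the number of
vertices of `s` before `a`, plus the number of vertices of `r(s)` before `r(a)`. -/
def signExp (r : α → β) (la : α → α → Prop) (lb : β → β → Prop) (s : Finset α) (a : α) : ℕ :=
  (s.filter fun b => Before r la lb b a).card + ((img r s).filter fun x => lb x (r a)).card

open Classical in
/-- The incidence number of `t` in the boundary of `s`, for `t` with the same image as `s`. -/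
def incidence (r : α → β) (la : α → α → Prop) (lb : β → β → Prop) (t s : Finset α) : ℤ :=
  if img r t = img r s then
    ∑ a ∈ s, if s.erase a = t then (-1) ^ signExp r la lb s a else 0
  else 0

variable (r : α → β) (la : α → α → Prop) (lb : β → β → Prop)

theorem mem_img {r : α → β} {s : Finset α} {x : β} : x ∈ img r s ↔ ∃ a ∈ s, r a = x := by
  simp [img]

theorem apply_mem_img {s : Finset α} {a : α} (h : a ∈ s) : r a ∈ img r s :=
  mem_img.2 ⟨a, h, rfl⟩

theorem img_mono {t s : Finset α} (h : t ⊆ s) : img r t ⊆ img r s := by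
  intro x hx
  obtain ⟨a, ha, rfl⟩ := mem_img.1 hx
  exact apply_mem_img r (h ha)

theorem img_sdiff_subset [DecidableEq α] [DecidableEq β] {t s : Finset α} :
    img r s \ img r t ⊆ (s \ t).image r := by
  intro x hx
  obtain ⟨hx1, hx2⟩ := Finset.mem_sdiff.1 hx
  obtain ⟨a, ha, rfl⟩ := mem_img.1 hx1
  exact Finset.mem_image.2
    ⟨a, Finset.mem_sdiff.2 ⟨ha, fun hat => hx2 (apply_mem_img r hat)⟩, rfl⟩

theorem depth_mono {t s : Finset α} (h : t ⊆ s) : depth r t ≤ depth r s := by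
  classical
  have c1 : (s \ t).card + t.card = s.card := Finset.card_sdiff_add_card_eq_card h
  have c2 : (img r s \ img r t).card + (img r t).card = (img r s).card :=
    Finset.card_sdiff_add_card_eq_card (img_mono r h)
  have c3 : ((s \ t).image r).card ≤ (s \ t).card := Finset.card_image_le
  have c4 := Finset.card_le_card (img_sdiff_subset r (s := s) (t := t))
  unfold depth
  omega

/-- For `t ⊆ s`: `t` is parallel to `s` iff `r` is injective on `s \ t` and maps it off `r(t)`. -/
theorem isParallel_iff {t s : Finset α} (h : t ⊆ s) :
    IsParallel r t s ↔ (∀ a ∈ s, a ∉ t → ∀ b ∈ s, b ∉ t → r a = r b → a = b) ∧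
      ∀ a ∈ s, a ∉ t → r a ∉ img r t := by
  classical
  have hsub := img_sdiff_subset r (s := s) (t := t)
  have c1 : (s \ t).card + t.card = s.card := Finset.card_sdiff_add_card_eq_card h
  have c2 : (img r s \ img r t).card + (img r t).card = (img r s).card :=
    Finset.card_sdiff_add_card_eq_card (img_mono r h)
  have c3 : ((s \ t).image r).card ≤ (s \ t).card := Finset.card_image_le
  have c4 := Finset.card_le_card hsub
  unfold IsParallel depth
  constructor
  · rintro ⟨-, hd⟩
    have e1 : ((s \ t).image r).card = (s \ t).card := by omega
    have e2 : img r s \ img r t = (s \ t).image r :=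
      Finset.eq_of_subset_of_card_le hsub (by omega)
    refine ⟨fun a ha hat b hb hbt hab => ?_, fun a ha hat => ?_⟩
    · exact Finset.card_image_iff.1 e1 (Finset.mem_coe.2 (Finset.mem_sdiff.2 ⟨ha, hat⟩))
        (Finset.mem_coe.2 (Finset.mem_sdiff.2 ⟨hb, hbt⟩)) hab
    · have : r a ∈ (s \ t).image r := Finset.mem_image_of_mem _ (Finset.mem_sdiff.2 ⟨ha, hat⟩)
      rw [← e2] at this
      exact (Finset.mem_sdiff.1 this).2
  · rintro ⟨hi, hn⟩
    have e1 : ((s \ t).image r).card = (s \ t).card := Finset.card_image_iff.2 fun a ha b hb hab =>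
      hi a (Finset.mem_sdiff.1 ha).1 (Finset.mem_sdiff.1 ha).2 b (Finset.mem_sdiff.1 hb).1
        (Finset.mem_sdiff.1 hb).2 hab
    have e2 : img r s \ img r t = (s \ t).image r := by
      refine Finset.Subset.antisymm hsub fun x hx => ?_
      obtain ⟨a, ha, rfl⟩ := Finset.mem_image.1 hx
      obtain ⟨ha1, ha2⟩ := Finset.mem_sdiff.1 ha
      exact Finset.mem_sdiff.2 ⟨apply_mem_img r ha1, hn a ha1 ha2⟩
    rw [e2] at c2
    exact ⟨h, by omega⟩

theorem IsParallel.trans {r : α → β} {q t s : Finset α}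
    (h : IsParallel r q t) (h' : IsParallel r t s) : IsParallel r q s :=
  ⟨h.1.trans h'.1, h.2.trans h'.2⟩

/-- Between `q` and `s`, with `q` parallel to `s`, the sets parallel to both correspond to the
sets between `r(q)` and `r(s)`. -/
theorem exists_parallel {q s : Finset α} (h : IsParallel r q s) (y : Finset β)
    (h1 : img r q ⊆ y) (h2 : y ⊆ img r s) :
    ∃ t, IsParallel r q t ∧ IsParallel r t s ∧ img r t = y := by
  classical
  have hts : (s.filter fun a => r a ∈ y) ⊆ s := Finset.filter_subset _ _
  have hqt : q ⊆ s.filter fun a => r a ∈ y := fun a ha =>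
    Finset.mem_filter.2 ⟨h.1 ha, h1 (apply_mem_img r ha)⟩
  have d1 := depth_mono r hts
  have d2 := depth_mono r hqt
  have d3 := h.2
  refine ⟨s.filter fun a => r a ∈ y, ⟨hqt, by omega⟩, ⟨hts, by omega⟩, ?_⟩
  refine Finset.ext fun x => ?_
  rw [mem_img]
  constructor
  · rintro ⟨a, ha, rfl⟩
    exact (Finset.mem_filter.1 ha).2
  · intro hx
    obtain ⟨a, ha, rfl⟩ := mem_img.1 (h2 hx)
    exact ⟨a, Finset.mem_filter.2 ⟨ha, hx⟩, rfl⟩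

theorem IsParallel.mem_iff {r : α → β} {t s : Finset α} (h : IsParallel r t s) (a : α) :
    a ∈ t ↔ a ∈ s ∧ r a ∈ img r t := by
  constructor
  · exact fun ha => ⟨h.1 ha, apply_mem_img r ha⟩
  · rintro ⟨ha, hr⟩
    by_contra hn
    exact ((isParallel_iff r h.1).1 h).2 a ha hn hr

theorem IsParallel.ext {r : α → β} {t t' s : Finset α} (h : IsParallel r t s)
    (h' : IsParallel r t' s) (e : img r t = img r t') : t = t' :=
  Finset.ext fun a => by rw [h.mem_iff, h'.mem_iff, e]

/-- `t` is obtained from `s` by deleting `a`, and `r(a)` is still in the image. -/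
structure Del (t s : Finset α) (a : α) : Prop where
  mem : a ∈ s
  iff : ∀ b, b ∈ t ↔ b ∈ s ∧ b ≠ a
  im : r a ∈ img r t

variable {r}

theorem Del.notMem {t s : Finset α} {a : α} (h : Del r t s a) : a ∉ t :=
  fun ha => ((h.iff a).1 ha).2 rfl

theorem Del.subset {t s : Finset α} {a : α} (h : Del r t s a) : t ⊆ s :=
  fun b hb => ((h.iff b).1 hb).1

theorem Del.img_eq {t s : Finset α} {a : α} (h : Del r t s a) : img r t = img r s := by
  refine Finset.Subset.antisymm (img_mono r h.subset) fun x hx => ?_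
  obtain ⟨b, hb, rfl⟩ := mem_img.1 hx
  by_cases e : b = a
  · rw [e]
    exact h.im
  · exact apply_mem_img r ((h.iff b).2 ⟨hb, e⟩)

theorem Del.eq {t s : Finset α} {a b : α} (h : Del r t s a) (hb : b ∈ s) (hbt : b ∉ t) :
    b = a := by
  by_contra e
  exact hbt ((h.iff b).2 ⟨hb, e⟩)

theorem Del.card {t s : Finset α} {a : α} (h : Del r t s a) : s.card = t.card + 1 := by
  classical
  have : s = insert a t := Finset.ext fun b => by
    rw [Finset.mem_insert, h.iff]
    constructor
    · intro hb
      by_cases e : b = a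
      · exact Or.inl e
      · exact Or.inr ⟨hb, e⟩
    · rintro (rfl | hb)
      · exact h.mem
      · exact hb.1
  rw [this, Finset.card_insert_of_notMem h.notMem]

theorem Del.depth_eq {t s : Finset α} {a : α} (h : Del r t s a) :
    depth r s = depth r t + 1 := by
  have := h.card
  unfold depth
  rw [h.img_eq]
  omega

theorem incidence_eq {t s : Finset α} {a : α} (h : Del r t s a) :
    incidence r la lb t s = (-1) ^ signExp r la lb s a := by
  classical
  unfold incidence
  rw [if_pos h.img_eq, Finset.sum_eq_single a]
  · rw [if_pos]
    exact Finset.ext fun b => by rw [Finset.mem_erase, h.iff, and_comm]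
  · intro b hb hba
    rw [if_neg]
    intro e
    have hat : b ∉ t := by
      rw [← e]
      exact Finset.notMem_erase b s
    exact hba (h.eq hb hat)
  · exact fun h1 => (h1 h.mem).elim

theorem exists_del {t s : Finset α} (h : incidence r la lb t s ≠ 0) : ∃ a, Del r t s a := by
  classical
  unfold incidence at h
  by_cases h1 : img r t = img r s
  · rw [if_pos h1] at h
    obtain ⟨a, ha, hne⟩ := Finset.exists_ne_zero_of_sum_ne_zero h
    have e : s.erase a = t := by
      by_contra e
      exact hne (if_neg e)
    refine ⟨a, ha, fun b => ?_, ?_⟩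
    · rw [← e, Finset.mem_erase, and_comm]
    · rw [h1]
      exact apply_mem_img r ha
  · exact (h (if_neg h1)).elim

/-- The relation `lt` is a strict order, total on `s`. -/
structure Tot {γ : Type*} (lt : γ → γ → Prop) (s : Finset γ) : Prop where
  irrefl : ∀ a, ¬ lt a a
  trans : ∀ a b c, lt a b → lt b c → lt a c
  total : ∀ a ∈ s, ∀ b ∈ s, a ≠ b → lt a b ∨ lt b a

variable {la lb}

theorem Tot.before {s : Finset α} (ha : Tot la s) (hb : Tot lb (img r s)) :
    Tot (Before r la lb) s where
  irrefl := fun a h => h.elim (hb.irrefl _) fun h => ha.irrefl _ h.2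
  trans := fun a b c h h' => by
    rcases h with h | ⟨e, h⟩ <;> rcases h' with h' | ⟨e', h'⟩
    · exact Or.inl (hb.trans _ _ _ h h')
    · exact Or.inl (e' ▸ h)
    · exact Or.inl (e ▸ h')
    · exact Or.inr ⟨e.trans e', ha.trans _ _ _ h h'⟩
  total := fun a h1 b h2 hab => by
    by_cases e : r a = r b
    · exact (ha.total a h1 b h2 hab).imp (fun h => Or.inr ⟨e, h⟩) fun h => Or.inr ⟨e.symm, h⟩
    · exact (hb.total _ (apply_mem_img r h1) _ (apply_mem_img r h2) e).imp Or.inl Or.inl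

/-- The composite of two boundary maps vanishes. -/
theorem sum_incidence_incidence {q s : Finset α} (T : Finset (Finset α))
    (hT : ∀ t, q ⊆ t → t ⊆ s → t ∈ T) (ha : Tot la s) (hb : Tot lb (img r s)) :
    ∑ t ∈ T, incidence r la lb t s * incidence r la lb q t = 0 := by
  classical
  by_cases hex : ∃ t ∈ T, incidence r la lb t s * incidence r la lb q t ≠ 0
  swap
  · push Not at hex
    exact Finset.sum_eq_zero hex
  obtain ⟨t, -, ht⟩ := hex
  obtain ⟨a, hta⟩ := exists_del la lb (left_ne_zero_of_mul ht)
  obtain ⟨b, hqb⟩ := exists_del la lb (right_ne_zero_of_mul ht)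
  have hB := ha.before hb
  have hbs : b ∈ s := hta.subset hqb.mem
  have hba : b ≠ a := ((hta.iff b).1 hqb.mem).2
  have hq : ∀ c, c ∈ q ↔ c ∈ s ∧ c ≠ a ∧ c ≠ b := fun c => by
    rw [hqb.iff, hta.iff, and_assoc]
  have ira : r a ∈ img r q := by
    rw [hqb.img_eq]
    exact hta.im
  -- the other intermediate set
  have key : ∀ a b : α, a ∈ s → b ∈ s → b ≠ a → (∀ c, c ∈ q ↔ c ∈ s ∧ c ≠ a ∧ c ≠ b) →
      r a ∈ img r q → r b ∈ img r q →
      Del r (s.erase a) s a ∧ Del r q (s.erase a) b := by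
    intro a b has hbs hba hq ira irb
    have hsub : q ⊆ s.erase a := fun c hc =>
      Finset.mem_erase.2 ⟨((hq c).1 hc).2.1, ((hq c).1 hc).1⟩
    refine ⟨⟨has, fun c => by rw [Finset.mem_erase, and_comm], img_mono r hsub ira⟩,
      ⟨Finset.mem_erase.2 ⟨hba, hbs⟩, fun c => by
        rw [hq, Finset.mem_erase]
        tauto, irb⟩⟩
  obtain ⟨A1, A2⟩ := key a b hta.mem hbs hba hq ira hqb.im
  obtain ⟨B1, B2⟩ := key b a hbs hta.mem hba.symm (fun c => by rw [hq]; tauto) hqb.im ira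
  have hne : s.erase a ≠ s.erase b := fun e => by
    have : a ∈ s.erase b := Finset.mem_erase.2 ⟨hba.symm, hta.mem⟩
    rw [← e] at this
    exact Finset.notMem_erase a s this
  have hcount : ∀ a b : α, a ∈ s → b ∈ s → Before r la lb a b →
      (∀ (_ : Del r (s.erase a) s a) (_ : Del r (s.erase b) s b),
        signExp r la lb s b = signExp r la lb (s.erase a) b + 1 ∧
        signExp r la lb s a = signExp r la lb (s.erase b) a) := by
    intro a b has hbs hab A1 B1
    unfold signExp
    rw [A1.img_eq, B1.img_eq]
    have e1 : (s.erase a).filter (fun c => Before r la lb c b)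
        = (s.filter fun c => Before r la lb c b).erase a := by
      rw [Finset.filter_erase]
    have e2 : (s.erase b).filter (fun c => Before r la lb c a)
        = s.filter fun c => Before r la lb c a := by
      rw [Finset.filter_erase]
      refine Finset.erase_eq_of_notMem fun h => ?_
      exact hB.irrefl _ (hB.trans _ _ _ (Finset.mem_filter.1 h).2 hab)
    have e3 : a ∈ s.filter fun c => Before r la lb c b := Finset.mem_filter.2 ⟨has, hab⟩
    have e4 := Finset.card_erase_add_one e3
    refine ⟨?_, ?_⟩
    · rw [e1]
      omega
    · rw [e2]
  have hsum : ∑ t ∈ T, incidence r la lb t s * incidence r la lb q t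
      = ∑ t ∈ ({s.erase a, s.erase b} : Finset (Finset α)),
        incidence r la lb t s * incidence r la lb q t := by
    symm
    refine Finset.sum_subset ?_ fun t _ ht => ?_
    · intro t ht
      rcases Finset.mem_insert.1 ht with rfl | h
      · exact hT _ A2.subset A1.subset
      · rw [Finset.mem_singleton.1 h]
        exact hT _ B2.subset B1.subset
    · by_contra hne
      obtain ⟨c, htc⟩ := exists_del la lb (left_ne_zero_of_mul hne)
      obtain ⟨d, hqd⟩ := exists_del la lb (right_ne_zero_of_mul hne)
      have hc : c ∉ q := fun h => htc.notMem (hqd.subset h)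
      have hcab : c = a ∨ c = b := by
        by_contra h
        exact hc ((hq c).2 ⟨htc.mem, fun e => h (Or.inl e), fun e => h (Or.inr e)⟩)
      have htc' : t = s.erase c := Finset.ext fun d => by
        rw [htc.iff, Finset.mem_erase, and_comm]
      refine ht (Finset.mem_insert.2 (hcab.imp ?_ ?_))
      · rintro rfl
        exact htc'
      · rintro rfl
        exact Finset.mem_singleton.2 htc'
  rw [hsum, Finset.sum_pair hne, incidence_eq la lb A1, incidence_eq la lb A2,
    incidence_eq la lb B1, incidence_eq la lb B2]
  rcases hB.total a hta.mem b hbs hba.symm with h | h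
  · obtain ⟨e1, e2⟩ := hcount a b hta.mem hbs h A1 B1
    rw [e1, e2]
    ring
  · obtain ⟨e1, e2⟩ := hcount b a hbs hta.mem h B1 A1
    rw [e1, e2]
    ring

open Classical in
/-- The boundary maps commute with restriction to parallel faces. -/
theorem sum_parallel_incidence {q s : Finset α} (T : Finset (Finset α))
    (hT : ∀ t, q ⊆ t → t ⊆ s → t ∈ T) (ha : Tot la s) (hb : Tot lb (img r s)) :
    ∑ t ∈ T, (if IsParallel r t s then incidence r la lb q t else 0)
      = ∑ t ∈ T, (if IsParallel r q t then incidence r la lb t s else 0) := by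
  have hB := ha.before hb
  by_cases hqs : q ⊆ s
  swap
  · rw [Finset.sum_eq_zero, Finset.sum_eq_zero]
    · intro t _
      split_ifs with h
      · by_contra hne
        obtain ⟨c, htc⟩ := exists_del la lb hne
        exact hqs (h.1.trans htc.subset)
      · rfl
    · intro t _
      split_ifs with h
      · by_contra hne
        obtain ⟨c, htc⟩ := exists_del la lb hne
        exact hqs (htc.subset.trans h.1)
      · rfl
  by_cases hex : ∃ a ∈ s, a ∉ q ∧ r a ∈ img r q
  · obtain ⟨a, has, haq, hra⟩ := hex
    have D1 : Del r q (insert a q) a :=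
      ⟨Finset.mem_insert_self _ _, fun b => by
        rw [Finset.mem_insert]
        constructor
        · exact fun h => ⟨Or.inr h, fun e => haq (e ▸ h)⟩
        · rintro ⟨h | h, h'⟩
          · exact (h' h).elim
          · exact h, hra⟩
    have hqe : q ⊆ s.erase a := fun c hc =>
      Finset.mem_erase.2 ⟨fun e => haq (e ▸ hc), hqs hc⟩
    have hins : insert a q ⊆ s := fun c hc => by
      rcases Finset.mem_insert.1 hc with rfl | h
      · exact has
      · exact hqs h
    have D2 : Del r (s.erase a) s a :=
      ⟨has, fun c => by rw [Finset.mem_erase, and_comm], img_mono r hqe hra⟩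
    rw [Finset.sum_eq_single (insert a q), Finset.sum_eq_single (s.erase a)]
    · have hiff : IsParallel r (insert a q) s ↔ IsParallel r q (s.erase a) := by
        rw [isParallel_iff r hins, isParallel_iff r hqe, ← D1.img_eq]
        have e1 : ∀ b, b ∈ s ∧ b ∉ insert a q ↔ b ∈ s.erase a ∧ b ∉ q := fun b => by
          rw [Finset.mem_insert, Finset.mem_erase]
          tauto
        constructor
        · rintro ⟨h1, h2⟩
          refine ⟨fun b hb hbq c hc hcq => ?_, fun b hb hbq => ?_⟩
          · obtain ⟨x1, x2⟩ := (e1 b).2 ⟨hb, hbq⟩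
            obtain ⟨y1, y2⟩ := (e1 c).2 ⟨hc, hcq⟩
            exact h1 b x1 x2 c y1 y2
          · obtain ⟨x1, x2⟩ := (e1 b).2 ⟨hb, hbq⟩
            exact h2 b x1 x2
        · rintro ⟨h1, h2⟩
          refine ⟨fun b hb hbq c hc hcq => ?_, fun b hb hbq => ?_⟩
          · obtain ⟨x1, x2⟩ := (e1 b).1 ⟨hb, hbq⟩
            obtain ⟨y1, y2⟩ := (e1 c).1 ⟨hc, hcq⟩
            exact h1 b x1 x2 c y1 y2
          · obtain ⟨x1, x2⟩ := (e1 b).1 ⟨hb, hbq⟩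
            exact h2 b x1 x2
      by_cases hp : IsParallel r q (s.erase a)
      swap
      · rw [if_neg hp, if_neg (hiff.not.2 hp)]
      rw [if_pos hp, if_pos (hiff.2 hp), incidence_eq la lb D1, incidence_eq la lb D2]
      obtain ⟨hi, ho⟩ := (isParallel_iff r hqe).1 hp
      -- the extra vertices before `a` correspond to their images
      let M := (s.erase a \ q).filter fun b => lb (r b) (r a)
      have hM : ∀ b, b ∈ M ↔ (b ∈ s ∧ b ≠ a ∧ b ∉ q) ∧ lb (r b) (r a) := fun b => by
        simp only [M, Finset.mem_filter, Finset.mem_sdiff, Finset.mem_erase]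
        tauto
      have c1 : (s.filter fun b => Before r la lb b a)
          = ((insert a q).filter fun b => Before r la lb b a) ∪ M := by
        refine Finset.ext fun b => ?_
        rw [Finset.mem_union, hM, Finset.mem_filter, Finset.mem_filter, Finset.mem_insert]
        constructor
        · rintro ⟨hbs, hba⟩
          have hne : b ≠ a := fun e => hB.irrefl a (by rw [e] at hba; exact hba)
          by_cases hbq : b ∈ q
          · exact Or.inl ⟨Or.inr hbq, hba⟩
          · refine Or.inr ⟨⟨hbs, hne, hbq⟩, ?_⟩
            rcases hba with h | ⟨h, -⟩
            · exact h
            · exact (ho b (Finset.mem_erase.2 ⟨hne, hbs⟩) hbq (h ▸ hra)).elim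
        · rintro (⟨h | h, h'⟩ | ⟨h, h'⟩)
          · exact ⟨h ▸ has, h'⟩
          · exact ⟨hqs h, h'⟩
          · exact ⟨h.1, Or.inl h'⟩
      have c2 : ((img r s).filter fun x => lb x (r a))
          = ((img r (insert a q)).filter fun x => lb x (r a)) ∪ M.image r := by
        refine Finset.ext fun x => ?_
        rw [Finset.mem_union, Finset.mem_filter, Finset.mem_filter, Finset.mem_image, ← D1.img_eq]
        constructor
        · rintro ⟨hx, hxa⟩
          obtain ⟨b, hb, rfl⟩ := mem_img.1 hx
          by_cases hbq : r b ∈ img r q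
          · exact Or.inl ⟨hbq, hxa⟩
          · refine Or.inr ⟨b, (hM b).2 ⟨⟨hb, fun e => hbq (e ▸ hra), fun h => hbq ?_⟩, hxa⟩, rfl⟩
            exact apply_mem_img r h
        · rintro (⟨h, h'⟩ | ⟨b, hb, rfl⟩)
          · exact ⟨img_mono r hqs h, h'⟩
          · exact ⟨apply_mem_img r ((hM b).1 hb).1.1, ((hM b).1 hb).2⟩
      have d1 : Disjoint ((insert a q).filter fun b => Before r la lb b a) M := by
        refine Finset.disjoint_left.2 fun b hb hbM => ?_
        obtain ⟨⟨-, h1, h2⟩, -⟩ := (hM b).1 hbM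
        rcases Finset.mem_insert.1 (Finset.mem_filter.1 hb).1 with h | h
        · exact h1 h
        · exact h2 h
      have d2 : Disjoint ((img r (insert a q)).filter fun x => lb x (r a)) (M.image r) := by
        refine Finset.disjoint_left.2 fun x hx hxM => ?_
        obtain ⟨b, hb, rfl⟩ := Finset.mem_image.1 hxM
        obtain ⟨⟨h0, h1, h2⟩, -⟩ := (hM b).1 hb
        have := (Finset.mem_filter.1 hx).1
        rw [← D1.img_eq] at this
        exact ho b (Finset.mem_erase.2 ⟨h1, h0⟩) h2 this
      have c3 : (M.image r).card = M.card := Finset.card_image_iff.2 fun b hb c hc hbc => by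
        obtain ⟨⟨b0, b1, b2⟩, -⟩ := (hM b).1 hb
        obtain ⟨⟨c0, c1, c2⟩, -⟩ := (hM c).1 hc
        exact hi b (Finset.mem_erase.2 ⟨b1, b0⟩) b2 c (Finset.mem_erase.2 ⟨c1, c0⟩) c2 hbc
      have c4 : signExp r la lb s a = signExp r la lb (insert a q) a + 2 * M.card := by
        unfold signExp
        rw [c1, c2, Finset.card_union_of_disjoint d1, Finset.card_union_of_disjoint d2, c3]
        omega
      rw [c4, pow_add, pow_mul]
      simp
    · intro t _ hta
      split_ifs with hp
      · by_contra hne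
        obtain ⟨b, hb⟩ := exists_del la lb hne
        have hbq : b ∉ q := fun h => hb.notMem (hp.1 h)
        have hba : a ≠ b := by
          rintro rfl
          exact hta (Finset.ext fun c => by rw [hb.iff, Finset.mem_erase, and_comm])
        exact ((isParallel_iff r hp.1).1 hp).2 a ((hb.iff a).2 ⟨has, hba⟩) haq hra
      · rfl
    · exact fun h => (h (hT _ hqe (Finset.erase_subset _ _))).elim
    · intro t _ hta
      split_ifs with hp
      · by_contra hne
        obtain ⟨b, hb⟩ := exists_del la lb hne
        have hat : a ∉ t := fun h => by
          have hab := hb.eq h haq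
          refine hta (Finset.ext fun c => ?_)
          rw [Finset.mem_insert, hb.iff]
          constructor
          · intro hc
            by_cases e : c = a
            · exact Or.inl e
            · exact Or.inr ⟨hc, fun e' => e (e'.trans hab.symm)⟩
          · rintro (e | e)
            · exact e ▸ h
            · exact e.1
        exact ((isParallel_iff r hp.1).1 hp).2 a has hat (img_mono r hb.subset hra)
      · rfl
    · exact fun h => (h (hT _ (Finset.subset_insert _ _) hins)).elim
  · push Not at hex
    rw [Finset.sum_eq_zero]
    swap
    · intro t _
      split_ifs with hp
      · by_contra hne
        obtain ⟨b, hb⟩ := exists_del la lb hne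
        exact hex b (hp.1 hb.mem) hb.notMem hb.im
      · rfl
    symm
    by_cases hex2 : ∃ t ∈ T, (if IsParallel r q t then incidence r la lb t s else 0) ≠ 0
    swap
    · push Not at hex2
      exact Finset.sum_eq_zero hex2
    obtain ⟨t, -, ht⟩ := hex2
    have hp : IsParallel r q t := by
      by_contra h
      exact ht (if_neg h)
    rw [if_pos hp] at ht
    obtain ⟨a, hta⟩ := exists_del la lb ht
    obtain ⟨b, hbt, hba⟩ := mem_img.1 hta.im
    obtain ⟨hi, ho⟩ := (isParallel_iff r hp.1).1 hp
    have haq : a ∉ q := fun h => hta.notMem (hp.1 h)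
    have hbs := hta.subset hbt
    have hne : b ≠ a := ((hta.iff b).1 hbt).2
    have hbq : b ∉ q := fun h => hex a hta.mem haq (hba ▸ apply_mem_img r h)
    have hqb : q ⊆ s.erase b := fun c hc =>
      Finset.mem_erase.2 ⟨fun e => hbq (e ▸ hc), hqs hc⟩
    have fib : ∀ c ∈ s, r c = r a → c = a ∨ c = b := fun c hc hca => by
      by_cases e : c = a
      · exact Or.inl e
      · have hcq : c ∉ q := fun h => hex a hta.mem haq (hca ▸ apply_mem_img r h)
        exact Or.inr (hi c ((hta.iff c).2 ⟨hc, e⟩) hcq b hbt hbq (hca.trans hba.symm))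
    have hp' : IsParallel r q (s.erase b) := by
      rw [isParallel_iff r hqb]
      refine ⟨fun c hc hcq d hd hdq hcd => ?_, fun c hc hcq => ?_⟩
      · obtain ⟨hcb, hcs⟩ := Finset.mem_erase.1 hc
        obtain ⟨hdb, hds⟩ := Finset.mem_erase.1 hd
        by_cases hca : c = a
        · rcases fib d hds (by rw [← hcd, hca]) with e | e
          · rw [hca, e]
          · exact (hdb e).elim
        · by_cases hda : d = a
          · rcases fib c hcs (by rw [hcd, hda]) with e | e
            · exact (hca e).elim
            · exact (hcb e).elim
          · exact hi c ((hta.iff c).2 ⟨hcs, hca⟩) hcq d ((hta.iff d).2 ⟨hds, hda⟩) hdq hcd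
      · exact hex c (Finset.mem_erase.1 hc).2 hcq
    have hdb : Del r (s.erase b) s b :=
      ⟨hbs, fun c => by rw [Finset.mem_erase, and_comm],
        hba ▸ apply_mem_img r (Finset.mem_erase.2 ⟨hne.symm, hta.mem⟩)⟩
    have hneq : t ≠ s.erase b := fun e => hdb.notMem (e ▸ hbt)
    have hsum : ∑ t ∈ T, (if IsParallel r q t then incidence r la lb t s else 0)
        = ∑ t ∈ ({t, s.erase b} : Finset (Finset α)),
          (if IsParallel r q t then incidence r la lb t s else 0) := by
      symm
      refine Finset.sum_subset ?_ fun t' _ ht' => ?_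
      · intro t' ht'
        rcases Finset.mem_insert.1 ht' with rfl | h
        · exact hT _ hp.1 hta.subset
        · rw [Finset.mem_singleton.1 h]
          exact hT _ hqb hdb.subset
      · by_contra hne'
        have hpc : IsParallel r q t' := by
          by_contra h
          exact hne' (if_neg h)
        rw [if_pos hpc] at hne'
        obtain ⟨c, htc⟩ := exists_del la lb hne'
        refine ht' (Finset.mem_insert.2 ?_)
        by_cases hca : c = a
        · exact Or.inl (Finset.ext fun d => by rw [htc.iff, hta.iff, hca])
        by_cases hcb : c = b
        · exact Or.inr (Finset.mem_singleton.2 (Finset.ext fun d => by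
            rw [htc.iff, hdb.iff, hcb]))
        have h1 : a ∈ t' := (htc.iff a).2 ⟨hta.mem, Ne.symm hca⟩
        have h2 : b ∈ t' := (htc.iff b).2 ⟨hbs, Ne.symm hcb⟩
        exact (hne (((isParallel_iff r hpc.1).1 hpc).1 b h2 hbq a h1 haq hba)).elim
    rw [hsum, Finset.sum_pair hneq, if_pos hp, if_pos hp', incidence_eq la lb hta,
      incidence_eq la lb hdb]
    have hcount : ∀ a b : α, a ∈ s → b ∈ s → r b = r a → Before r la lb a b →
        (∀ c ∈ s, r c = r a → c = a ∨ c = b) →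
        signExp r la lb s b = signExp r la lb s a + 1 := by
      intro a b has hbs hba hab fib
      have e1 : (s.filter fun c => Before r la lb c b)
          = insert a (s.filter fun c => Before r la lb c a) := by
        refine Finset.ext fun c => ?_
        rw [Finset.mem_insert, Finset.mem_filter, Finset.mem_filter]
        constructor
        · rintro ⟨hc, hcb⟩
          by_cases e : r c = r a
          · rcases fib c hc e with h | h
            · exact Or.inl h
            · rw [h] at hcb
              exact (hB.irrefl b hcb).elim
          · refine Or.inr ⟨hc, ?_⟩
            rcases hcb with h | ⟨h, -⟩
            · exact Or.inl (hba ▸ h)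
            · exact (e (h.trans hba)).elim
        · rintro (rfl | ⟨hc, h⟩)
          · exact ⟨has, hab⟩
          · exact ⟨hc, hB.trans _ _ _ h hab⟩
      unfold signExp
      rw [e1, Finset.card_insert_of_notMem, hba]
      · omega
      · exact fun h => hB.irrefl a (Finset.mem_filter.1 h).2
    rcases hB.total a hta.mem b hbs hne.symm with h | h
    · rw [hcount a b hta.mem hbs hba h fib]
      ring
    · rw [hcount b a hbs hta.mem hba.symm h fun c hc hcb => (fib c hc (hcb.trans hba)).symm]
      ring

end Comb
/-! ### Algebraic subdivision -/

/-- The two kinds of category `A(X)`. -/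
inductive Variance
  | cov
  | contra

/-- For `cov` components go from a simplex to its faces; for `contra` they go from a simplex to
the simplices that contain it. -/
def Variance.rel (v : Variance) (X : LFComplex.{u}) : SuppRel X.Simplex :=
  match v with
  | cov => ⟨fun t s => t ≤ s, le_refl, fun _ _ _ => le_trans⟩
  | contra => ⟨fun t s => s ≤ t, le_refl, fun _ _ _ h h' => le_trans h' h⟩

theorem Variance.finite_rel (v : Variance) {X : LFComplex.{u}} (s : X.Simplex) :
    {t | (v.rel X).rel t s}.Finite := by
  cases v
  · exact LFComplex.finite_faces s
  · exact LFComplex.finite_cofaces s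

/-- The category `A^*(X)` (for `cov`) or `A_*(X)` (for `contra`). -/
abbrev ControlledCat (v : Variance) (X : LFComplex.{u}) (A : Type w) := Graded (v.rel X) A

/-- The category `G_X(A)` of `X`-graded objects. -/
abbrev GradedCat (X : LFComplex.{u}) (A : Type w) := Graded (SuppRel.all X.Simplex) A

namespace LFComplex

variable {X : LFComplex.{u}}

/-- The simplex of `X` onto which `r` maps a simplex `s` of `Sd X`. -/
def Approx.image (r : X.Approx) (s : X.sd.Simplex) : X.Simplex :=
  ⟨Comb.img r.toFun s.1, by
    obtain ⟨m, hm, hmax⟩ := s.1.exists_maximal s.nonempty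
    refine mem_faces_of_subset (X := X) m ?_ ?_
    · intro x hx
      obtain ⟨t, ht, rfl⟩ := Comb.mem_img.1 hx
      have htm : t ≤ m := by
        rcases s.2.2.total ht hm with h | h
        · exact h
        · exact hmax ht h
      exact htm (r.mem t)
    · obtain ⟨a, ha⟩ := s.nonempty
      exact ⟨_, Comb.apply_mem_img r.toFun ha⟩⟩

/-- The number `|s| - |r(s)|` for a simplex `s` of `Sd X`. -/
def Approx.depth (r : X.Approx) (s : X.sd.Simplex) : ℤ := Comb.depth r.toFun s.1

/-- The incidence number of `t` in the boundary of `s`, for `r(t) = r(s)` (and zero otherwise).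
It is the incidence number of `s`, oriented as the product of its fibres over `r(s)`. -/
def Approx.incidence (r : X.Approx) (o : X.VertexOrder) (t s : X.sd.Simplex) : ℤ :=
  Comb.incidence (β := X.V) r.toFun (fun a b : X.Simplex => a < b) o.lt t.1 s.1

/-- `t` is a face of `s` with `|t| - |r(t)| = |s| - |r(s)|`. -/
def Approx.IsParallel (r : X.Approx) (t s : X.sd.Simplex) : Prop :=
  Comb.IsParallel r.toFun t.1 s.1

end LFComplex

open LFComplex

namespace Variance

variable {X : LFComplex.{u}} (v : Variance) (r : X.Approx) (o : X.VertexOrder)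

/-- The shift of degrees over the simplex `s` of `Sd X`. -/
def shift (s : X.sd.Simplex) : ℤ :=
  match v with
  | cov => - r.depth s
  | contra => r.depth s

/-- The components of the subdivided differential that come from the original differential go
between parallel simplices. -/
def IsParallel (t s : X.sd.Simplex) : Prop :=
  match v with
  | cov => r.IsParallel t s
  | contra => r.IsParallel s t

/-- The coefficients of the components of the subdivided differential that come from the
(co)boundary of the fibres of `r`. -/
def incidence (t s : X.sd.Simplex) : ℤ :=
  match v with
  | cov => r.incidence o t s
  | contra => r.incidence o s t

/-- The finite set of the simplices that components from `s` to `q` can pass through. -/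
def between (q s : X.Simplex) : Finset X.Simplex :=
  ((v.finite_rel s).inter_of_left {t | (v.rel X).rel q t}).toFinset

variable {v r o}

theorem mem_between {q s t : X.Simplex} :
    t ∈ v.between q s ↔ (v.rel X).rel t s ∧ (v.rel X).rel q t := by
  simp [between]

theorem IsParallel.rel {t s : X.sd.Simplex} (h : v.IsParallel r t s) :
    (v.rel X.sd).rel t s := by
  cases v
  · exact h.1
  · exact h.1

theorem IsParallel.rel_image {t s : X.sd.Simplex} (h : v.IsParallel r t s) :
    (v.rel X).rel (r.image t) (r.image s) := by
  cases v
  · exact Comb.img_mono _ h.1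
  · exact Comb.img_mono _ h.1

theorem IsParallel.shift_eq {t s : X.sd.Simplex} (h : v.IsParallel r t s) :
    v.shift r t = v.shift r s := by
  cases v
  · exact congrArg Neg.neg h.2
  · exact h.2.symm

theorem IsParallel.trans {q t s : X.sd.Simplex} (h : v.IsParallel r q t)
    (h' : v.IsParallel r t s) : v.IsParallel r q s := by
  cases v
  · exact Comb.IsParallel.trans h h'
  · exact Comb.IsParallel.trans h' h

theorem IsParallel.exists {q s : X.sd.Simplex} (h : v.IsParallel r q s) (y : X.Simplex)
    (h1 : (v.rel X).rel y (r.image s)) (h2 : (v.rel X).rel (r.image q) y) :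
    ∃ t, v.IsParallel r q t ∧ v.IsParallel r t s ∧ r.image t = y := by
  cases v
  · obtain ⟨t, ht, ht', e⟩ := Comb.exists_parallel r.toFun h y.1 h2 h1
    exact ⟨⟨t, mem_faces_of_subset (X := X.sd) s ht'.1 (q.nonempty.mono ht.1)⟩, ht, ht',
      Subtype.ext e⟩
  · obtain ⟨t, ht, ht', e⟩ := Comb.exists_parallel r.toFun h y.1 h1 h2
    exact ⟨⟨t, mem_faces_of_subset (X := X.sd) q ht'.1 (s.nonempty.mono ht.1)⟩, ht', ht,
      Subtype.ext e⟩

theorem IsParallel.eq_of_image_eq {q t t' s : X.sd.Simplex} (h1 : v.IsParallel r q t)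
    (h2 : v.IsParallel r t s) (h1' : v.IsParallel r q t') (h2' : v.IsParallel r t' s)
    (e : r.image t = r.image t') : t = t' := by
  cases v
  · exact Subtype.ext (Comb.IsParallel.ext h2 h2' (congrArg Subtype.val e))
  · exact Subtype.ext (Comb.IsParallel.ext h1 h1' (congrArg Subtype.val e))

theorem of_incidence {t s : X.sd.Simplex} (h : v.incidence r o t s ≠ 0) :
    (v.rel X.sd).rel t s ∧ r.image s = r.image t ∧ v.shift r t = v.shift r s + 1 := by
  cases v
  · obtain ⟨a, ha⟩ := Comb.exists_del _ _ h
    have h1 := ha.depth_eq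
    refine ⟨ha.subset, Subtype.ext ha.img_eq.symm, ?_⟩
    simp only [shift, Approx.depth]
    omega
  · obtain ⟨a, ha⟩ := Comb.exists_del _ _ h
    exact ⟨ha.subset, Subtype.ext ha.img_eq, ha.depth_eq⟩

theorem tot_lt (s : X.sd.Simplex) : Comb.Tot (fun a b : X.Simplex => a < b) s.1 :=
  ⟨X.sdOrder.irrefl, X.sdOrder.trans, X.sdOrder.total s⟩

theorem tot_order (o : X.VertexOrder) (s : X.sd.Simplex) :
    Comb.Tot o.lt (Comb.img (β := X.V) r.toFun s.1) :=
  ⟨o.irrefl, o.trans, o.total (r.image s)⟩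

theorem sum_transfer {q s : X.sd.Simplex} (F : Finset X.Simplex → ℤ) :
    ∑ t ∈ cov.between (X := X.sd) q s, F t.1
      = ∑ t ∈ (cov.between (X := X.sd) q s).map (Function.Embedding.subtype _), F t := by
  rw [Finset.sum_map]
  rfl

theorem between_contra (q s : X.Simplex) : contra.between q s = cov.between s q :=
  Finset.ext fun t => by
    rw [mem_between, mem_between]
    exact and_comm

theorem mem_transfer {q s : X.sd.Simplex} (t : Finset X.Simplex) (h : q.1 ⊆ t) (h' : t ⊆ s.1) :
    t ∈ (cov.between (X := X.sd) q s).map (Function.Embedding.subtype _) :=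
  Finset.mem_map.2 ⟨⟨t, mem_faces_of_subset (X := X.sd) s h' (q.nonempty.mono h)⟩,
    mem_between.2 ⟨h', h⟩, rfl⟩

variable (v r o)

theorem sum_incidence_incidence (q s : X.sd.Simplex) :
    ∑ t ∈ v.between (X := X.sd) q s, v.incidence r o t s * v.incidence r o q t = 0 := by
  cases v
  · rw [← Comb.sum_incidence_incidence _ (mem_transfer (q := q) (s := s)) (tot_lt s)
      (tot_order (r := r) o s)]
    exact sum_transfer fun t =>
      Comb.incidence (β := X.V) r.toFun (fun a b : X.Simplex => a < b) o.lt t s.1 *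
      Comb.incidence (β := X.V) r.toFun (fun a b : X.Simplex => a < b) o.lt q.1 t
  · rw [between_contra, ← Comb.sum_incidence_incidence _ (mem_transfer (q := s) (s := q)) (tot_lt q)
      (tot_order (r := r) o q)]
    refine Eq.trans (Finset.sum_congr rfl fun t _ => mul_comm _ _) ?_
    exact sum_transfer (q := s) (s := q) fun t =>
      Comb.incidence (β := X.V) r.toFun (fun a b : X.Simplex => a < b) o.lt t q.1 *
      Comb.incidence (β := X.V) r.toFun (fun a b : X.Simplex => a < b) o.lt s.1 t

open Classical in
theorem sum_parallel_incidence (q s : X.sd.Simplex) :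
    ∑ t ∈ v.between (X := X.sd) q s, (if v.IsParallel r t s then v.incidence r o q t else 0)
      = ∑ t ∈ v.between (X := X.sd) q s,
        (if v.IsParallel r q t then v.incidence r o t s else 0) := by
  cases v
  · have h := Comb.sum_parallel_incidence _ (mem_transfer (q := q) (s := s)) (tot_lt s)
      (tot_order (r := r) o s)
    rw [← sum_transfer, ← sum_transfer] at h
    exact h
  · have h := Comb.sum_parallel_incidence _ (mem_transfer (q := s) (s := q)) (tot_lt q)
      (tot_order (r := r) o q)
    rw [← sum_transfer, ← sum_transfer] at h
    rw [between_contra]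
    exact h.symm

end Variance

section Subdivision

variable {X : LFComplex.{u}} {A : Type w} [Category.{v} A] [Preadditive A]
variable {a : Variance}

open Classical in
/-- The identity of the object of `C` in degree `k` over `y`, if `k = l` and `y = z`. -/
def transport (C : ChainComplex (ControlledCat a X A) ℤ) (k : ℤ) (y : X.Simplex) (l : ℤ)
    (z : X.Simplex) : (C.X k).obj y ⟶ (C.X l).obj z :=
  if h : k = l ∧ y = z then eqToHom (by rw [h.1, h.2]) else 0

open Classical in
/-- The component from `s` to `t` of the differential of the subdivision. -/
def sdComponent (r : X.Approx) (o : X.VertexOrder) (C : ChainComplex (ControlledCat a X A) ℤ)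
    (n m : ℤ) (t s : X.sd.Simplex) :
    (C.X (n + a.shift r s)).obj (r.image s) ⟶ (C.X (m + a.shift r t)).obj (r.image t) :=
  (if a.IsParallel r t s then
    Graded.Hom.f (C.d (n + a.shift r s) (m + a.shift r t)) (r.image t) (r.image s) else 0) +
  ((n.negOnePow : ℤ) * a.incidence r o t s) •
    transport C (n + a.shift r s) (r.image s) (m + a.shift r t) (r.image t)

variable {r : X.Approx} {o : X.VertexOrder} {C : ChainComplex (ControlledCat a X A) ℤ}

theorem sdComponent_supp (n m : ℤ) (t s : X.sd.Simplex) (h : ¬ (a.rel X.sd).rel t s) :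
    sdComponent r o C n m t s = 0 := by
  have h1 : a.incidence r o t s = 0 := by
    by_contra h1
    exact h (Variance.of_incidence h1).1
  unfold sdComponent
  rw [if_neg fun h2 => h h2.rel, h1, mul_zero, zero_smul, add_zero]

open Classical in
theorem sdComponent_shape (n m : ℤ) (t s : X.sd.Simplex) (h : m + 1 ≠ n) :
    sdComponent r o C n m t s = 0 := by
  unfold sdComponent
  rw [add_eq_zero_iff_eq_neg]
  have h1 : (if a.IsParallel r t s then
      Graded.Hom.f (C.d (n + a.shift r s) (m + a.shift r t)) (r.image t) (r.image s) else 0)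
      = 0 := by
    split_ifs with hp
    · rw [C.shape]
      · rfl
      · have := hp.shift_eq
        simp only [ComplexShape.down_Rel]
        omega
    · rfl
  rw [h1, eq_comm, neg_eq_zero]
  by_cases h2 : a.incidence r o t s = 0
  · rw [h2, mul_zero, zero_smul]
  · have := (Variance.of_incidence h2).2.2
    unfold transport
    rw [dif_neg, smul_zero]
    rintro ⟨h3, -⟩
    omega

theorem d_transport {j k l : ℤ} {q y z : X.Simplex} (h : k = l) (h' : y = z) :
    Graded.Hom.f (C.d j k) y q ≫ transport C k y l z = Graded.Hom.f (C.d j l) z q := by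
  subst h h'
  simp [transport]

theorem transport_d {j k l : ℤ} {q y z : X.Simplex} (h : k = l) (h' : y = z) :
    transport C k y l z ≫ Graded.Hom.f (C.d l j) q z = Graded.Hom.f (C.d k j) q y := by
  subst h h'
  simp [transport]

theorem transport_transport {k l m : ℤ} {y z x : X.Simplex} (h : k = l) (h' : y = z) :
    transport C k y l z ≫ transport C l z m x = transport C k y m x := by
  subst h h'
  simp [transport]

open Classical in
theorem sum_parallel_parallel (n m k : ℤ) (q s : X.sd.Simplex) :
    ∑ t ∈ a.between (X := X.sd) q s,
      (if a.IsParallel r t s then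
        Graded.Hom.f (C.d (n + a.shift r s) (m + a.shift r t)) (r.image t) (r.image s) else 0) ≫
      (if a.IsParallel r q t then
        Graded.Hom.f (C.d (m + a.shift r t) (k + a.shift r q)) (r.image q) (r.image t) else 0)
      = 0 := by
  by_cases hqs : a.IsParallel r q s
  swap
  · refine Finset.sum_eq_zero fun t _ => ?_
    by_cases h1 : a.IsParallel r t s
    · rw [if_neg fun h2 : a.IsParallel r q t => hqs (h2.trans h1), comp_zero]
    · rw [if_neg h1, zero_comp]
  have h0 : ∑ y ∈ a.between (r.image q) (r.image s),
      Graded.Hom.f (C.d (n + a.shift r s) (m + a.shift r s)) y (r.image s) ≫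
      Graded.Hom.f (C.d (m + a.shift r s) (k + a.shift r q)) (r.image q) y = 0 := by
    have h1 := Graded.comp_f (C.d (n + a.shift r s) (m + a.shift r s))
      (C.d (m + a.shift r s) (k + a.shift r q)) (r.image q) (r.image s)
    rw [C.d_comp_d, Graded.zero_f, finsum_eq_sum_of_support_subset] at h1
    · exact h1.symm
    · intro y hy
      refine Finset.mem_coe.2 (Variance.mem_between.2 ⟨?_, ?_⟩)
      · by_contra h
        exact hy (by
          change _ ≫ _ = _
          rw [Graded.Hom.supp _ _ _ h, zero_comp])
      · by_contra h
        exact hy (by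
          change _ ≫ _ = _
          rw [Graded.Hom.supp _ _ _ h, comp_zero])
  rw [← h0]
  have hz : ∀ t, t ∈ a.between (X := X.sd) q s → ¬ (a.IsParallel r t s ∧ a.IsParallel r q t) →
      (if a.IsParallel r t s then
        Graded.Hom.f (C.d (n + a.shift r s) (m + a.shift r t)) (r.image t) (r.image s) else 0) ≫
      (if a.IsParallel r q t then
        Graded.Hom.f (C.d (m + a.shift r t) (k + a.shift r q)) (r.image q) (r.image t) else 0)
      = 0 := by
    intro t _ h
    by_cases h1 : a.IsParallel r t s
    · rw [if_neg fun h2 : a.IsParallel r q t => h ⟨h1, h2⟩, comp_zero]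
    · rw [if_neg h1, zero_comp]
  rw [← Finset.sum_filter_of_ne (p := fun t => a.IsParallel r t s ∧ a.IsParallel r q t)
    fun t ht hne => by
      by_contra h
      exact hne (hz t ht h)]
  refine Finset.sum_bij (fun t _ => r.image t) ?_ ?_ ?_ ?_
  · intro t ht
    obtain ⟨-, h1, h2⟩ := Finset.mem_filter.1 ht
    exact Variance.mem_between.2 ⟨h1.rel_image, h2.rel_image⟩
  · intro t ht t' ht' e
    obtain ⟨-, h1, h2⟩ := Finset.mem_filter.1 ht
    obtain ⟨-, h1', h2'⟩ := Finset.mem_filter.1 ht'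
    exact h2.eq_of_image_eq h1 h2' h1' e
  · intro y hy
    obtain ⟨h1, h2⟩ := Variance.mem_between.1 hy
    obtain ⟨t, h3, h4, rfl⟩ := hqs.exists y h1 h2
    exact ⟨t, Finset.mem_filter.2 ⟨Variance.mem_between.2 ⟨h4.rel, h3.rel⟩, h4, h3⟩, rfl⟩
  · intro t ht
    obtain ⟨-, h1, h2⟩ := Finset.mem_filter.1 ht
    rw [if_pos h1, if_pos h2, h1.shift_eq]

theorem sum_sdComponent (n m k : ℤ) (hnm : m + 1 = n) (hmk : k + 1 = m) (q s : X.sd.Simplex) :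
    ∑ t ∈ a.between (X := X.sd) q s, sdComponent r o C n m t s ≫ sdComponent r o C m k q t
      = 0 := by
  classical
  let F := Graded.Hom.f (C.d (n + a.shift r s) (k + a.shift r q)) (r.image q) (r.image s)
  let G := transport C (n + a.shift r s) (r.image s) (k + a.shift r q) (r.image q)
  have key : ∀ t, sdComponent r o C n m t s ≫ sdComponent r o C m k q t =
      (if a.IsParallel r t s then
        Graded.Hom.f (C.d (n + a.shift r s) (m + a.shift r t)) (r.image t) (r.image s) else 0) ≫
      (if a.IsParallel r q t then
        Graded.Hom.f (C.d (m + a.shift r t) (k + a.shift r q)) (r.image q) (r.image t) else 0) +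
      (((m.negOnePow : ℤ) * if a.IsParallel r t s then a.incidence r o q t else 0) • F +
      (((n.negOnePow : ℤ) * if a.IsParallel r q t then a.incidence r o t s else 0) • F +
      ((n.negOnePow : ℤ) * (m.negOnePow : ℤ) *
        (a.incidence r o t s * a.incidence r o q t)) • G)) := by
    intro t
    have e1 : (if a.IsParallel r t s then
          Graded.Hom.f (C.d (n + a.shift r s) (m + a.shift r t)) (r.image t) (r.image s)
          else 0) ≫ (((m.negOnePow : ℤ) * a.incidence r o q t) •
          transport C (m + a.shift r t) (r.image t) (k + a.shift r q) (r.image q)) =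
        ((m.negOnePow : ℤ) * if a.IsParallel r t s then a.incidence r o q t else 0) • F := by
      by_cases h0 : a.incidence r o q t = 0
      · simp [h0]
      obtain ⟨-, h1, h2⟩ := Variance.of_incidence h0
      split_ifs
      · rw [Preadditive.comp_zsmul, d_transport (by omega) h1]
      · simp
    have e2 : (((n.negOnePow : ℤ) * a.incidence r o t s) •
          transport C (n + a.shift r s) (r.image s) (m + a.shift r t) (r.image t)) ≫
        (if a.IsParallel r q t then
          Graded.Hom.f (C.d (m + a.shift r t) (k + a.shift r q)) (r.image q) (r.image t)
          else 0) =
        ((n.negOnePow : ℤ) * if a.IsParallel r q t then a.incidence r o t s else 0) • F := by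
      by_cases h0 : a.incidence r o t s = 0
      · simp [h0]
      obtain ⟨-, h1, h2⟩ := Variance.of_incidence h0
      split_ifs
      · rw [Preadditive.zsmul_comp, transport_d (by omega) h1]
      · simp
    have e3 : (((n.negOnePow : ℤ) * a.incidence r o t s) •
          transport C (n + a.shift r s) (r.image s) (m + a.shift r t) (r.image t)) ≫
        (((m.negOnePow : ℤ) * a.incidence r o q t) •
          transport C (m + a.shift r t) (r.image t) (k + a.shift r q) (r.image q)) =
        ((n.negOnePow : ℤ) * (m.negOnePow : ℤ) *
          (a.incidence r o t s * a.incidence r o q t)) • G := by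
      by_cases h0 : a.incidence r o t s = 0
      · simp [h0]
      obtain ⟨-, h1, h2⟩ := Variance.of_incidence h0
      rw [Preadditive.zsmul_comp, Preadditive.comp_zsmul, smul_smul,
        transport_transport (by omega) h1]
      congr 1
      ring
    unfold sdComponent
    rw [Preadditive.add_comp, Preadditive.comp_add, Preadditive.comp_add, e1, e2, e3, add_assoc]
  rw [Finset.sum_congr rfl fun t _ => key t, Finset.sum_add_distrib, Finset.sum_add_distrib,
    Finset.sum_add_distrib, sum_parallel_parallel, zero_add, ← Finset.sum_smul,
    ← Finset.sum_smul, ← Finset.sum_smul, ← Finset.mul_sum, ← Finset.mul_sum, ← Finset.mul_sum,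
    Variance.sum_incidence_incidence, Variance.sum_parallel_incidence, mul_zero, zero_smul,
    add_zero, ← add_smul, ← add_mul]
  have h : (m.negOnePow : ℤ) + (n.negOnePow : ℤ) = 0 := by
    rw [← hnm, Int.negOnePow_succ]
    simp
  rw [h, zero_mul, zero_smul]

variable (r o C) in
/-- The subdivision `Sd C` of a chain complex in `A(X)`, a chain complex in `A(Sd X)`. Over the
simplex `s` of `Sd X` it is `C` over the simplex `r(s)`, shifted by `|s| - |r(s)|`. -/
def sdChain : ChainComplex (ControlledCat a X.sd A) ℤ where
  X := fun n => ⟨fun s => (C.X (n + a.shift r s)).obj (r.image s)⟩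
  d := fun n m => Graded.Hom.mk (fun t s => sdComponent r o C n m t s)
    (fun t s h => sdComponent_supp n m t s h)
    fun s => (a.finite_rel (X := X.sd) s).subset fun t ht => by
      by_contra h
      exact ht (sdComponent_supp n m t s h)
  shape := fun n m h => Graded.hom_ext _ _ fun t s => sdComponent_shape n m t s h
  d_comp_d' := fun n m k hnm hmk => Graded.hom_ext _ _ fun q s => by
    rw [Graded.comp_f, finsum_eq_sum_of_support_subset (s := a.between (X := X.sd) q s)]
    · exact sum_sdComponent n m k hnm hmk q s
    · intro t ht
      refine Finset.mem_coe.2 (Variance.mem_between.2 ⟨?_, ?_⟩)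
      · by_contra h
        refine ht ?_
        change sdComponent r o C n m t s ≫ _ = 0
        rw [sdComponent_supp _ _ _ _ h, zero_comp]
      · by_contra h
        refine ht ?_
        change _ ≫ sdComponent r o C m k q t = 0
        rw [sdComponent_supp _ _ _ _ h, comp_zero]

/-- The iterated subdivision `Sd^i C`, for given simplicial approximations `Sd^(j+1) X → Sd^j X`. -/
def sdChainIter (r : ∀ j, (X.sdIter j).Approx) (o : X.VertexOrder)
    (C : ChainComplex (ControlledCat a X A) ℤ) :
    ∀ i, ChainComplex (ControlledCat a (X.sdIter i) A) ℤ
  | 0 => C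
  | i + 1 => sdChain (r i) (orderIter o i) (sdChainIter r o C i)

end Subdivision

/-! ### Control -/

/-- A chain complex is finite: its objects vanish outside a bounded range of degrees. -/
def IsFiniteComplex {B : Type w} [Category.{v} B] [Limits.HasZeroMorphisms B]
    (C : ChainComplex B ℤ) : Prop :=
  {n | ¬ IsZero (C.X n)}.Finite

section Control

variable {X : LFComplex.{u}} {A : Type w} [Category.{v} A] [Preadditive A] {i : ℕ}

/-- The bound, measured in `X`, of a morphism of `Sd^i X`-graded objects: the supremum of the
distances between the barycentres of simplices of `Sd^i X` between which it has a nonzero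
component. -/
def homBound {M N : GradedCat (X.sdIter i) A} (f : M ⟶ N) : ℝ≥0∞ :=
  ⨆ (t : (X.sdIter i).Simplex) (s : (X.sdIter i).Simplex) (_ : Graded.Hom.f f t s ≠ 0),
    X.stdDist (X.barycentre i s) (X.barycentre i t)

/-- The bound of a chain equivalence: the supremum of the bounds of the two chain maps and of
the two chain homotopies. -/
def equivBound {C D : ChainComplex (GradedCat (X.sdIter i) A) ℤ} (e : HomotopyEquiv C D) :
    ℝ≥0∞ :=
  (⨆ n, homBound (e.hom.f n)) ⊔ (⨆ n, homBound (e.inv.f n)) ⊔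
    (⨆ (n) (m), homBound (e.homotopyHomInvId.hom n m)) ⊔
    (⨆ (n) (m), homBound (e.homotopyInvHomId.hom n m))

variable {a : Variance}

/-- A chain complex in `A(X)`, regarded as a chain complex in `G_X(A)`. -/
def toGraded (C : ChainComplex (ControlledCat a X A) ℤ) : ChainComplex (GradedCat X A) ℤ :=
  ((Graded.forget (a.rel X) A).mapHomologicalComplex (ComplexShape.down ℤ)).obj C

end Control

end Squeezing

end

open Squeezing

noncomputable section

namespace Squeezing

/-! ### Families of objects and column-finite matrices -/

/-! The proof has an algebraic half and a geometric half.

Algebra. A complex is a strong deformation retract of its subdivision, by maps whose supports are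
known. The matrices are indexed by simplices and degrees together, so that a differential becomes
one endomorphism of square zero. Let `r` choose the largest vertex of each simplex for a linear
order. The projection of the subdivision onto the summands of depth zero, that is over the flags `t`
with `|t| = |r(t)|`, is a chain map (`IsSubdivision.d'_proj`). It has a section on objects: place
the summand of `σ` over the flag of initial segments of `σ`. The remaining flags are paired off as
in discrete Morse theory: the initial segments contained in a flag determine a prefix, and the
pairing adds or deletes the largest of them. With the resulting `h`, the map `h ≫ d' + d' ≫ h + proj
≫ incl` is the identity plus terms that strictly lower a bounded rank
(`IsSubdivision.supp_one_sub`), hence invertible by a finite Neumann series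
(`exists_inverse_of_rank`). The section and `h` can then be corrected to a retraction
(`Retract.ofPerturbation`). The projection is untouched, so its support is exactly the relation `σ =
r(t)`; the inclusion and the homotopy stay inside carriers. The covariant and contravariant cases
are exchanged by transposing matrices, which local finiteness allows. `exists_retract_iter` composes
over several subdivisions.

Transfer. Given the equivalence of the subdivisions, the composites `C → Sd^i C → Sd^i D → D` and
back are chain maps with the homotopies of `Retract.transfer`. Everything is a morphism of `A(X)` as
soon as, starting in a simplex `σ`, going up, moving by less than `ε`, possibly moving by a homotopy
and by `ε` again, and going down, one ends in a face of `σ`.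

Geometry. Let `m` bound the number of vertices of simplices. The distance dominates every difference
of barycentric coordinates, so a move by `ε` changes the coordinates off `σ` by less than `ε`. Going
down must bring back to `σ` a simplex whose coordinates off `σ` are small, with a bound independent
of `i`. This dictates the approximations: after a reset at level `k` they choose the vertex that
ends up in the smallest possible simplex of `Sd^k X`. A vertex of `Sd^k X` so reached has each
coordinate at most `m` times that of a vertex of the original simplex, however many levels have been
crossed (`vertexPos_le_of_mem_descend`).

A retraction of `Sd^i C` directly onto `C` would not suffice: its homotopy moves anywhere in the
carrier in `X`, and this carrier leaves `σ` after the first move by `ε`. The retraction is therefore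
composed of two, through `Sd^{j₀} C`, with resets at levels `0` and `j₀`. The homotopy of the upper
one stays in simplices of `Sd^{j₀} X`, on which coordinates vary by at most `(1 - 1/m)^{j₀}`. That
of the lower one is preceded by the image in `Sd^{j₀} X`, whose carrier in `X` is already back in
`σ` if `ε` is small compared to `m^{-j₀}`. `exists_squeeze` chooses first `j₀` and then `ε`. -/

/-- A family of objects of `A` over an arbitrary index type. The morphisms of families are the
column-finite matrices. -/
structure Fam (A : Type w) where
  ι : Type u
  obj : ι → A

namespace Fam

variable {A : Type w} [Category.{v} A] [Preadditive A]

/-- Matrices with finitely many nonzero entries in each column. -/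
@[ext]
structure Hom (M N : Fam.{u} A) where
  f : ∀ (t : N.ι) (s : M.ι), M.obj s ⟶ N.obj t
  fin : ∀ s, {t | f t s ≠ 0}.Finite

open Classical in
/-- The entries of the identity matrix of a family of objects. -/
def idEntry {ι : Type*} (M : ι → A) (t s : ι) : M s ⟶ M t :=
  if h : s = t then eqToHom (congrArg M h) else 0

@[simp]
theorem idEntry_self {ι : Type*} (M : ι → A) (s : ι) : idEntry M s s = 𝟙 (M s) := by
  simp [idEntry]

theorem idEntry_ne {ι : Type*} (M : ι → A) {t s : ι} (h : s ≠ t) : idEntry M t s = 0 :=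
  dif_neg h

/-- Entries at equal indices have objects that agree only propositionally. Taking a morphism for
every index makes it possible to substitute the equality. -/
theorem idEntry_comp_app {ι : Type*} (M : ι → A) {t s : ι} {Z : A} (g : ∀ i, M i ⟶ Z)
    (h : s = t) : idEntry M t s ≫ g t = g s := by
  subst h
  simp

theorem app_comp_idEntry {ι : Type*} (M : ι → A) {t s : ι} {Z : A} (g : ∀ i, Z ⟶ M i)
    (h : s = t) : g s ≫ idEntry M t s = g t := by
  subst h
  simp

/-- The identity matrix. -/
def Hom.id (M : Fam.{u} A) : Hom M M where
  f := idEntry M.obj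
  fin := fun s => (Set.finite_singleton s).subset fun t ht => by
    by_contra h
    exact ht (idEntry_ne _ fun e => h e.symm)

/-- Matrix multiplication. -/
def Hom.comp {M N P : Fam.{u} A} (f : Hom M N) (g : Hom N P) : Hom M P where
  f := fun q s => ∑ᶠ t, f.f t s ≫ g.f q t
  fin := fun s => by
    refine ((f.fin s).biUnion fun t _ => g.fin t).subset fun q hq => ?_
    by_contra h
    simp only [Set.mem_iUnion, not_exists] at h
    refine hq ((finsum_congr fun t => ?_).trans finsum_zero)
    by_cases h1 : f.f t s = 0
    · rw [h1, zero_comp]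
    · have : g.f q t = 0 := by
        by_contra h2
        exact h t h1 h2
      rw [this, comp_zero]

theorem Hom.comp_eq_sum {M N P : Fam.{u} A} (f : Hom M N) (g : Hom N P) (q : P.ι) (s : M.ι)
    (T : Finset N.ι) (hT : ∀ t, f.f t s ≠ 0 → t ∈ T) :
    (f.comp g).f q s = ∑ t ∈ T, f.f t s ≫ g.f q t :=
  finsum_eq_sum_of_support_subset _ fun t ht => hT t fun h => ht (by simp [h])

instance : Category (Fam.{u} A) where
  Hom := Hom
  id := Hom.id
  comp := Hom.comp
  id_comp := fun {M N} f => by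
    ext t s
    change ∑ᶠ x, idEntry M.obj x s ≫ f.f t x = f.f t s
    rw [finsum_eq_single _ s fun x hx => by rw [idEntry_ne _ hx.symm, zero_comp]]
    simp
  comp_id := fun {M N} f => by
    ext t s
    change ∑ᶠ x, f.f x s ≫ idEntry N.obj t x = f.f t s
    rw [finsum_eq_single _ t fun x hx => by rw [idEntry_ne _ hx, comp_zero]]
    simp
  assoc := fun {M N P Q} f g h => by
    ext q s
    let T := (f.fin s).toFinset
    have hT : ∀ t, f.f t s ≠ 0 → t ∈ T := fun t ht => (f.fin s).mem_toFinset.2 ht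
    let U := ((f.fin s).biUnion fun t _ => g.fin t).toFinset
    have hU : ∀ t ∈ T, ∀ x, g.f x t ≠ 0 → x ∈ U := fun t ht x hx => by
      refine (Set.Finite.mem_toFinset _).2 ?_
      simp only [Set.mem_iUnion]
      exact ⟨t, (f.fin s).mem_toFinset.1 ht, hx⟩
    have hfg : ∀ x, (f.comp g).f x s ≠ 0 → x ∈ U := fun x hx => by
      by_contra hxU
      refine hx ?_
      rw [Hom.comp_eq_sum f g x s T hT]
      refine Finset.sum_eq_zero fun t ht => ?_
      have : g.f x t = 0 := by
        by_contra h2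
        exact hxU (hU t ht x h2)
      rw [this, comp_zero]
    change ((f.comp g).comp h).f q s = (f.comp (g.comp h)).f q s
    rw [Hom.comp_eq_sum _ h q s U hfg, Hom.comp_eq_sum f _ q s T hT]
    calc ∑ x ∈ U, (f.comp g).f x s ≫ h.f q x
        = ∑ x ∈ U, ∑ t ∈ T, (f.f t s ≫ g.f x t) ≫ h.f q x := by
          refine Finset.sum_congr rfl fun x _ => ?_
          rw [Hom.comp_eq_sum f g x s T hT, Preadditive.sum_comp]
      _ = ∑ t ∈ T, ∑ x ∈ U, (f.f t s ≫ g.f x t) ≫ h.f q x := Finset.sum_comm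
      _ = ∑ t ∈ T, f.f t s ≫ (g.comp h).f q t := by
          refine Finset.sum_congr rfl fun t ht => ?_
          rw [Hom.comp_eq_sum g h q t U (hU t ht), Preadditive.comp_sum]
          simp

/-- The entry of a matrix in row `t` and column `s`. -/
def ent {M N : Fam.{u} A} (f : M ⟶ N) (t : N.ι) (s : M.ι) : M.obj s ⟶ N.obj t := Hom.f f t s

theorem ent_fin {M N : Fam.{u} A} (f : M ⟶ N) (s : M.ι) : {t | ent f t s ≠ 0}.Finite :=
  Hom.fin f s

/-- The matrix with given entries. -/
def mk' {M N : Fam.{u} A} (f : ∀ (t : N.ι) (s : M.ι), M.obj s ⟶ N.obj t)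
    (h : ∀ s, {t | f t s ≠ 0}.Finite) : M ⟶ N := Hom.mk f h

@[simp]
theorem ent_mk' {M N : Fam.{u} A} (f : ∀ (t : N.ι) (s : M.ι), M.obj s ⟶ N.obj t)
    (h : ∀ s, {t | f t s ≠ 0}.Finite) (t : N.ι) (s : M.ι) : ent (mk' f h) t s = f t s := rfl

@[ext]
theorem hom_ext {M N : Fam.{u} A} (f g : M ⟶ N) (h : ∀ t s, ent f t s = ent g t s) : f = g :=
  Hom.ext (funext fun t => funext fun s => h t s)

@[simp]
theorem ent_id (M : Fam.{u} A) (t s : M.ι) : ent (𝟙 M) t s = idEntry M.obj t s := rfl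

theorem ent_comp {M N P : Fam.{u} A} (f : M ⟶ N) (g : N ⟶ P) (q : P.ι) (s : M.ι) :
    ent (f ≫ g) q s = ∑ᶠ t, ent f t s ≫ ent g q t := rfl

theorem ent_comp_finite {M N P : Fam.{u} A} (f : M ⟶ N) (g : N ⟶ P) (q : P.ι) (s : M.ι) :
    (Function.support fun t => ent f t s ≫ ent g q t).Finite :=
  (ent_fin f s).subset fun t ht h => ht (by simp [h])

theorem exists_of_ent_comp {M N P : Fam.{u} A} {f : M ⟶ N} {g : N ⟶ P} {q : P.ι} {s : M.ι}
    (h : ent (f ≫ g) q s ≠ 0) : ∃ t, ent f t s ≠ 0 ∧ ent g q t ≠ 0 := by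
  by_contra hn
  push Not at hn
  rw [ent_comp] at h
  refine h ((finsum_congr fun t => ?_).trans finsum_zero)
  by_cases h1 : ent f t s = 0
  · rw [h1, zero_comp]
  · rw [hn t h1, comp_zero]

theorem ent_comp_single {M N P : Fam.{u} A} (f : M ⟶ N) (g : N ⟶ P) {q : P.ι} {s : M.ι} (t : N.ι)
    (h : ∀ t', ent f t' s ≠ 0 → ent g q t' ≠ 0 → t' = t) :
    ent (f ≫ g) q s = ent f t s ≫ ent g q t := by
  rw [ent_comp]
  refine finsum_eq_single _ t fun t' ht' => ?_
  by_cases h1 : ent f t' s = 0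
  · rw [h1, zero_comp]
  · have : ent g q t' = 0 := by
      by_contra h2
      exact ht' (h t' h1 h2)
    rw [this, comp_zero]

section AddGroup

variable (M N : Fam.{u} A)

instance : Zero (M ⟶ N) := ⟨⟨fun _ _ => 0, fun _ => by simp⟩⟩

instance : Add (M ⟶ N) := ⟨fun f g =>
  ⟨fun t s => ent f t s + ent g t s,
   fun s => ((ent_fin f s).union (ent_fin g s)).subset fun t ht => by
      by_contra h
      simp only [Set.mem_union, Set.mem_ofPred_eq, not_or, not_not] at h
      exact ht (by rw [h.1, h.2, add_zero])⟩⟩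

instance : Neg (M ⟶ N) := ⟨fun f =>
  ⟨fun t s => - ent f t s,
   fun s => (ent_fin f s).subset fun t ht h => ht (by rw [h, neg_zero])⟩⟩

instance : Sub (M ⟶ N) := ⟨fun f g =>
  ⟨fun t s => ent f t s - ent g t s,
   fun s => ((ent_fin f s).union (ent_fin g s)).subset fun t ht => by
      by_contra h
      simp only [Set.mem_union, Set.mem_ofPred_eq, not_or, not_not] at h
      exact ht (by rw [h.1, h.2, sub_zero])⟩⟩

instance : SMul ℕ (M ⟶ N) := ⟨fun n f =>
  ⟨fun t s => n • ent f t s,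
   fun s => (ent_fin f s).subset fun t ht h => ht (by rw [h, smul_zero])⟩⟩

instance : SMul ℤ (M ⟶ N) := ⟨fun n f =>
  ⟨fun t s => n • ent f t s,
   fun s => (ent_fin f s).subset fun t ht h => ht (by rw [h, smul_zero])⟩⟩

instance : AddCommGroup (M ⟶ N) :=
  Function.Injective.addCommGroup (fun f : M ⟶ N => (ent f : ∀ t s, M.obj s ⟶ N.obj t))
    (fun _ _ h => Hom.ext h) rfl (fun _ _ => rfl) (fun _ => rfl) (fun _ _ => rfl)
    (fun _ _ => rfl) (fun _ _ => rfl)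

end AddGroup

variable {M N P : Fam.{u} A}

@[simp]
theorem ent_add (f g : M ⟶ N) (t : N.ι) (s : M.ι) : ent (f + g) t s = ent f t s + ent g t s := rfl

@[simp]
theorem ent_sub (f g : M ⟶ N) (t : N.ι) (s : M.ι) : ent (f - g) t s = ent f t s - ent g t s := rfl

@[simp]
theorem ent_neg (f : M ⟶ N) (t : N.ι) (s : M.ι) : ent (-f) t s = - ent f t s := rfl

instance : Preadditive (Fam.{u} A) where
  homGroup := fun M N => inferInstance
  add_comp := fun M N P f g h => by
    ext q s
    rw [ent_add, ent_comp, ent_comp, ent_comp,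
      ← finsum_add_distrib (ent_comp_finite f h q s) (ent_comp_finite g h q s)]
    exact finsum_congr fun t => by rw [ent_add, Preadditive.add_comp]
  comp_add := fun M N P f g h => by
    ext q s
    rw [ent_add, ent_comp, ent_comp, ent_comp,
      ← finsum_add_distrib (ent_comp_finite f g q s) (ent_comp_finite f h q s)]
    exact finsum_congr fun t => by rw [ent_add, Preadditive.comp_add]

/-! #### Supports -/

/-- The nonzero entries of `f` lie in the relation `ρ`. -/
def Supp (f : M ⟶ N) (ρ : N.ι → M.ι → Prop) : Prop := ∀ t s, ent f t s ≠ 0 → ρ t s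

theorem Supp.mono {f : M ⟶ N} {ρ ρ' : N.ι → M.ι → Prop} (h : Supp f ρ)
    (h' : ∀ t s, ρ t s → ρ' t s) : Supp f ρ' := fun t s ht => h' t s (h t s ht)

theorem Supp.comp {f : M ⟶ N} {g : N ⟶ P} {ρ : N.ι → M.ι → Prop} {ρ' : P.ι → N.ι → Prop}
    {ρ'' : P.ι → M.ι → Prop} (hf : Supp f ρ) (hg : Supp g ρ')
    (h : ∀ q t s, ρ t s → ρ' q t → ρ'' q s) : Supp (f ≫ g) ρ'' := fun q s hq => by
  obtain ⟨t, h1, h2⟩ := exists_of_ent_comp hq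
  exact h q t s (hf t s h1) (hg q t h2)

theorem Supp.add {f g : M ⟶ N} {ρ : N.ι → M.ι → Prop} (hf : Supp f ρ) (hg : Supp g ρ) :
    Supp (f + g) ρ := fun t s h => by
  by_cases h1 : ent f t s = 0
  · refine hg t s fun h2 => h ?_
    rw [ent_add, h1, h2, add_zero]
  · exact hf t s h1

theorem Supp.neg {f : M ⟶ N} {ρ : N.ι → M.ι → Prop} (hf : Supp f ρ) : Supp (-f) ρ :=
  fun t s h => hf t s fun h1 => h (by rw [ent_neg, h1, neg_zero])

theorem Supp.sub {f g : M ⟶ N} {ρ : N.ι → M.ι → Prop} (hf : Supp f ρ) (hg : Supp g ρ) :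
    Supp (f - g) ρ := by
  rw [sub_eq_add_neg]
  exact hf.add hg.neg

theorem Supp.zero {ρ : N.ι → M.ι → Prop} : Supp (0 : M ⟶ N) ρ := fun _ _ h => (h rfl).elim

theorem Supp.id {ρ : M.ι → M.ι → Prop} (h : ∀ s, ρ s s) : Supp (𝟙 M) ρ := fun t s ht => by
  have : s = t := by
    by_contra h1
    exact ht (idEntry_ne _ h1)
  exact this ▸ h s

/-- A matrix all of whose nonzero entries strictly lower a bounded rank has a unipotent
complement, whose inverse has the same support. -/
theorem exists_inverse_of_rank (x : M ⟶ M) (R : M.ι → ℕ) (L : ℕ) (hL : ∀ s, R s < L)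
    (hR : Supp (𝟙 M - x) fun t s => R t < R s) {ρ : M.ι → M.ι → Prop} (hrefl : ∀ s, ρ s s)
    (htrans : ∀ q t s, ρ t s → ρ q t → ρ q s) (hx : Supp x ρ) :
    ∃ y : M ⟶ M, x ≫ y = 𝟙 M ∧ y ≫ x = 𝟙 M ∧ Supp y ρ := by
  -- The partial sums of the Neumann series: `y n` is the sum of the first `n` powers of `𝟙 M - x`.
  let y : ℕ → (M ⟶ M) := fun n => Nat.rec 0 (fun _ z => 𝟙 M + (𝟙 M - x) ≫ z) n
  have y0 : y 0 = 0 := rfl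
  have y1 : ∀ n, y (n + 1) = 𝟙 M + (𝟙 M - x) ≫ y n := fun n => rfl
  have hc : ∀ n, x ≫ y n = y n ≫ x := by
    intro n
    induction n with
    | zero => rw [y0, comp_zero, zero_comp]
    | succ n ih =>
      simp only [y1, Preadditive.comp_add, Preadditive.add_comp, Preadditive.comp_sub,
        Preadditive.sub_comp, Category.id_comp, Category.comp_id, Category.assoc, ← ih]
  -- The remainder `𝟙 M - x ≫ y n` is the `n`-th power of `𝟙 M - x`, so it lowers the rank by at
  -- least `n`; for `n = L` nothing is left.
  have hlow : ∀ n, Supp (𝟙 M - x ≫ y n) fun t s => R t + n ≤ R s := by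
    intro n
    induction n with
    | zero =>
      rw [y0, comp_zero, sub_zero]
      exact Supp.id fun s => le_refl _
    | succ n ih =>
      have e : 𝟙 M - x ≫ y (n + 1) = (𝟙 M - x) ≫ (𝟙 M - x ≫ y n) := by
        simp only [y1, Preadditive.comp_add, Preadditive.comp_sub,
          Preadditive.sub_comp, Category.id_comp, Category.comp_id]
        abel
      rw [e]
      exact hR.comp ih fun q t s h1 h2 => by omega
  have hz : 𝟙 M - x ≫ y L = 0 := by
    ext t s
    by_contra h
    have := hlow L t s h
    have := hL s
    omega
  have h1 := (sub_eq_zero.1 hz).symm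
  refine ⟨y L, h1, (hc L).symm.trans h1, ?_⟩
  have : ∀ n, Supp (y n) ρ := by
    intro n
    induction n with
    | zero => exact Supp.zero
    | succ n ih =>
      rw [y1]
      exact (Supp.id hrefl).add (((Supp.id hrefl).sub hx).comp ih htrans)
  exact this L

end Fam

/-! ### Deformation retractions of differential objects -/

section Retract

variable {B : Type w} [Category.{v} B] [Preadditive B]

/-- A strong deformation retraction of the differential object `(M', d')` onto `(M, d)`. -/
structure Retract {M M' : B} (d : M ⟶ M) (d' : M' ⟶ M') where
  up : M ⟶ M'
  down : M' ⟶ M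
  htpy : M' ⟶ M'
  up_comm : d ≫ up = up ≫ d'
  down_comm : d' ≫ down = down ≫ d
  up_down : up ≫ down = 𝟙 M
  htpy_eq : htpy ≫ d' + d' ≫ htpy = 𝟙 M' - down ≫ up

/-- The identity deformation retraction. -/
def Retract.refl {M : B} (d : M ⟶ M) : Retract d d where
  up := 𝟙 M
  down := 𝟙 M
  htpy := 0
  up_comm := by simp
  down_comm := by simp
  up_down := by simp
  htpy_eq := by simp

/-- Composition of deformation retractions. -/
def Retract.trans {M M' M'' : B} {d : M ⟶ M} {d' : M' ⟶ M'} {d'' : M'' ⟶ M''}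
    (R : Retract d d') (S : Retract d' d'') : Retract d d'' where
  up := R.up ≫ S.up
  down := S.down ≫ R.down
  htpy := S.htpy + S.down ≫ R.htpy ≫ S.up
  up_comm := by rw [← Category.assoc, R.up_comm, Category.assoc, S.up_comm, Category.assoc]
  down_comm := by rw [← Category.assoc, S.down_comm, Category.assoc, R.down_comm, Category.assoc]
  up_down := by
    rw [Category.assoc, ← Category.assoc S.up, S.up_down, Category.id_comp, R.up_down]
  htpy_eq := by
    have h1 : (S.down ≫ R.htpy ≫ S.up) ≫ d'' + d'' ≫ S.down ≫ R.htpy ≫ S.up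
        = S.down ≫ (R.htpy ≫ d' + d' ≫ R.htpy) ≫ S.up := by
      rw [Preadditive.add_comp, Preadditive.comp_add]
      congr 1
      · simp only [Category.assoc, S.up_comm]
      · rw [← Category.assoc, S.down_comm]
        simp only [Category.assoc]
    have h2 := S.htpy_eq
    rw [Preadditive.add_comp, Preadditive.comp_add, add_add_add_comm, h1, h2, R.htpy_eq]
    simp only [Preadditive.comp_sub, Preadditive.sub_comp, Category.id_comp, Category.assoc]
    abel

/-- A section `a` of the underlying objects of a chain map `b`, and a homotopy `h` with `h b = 0`,
can be corrected to a deformation retraction as soon as `dh + hd + ba` is invertible. -/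
def Retract.ofPerturbation {M M' : B} {d : M ⟶ M} {d' : M' ⟶ M'} (hd : d ≫ d = 0)
    (hd' : d' ≫ d' = 0) (a : M ⟶ M') (b : M' ⟶ M) (h y : M' ⟶ M')
    (hb : d' ≫ b = b ≫ d) (hab : a ≫ b = 𝟙 M) (hh : h ≫ b = 0)
    (hy : (h ≫ d' + d' ≫ h + b ≫ a) ≫ y = 𝟙 M') (hy' : y ≫ (h ≫ d' + d' ≫ h + b ≫ a) = 𝟙 M') :
    Retract d d' := by
  let x := h ≫ d' + d' ≫ h + b ≫ a
  -- The failure of `a` to be a chain map. It is killed by `b`, since `b` is a chain map with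
  -- section `a`.
  let e := a ≫ d' - d ≫ a
  have xb : x ≫ b = b := by
    simp only [x, Preadditive.add_comp, Category.assoc, hb, hab, hh, Category.comp_id, comp_zero,
      add_zero]
    rw [← Category.assoc, hh, zero_comp, zero_add]
  have yb : y ≫ b = b := by
    have := congrArg (fun z => z ≫ b) hy'
    simp only [Category.assoc, Category.id_comp] at this
    rwa [xb] at this
  have eb : e ≫ b = 0 := by
    simp only [e, Preadditive.sub_comp, Category.assoc, hb, hab, Category.comp_id]
    rw [← Category.assoc, hab, Category.id_comp, sub_self]
  have ed : e ≫ d' = - d ≫ e := by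
    simp only [e, Preadditive.sub_comp, Preadditive.comp_sub, Category.assoc, hd', comp_zero,
      zero_sub, neg_inj]
    rw [← Category.assoc d d, hd, zero_comp, sub_zero]
  -- The perturbation `x` need not commute with `d'`, but its commutator with `d'` is exactly the
  -- defect `e` composed with `b`.
  have xd : x ≫ d' = d' ≫ x + b ≫ e := by
    simp only [x, e, Preadditive.add_comp, Preadditive.comp_add, Preadditive.comp_sub,
      Category.assoc, hd', comp_zero, zero_add]
    rw [← Category.assoc d' d', hd', zero_comp, ← Category.assoc d' b, hb]
    simp only [Category.assoc]
    abel
  have yd : d' ≫ y = y ≫ d' + b ≫ e ≫ y := by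
    have h1 : y ≫ (x ≫ d') ≫ y = y ≫ (d' ≫ x + b ≫ e) ≫ y := by rw [xd]
    simp only [Preadditive.add_comp, Preadditive.comp_add, Category.assoc] at h1
    rw [← Category.assoc y x, hy', Category.id_comp, hy, Category.comp_id, ← Category.assoc y b,
      yb] at h1
    exact h1
  exact
    -- The subtracted term cancels the defect of `a`. It does not disturb `up ≫ down` because `h ≫ b
    -- = 0`.
    { up := a - e ≫ y ≫ h
      down := b
      htpy := y ≫ h
      up_down := by
        simp only [Preadditive.sub_comp, Category.assoc, hh, comp_zero, sub_zero, hab]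
      down_comm := hb
      up_comm := by
        have h1 : (e ≫ y ≫ h) ≫ d' = e - e ≫ y ≫ (d' ≫ h + b ≫ a) := by
          have h2 : e ≫ y ≫ x = e := by rw [hy', Category.comp_id]
          simp only [x, Preadditive.comp_add] at h2
          rw [Preadditive.comp_add, Preadditive.comp_add, Category.assoc, Category.assoc]
          rw [eq_sub_iff_add_eq, ← add_assoc]
          exact h2
        have h3 : e ≫ y ≫ b ≫ a = 0 := by
          rw [← Category.assoc y, yb, ← Category.assoc, eb, zero_comp]
        have h4 : e ≫ y ≫ d' ≫ h = - d ≫ e ≫ y ≫ h := by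
          have h5 : e ≫ y ≫ d' = e ≫ d' ≫ y := by
            rw [yd, Preadditive.comp_add, ← Category.assoc e b, eb, zero_comp, add_zero]
          rw [← Category.assoc y, ← Category.assoc e, h5, ← Category.assoc e, ed]
          simp only [Category.assoc, Preadditive.neg_comp]
        have h6 : d ≫ a = a ≫ d' - e := (sub_sub_cancel _ _).symm
        clear_value e
        rw [Preadditive.sub_comp, h1, Preadditive.comp_add, Preadditive.comp_add, h3, add_zero,
          h4, Preadditive.comp_sub, h6]
        abel
      htpy_eq := by
        have h1 : (y ≫ h) ≫ d' + d' ≫ y ≫ h = y ≫ (h ≫ d' + d' ≫ h) + b ≫ e ≫ y ≫ h := by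
          rw [← Category.assoc d', yd]
          simp only [Preadditive.comp_add, Preadditive.add_comp, Category.assoc]
          abel
        have h2 : y ≫ (h ≫ d' + d' ≫ h) = 𝟙 M' - b ≫ a := by
          rw [← hy']
          rw [eq_sub_iff_add_eq, Preadditive.comp_add _ _ _ y _ (b ≫ a), ← Category.assoc y b, yb]
        rw [h1, h2, Preadditive.comp_sub]
        abel }

end Retract

namespace LFComplex

variable {X : LFComplex.{u}}

/-! ### Flags -/

theorem exists_top (t : X.sd.Simplex) : ∃ m : X.Simplex, m ∈ t.1 ∧ ∀ ρ : X.Simplex, ρ ∈ t.1 → ρ ≤ m := by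
  obtain ⟨m, hm, hmax⟩ := t.1.exists_maximal t.nonempty
  refine ⟨m, hm, fun ρ hρ => ?_⟩
  rcases t.2.2.total hρ hm with h | h
  · exact h
  · exact hmax hρ h

/-- The largest element of a flag, that is, the carrier in `X` of a simplex of `Sd X`. -/
def top (t : X.sd.Simplex) : X.Simplex := Classical.choose (exists_top t)

theorem top_mem (t : X.sd.Simplex) : top t ∈ t.1 := (Classical.choose_spec (exists_top t)).1

theorem le_top {t : X.sd.Simplex} {ρ : X.Simplex} (h : ρ ∈ t.1) : ρ ≤ top t :=
  (Classical.choose_spec (exists_top t)).2 ρ h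

theorem top_mono {t t' : X.sd.Simplex} (h : t ≤ t') : top t ≤ top t' := le_top (h (top_mem t))

theorem image_le_top (r : X.Approx) (t : X.sd.Simplex) : r.image t ≤ top t := by
  intro x hx
  obtain ⟨ρ, hρ, rfl⟩ := Comb.mem_img.1 hx
  exact le_top hρ (r.mem ρ)

theorem mem_image {r : X.Approx} {t : X.sd.Simplex} {x : X.V} :
    x ∈ (r.image t).1 ↔ ∃ ρ : X.Simplex, ρ ∈ t.1 ∧ r.toFun ρ = x := Comb.mem_img

theorem image_mono (r : X.Approx) {t t' : X.sd.Simplex} (h : t ≤ t') : r.image t ≤ r.image t' :=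
  Comb.img_mono _ h

theorem flag_total {t : X.sd.Simplex} {ρ ρ' : X.Simplex} (h : ρ ∈ t.1) (h' : ρ' ∈ t.1) :
    ρ.1 ⊆ ρ'.1 ∨ ρ'.1 ⊆ ρ.1 := t.2.2.total h h'

/-! ### Initial segments of flags for an approximation given by a linear order -/

variable {K : Type*} [LinearOrder K]

/-- The approximation sends the barycentre of each simplex to its largest vertex, for the linear
order obtained from an injection of the vertices into a linear order. -/
structure IsMax (key : X.V → K) (r : X.Approx) : Prop where
  inj : Function.Injective key
  le : ∀ σ : X.Simplex, ∀ x ∈ σ.1, key x ≤ key (r.toFun σ)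

/-- The vertices of `P` up to `x`. -/
def seg (key : X.V → K) (P : Finset X.V) (x : X.V) : Finset X.V :=
  P.filter fun y => key y ≤ key x

variable {key : X.V → K} {r : X.Approx}

theorem mem_seg {P : Finset X.V} {x y : X.V} : y ∈ seg key P x ↔ y ∈ P ∧ key y ≤ key x :=
  Finset.mem_filter

theorem seg_subset {P : Finset X.V} {x : X.V} : seg key P x ⊆ P := Finset.filter_subset _ _

theorem seg_eq_self {P : Finset X.V} {x : X.V} (h : ∀ y ∈ P, key y ≤ key x) : seg key P x = P :=
  Finset.filter_true_of_mem h

theorem seg_mono {P : Finset X.V} {x y : X.V} (h : key x ≤ key y) :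
    seg key P x ⊆ seg key P y := fun _ hz =>
  mem_seg.2 ⟨(mem_seg.1 hz).1, (mem_seg.1 hz).2.trans h⟩

theorem seg_seg {P Q : Finset X.V} {x : X.V} (hQ : Q ⊆ P) (hx : x ∈ Q)
    (h : ∀ y ∈ Q, ∀ z ∈ P, key z ≤ key y → z ∈ Q) : seg key Q x = seg key P x := by
  ext z
  rw [mem_seg, mem_seg]
  exact ⟨fun hz => ⟨hQ hz.1, hz.2⟩, fun hz => ⟨h x hx z hz.1 hz.2, hz.2⟩⟩

theorem IsMax.eq (hr : IsMax key r) {σ : X.Simplex} {x : X.V} (hx : x ∈ σ.1)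
    (h : ∀ y ∈ σ.1, key y ≤ key x) : r.toFun σ = x :=
  hr.inj (le_antisymm (h _ (r.mem σ)) (hr.le σ x hx))

theorem IsMax.of_eq_seg (hr : IsMax key r) {σ : X.Simplex} {P : Finset X.V} {x : X.V}
    (hx : x ∈ P) (h : σ.1 = seg key P x) : r.toFun σ = x := by
  refine hr.eq ?_ fun y hy => ?_
  · rw [h]
    exact mem_seg.2 ⟨hx, le_refl _⟩
  · rw [h] at hy
    exact (mem_seg.1 hy).2

open Classical in
/-- The flag of the initial segments of `σ`. -/
def full (key : X.V → K) (σ : X.Simplex) : X.sd.Simplex :=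
  ⟨(σ.1.attach.image fun x : σ.1 => (⟨seg key σ.1 x.1, mem_faces_of_subset σ seg_subset
      ⟨x.1, mem_seg.2 ⟨x.2, le_refl _⟩⟩⟩ : X.Simplex) : Finset X.Simplex), by
    refine ⟨?_, ?_⟩
    · obtain ⟨x, hx⟩ := σ.nonempty
      exact ⟨_, Finset.mem_image_of_mem _ (Finset.mem_attach _ ⟨x, hx⟩)⟩
    · intro a ha b hb _
      obtain ⟨x, -, rfl⟩ := Finset.mem_image.1 (Finset.mem_coe.1 ha)
      obtain ⟨y, -, rfl⟩ := Finset.mem_image.1 (Finset.mem_coe.1 hb)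
      rcases le_total (key x.1) (key y.1) with h | h
      · exact Or.inl (seg_mono h)
      · exact Or.inr (seg_mono h)⟩

theorem mem_full {σ ρ : X.Simplex} :
    ρ ∈ (full key σ).1 ↔ ∃ x ∈ σ.1, ρ.1 = seg key σ.1 x := by
  classical
  unfold full
  constructor
  · intro h
    obtain ⟨x, -, rfl⟩ := Finset.mem_image.1 h
    exact ⟨x.1, x.2, rfl⟩
  · rintro ⟨x, hx, h⟩
    exact Finset.mem_image.2 ⟨⟨x, hx⟩, Finset.mem_attach _ _, Subtype.ext h.symm⟩

/-- The largest vertex of the segment ending at `x` is `x`, so `r` maps the segments of `σ`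
bijectively to the vertices of `σ`. -/
theorem image_full (hr : IsMax key r) (σ : X.Simplex) : r.image (full key σ) = σ := by
  refine Subtype.ext (Finset.ext fun x => ?_)
  rw [mem_image]
  constructor
  · rintro ⟨ρ, hρ, rfl⟩
    obtain ⟨x, hx, h⟩ := mem_full.1 hρ
    rwa [hr.of_eq_seg hx h]
  · intro hx
    have hs : seg key σ.1 x ∈ X.K.faces :=
      mem_faces_of_subset σ seg_subset ⟨x, mem_seg.2 ⟨hx, le_refl _⟩⟩
    exact ⟨⟨_, hs⟩, mem_full.2 ⟨x, hx, rfl⟩, hr.of_eq_seg hx rfl⟩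

theorem injOn_full (hr : IsMax key r) {σ ρ ρ' : X.Simplex} (h : ρ ∈ (full key σ).1)
    (h' : ρ' ∈ (full key σ).1) (e : r.toFun ρ = r.toFun ρ') : ρ = ρ' := by
  obtain ⟨x, hx, h⟩ := mem_full.1 h
  obtain ⟨y, hy, h'⟩ := mem_full.1 h'
  rw [hr.of_eq_seg hx h, hr.of_eq_seg hy h'] at e
  exact Subtype.ext (by rw [h, h', e])

theorem depth_full (hr : IsMax key r) (σ : X.Simplex) : r.depth (full key σ) = 0 := by
  classical
  unfold Approx.depth Comb.depth Comb.img
  rw [Finset.card_image_of_injOn fun ρ hρ ρ' hρ' e => injOn_full hr hρ hρ' e, sub_self]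

theorem top_full (σ : X.Simplex) : top (full key σ) = σ := by
  refine le_antisymm ?_ ?_
  · obtain ⟨x, hx, h⟩ := mem_full.1 (top_mem (full key σ))
    change (top (full key σ)).1 ⊆ σ.1
    rw [h]
    exact seg_subset
  · obtain ⟨m, hm, hmax⟩ := σ.1.exists_max_image key σ.nonempty
    exact le_top (mem_full.2 ⟨m, hm, (seg_eq_self hmax).symm⟩)

/-- All initial segments of `P` belong to the flag `t`. -/
def Pre (key : X.V → K) (t : X.sd.Simplex) (P : Finset X.V) : Prop :=
  ∀ x ∈ P, ∃ ρ : X.Simplex, ρ ∈ t.1 ∧ ρ.1 = seg key P x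

theorem Pre.mono {t t' : X.sd.Simplex} {P : Finset X.V} (h : Pre key t P)
    (htt : ∀ ρ : X.Simplex, ρ ∈ t.1 → ρ.1 ⊆ P → ρ ∈ t'.1) : Pre key t' P := fun x hx => by
  obtain ⟨ρ, h1, h2⟩ := h x hx
  exact ⟨ρ, htt ρ h1 (h2 ▸ seg_subset), h2⟩

theorem Pre.sub {t : X.sd.Simplex} {P Q : Finset X.V} (h : Pre key t P) (hQ : Q ⊆ P)
    (hQP : ∀ y ∈ Q, ∀ z ∈ P, key z ≤ key y → z ∈ Q) : Pre key t Q := fun x hx => by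
  obtain ⟨ρ, h1, h2⟩ := h x (hQ hx)
  exact ⟨ρ, h1, by rw [h2, seg_seg hQ hx hQP]⟩

theorem Pre.exists_mem {t : X.sd.Simplex} {P : Finset X.V} (h : Pre key t P) (hP : P.Nonempty) :
    ∃ ρ : X.Simplex, ρ ∈ t.1 ∧ ρ.1 = P := by
  obtain ⟨m, hm, hmax⟩ := P.exists_max_image key hP
  obtain ⟨ρ, h1, h2⟩ := h m hm
  exact ⟨ρ, h1, by rw [h2, seg_eq_self hmax]⟩

theorem Pre.total {t : X.sd.Simplex} {P : Finset X.V} (h : Pre key t P) {ρ : X.Simplex}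
    (hρ : ρ ∈ t.1) : ρ.1 ⊆ P ∨ P ⊆ ρ.1 := by
  rcases P.eq_empty_or_nonempty with rfl | hP
  · exact Or.inr (Finset.empty_subset _)
  · obtain ⟨π, h1, rfl⟩ := h.exists_mem hP
    exact flag_total hρ h1

theorem Pre.total' {t : X.sd.Simplex} {P Q : Finset X.V} (h : Pre key t P) (h' : Pre key t Q) :
    P ⊆ Q ∨ Q ⊆ P := by
  rcases P.eq_empty_or_nonempty with rfl | hP
  · exact Or.inl (Finset.empty_subset _)
  · obtain ⟨π, h1, rfl⟩ := h.exists_mem hP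
    exact h'.total h1

/-- For `z` in `P` not exceeding the largest vertex of `ρ`, the segment ending at `z` is in the
flag, so it is comparable with `ρ`. If contained in `ρ`, it puts `z` there; if it contains `ρ`, the
largest vertex of `ρ` must be `z`. -/
theorem Pre.eq_seg (hr : IsMax key r) {t : X.sd.Simplex} {P : Finset X.V} (h : Pre key t P)
    {ρ : X.Simplex} (hρ : ρ ∈ t.1) (hP : ρ.1 ⊆ P) : ρ.1 = seg key P (r.toFun ρ) := by
  refine Finset.Subset.antisymm (fun y hy => mem_seg.2 ⟨hP hy, hr.le ρ y hy⟩) fun z hz => ?_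
  obtain ⟨hzP, hzr⟩ := mem_seg.1 hz
  obtain ⟨π, h1, h2⟩ := h z hzP
  rcases flag_total h1 hρ with h3 | h3
  · exact h3 (by rw [h2]; exact mem_seg.2 ⟨hzP, le_refl _⟩)
  · have : r.toFun ρ = z := by
      have h4 := h3 (r.mem ρ)
      rw [h2] at h4
      exact hr.inj (le_antisymm (mem_seg.1 h4).2 hzr)
    exact this ▸ r.mem ρ

theorem pre_full (σ : X.Simplex) : Pre key (full key σ) σ.1 := fun x hx => by
  have hs : seg key σ.1 x ∈ X.K.faces :=
    mem_faces_of_subset σ seg_subset ⟨x, mem_seg.2 ⟨hx, le_refl _⟩⟩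
  exact ⟨⟨_, hs⟩, mem_full.2 ⟨x, hx, rfl⟩, rfl⟩

/-- A nonempty set with this property is itself an element of the flag. Hence such sets are totally
ordered and bounded in size by the top, and one of maximal size is the largest. -/
theorem exists_prefix (key : X.V → K) (t : X.sd.Simplex) :
    ∃ P, Pre key t P ∧ ∀ Q, Pre key t Q → Q ⊆ P := by
  let S : Set ℕ := {n | ∃ P, Pre key t P ∧ P.card = n}
  have hb : BddAbove S := ⟨(top t).1.card, by
    rintro n ⟨P, hP, rfl⟩
    rcases P.eq_empty_or_nonempty with rfl | hne
    · exact Nat.zero_le _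
    · obtain ⟨π, h1, rfl⟩ := hP.exists_mem hne
      exact Finset.card_le_card (le_top h1)⟩
  obtain ⟨P, hP, hc⟩ := Nat.sSup_mem (s := S)
    ⟨0, ∅, fun x hx => (Finset.notMem_empty x hx).elim, rfl⟩ hb
  refine ⟨P, hP, fun Q hQ => ?_⟩
  rcases hQ.total' hP with h | h
  · exact h
  · have h1 : Q.card ≤ P.card := hc ▸ le_csSup hb ⟨Q, hQ, rfl⟩
    exact (Finset.eq_of_subset_of_card_le h h1).symm.subset

/-- The largest `P` all of whose initial segments belong to `t`. -/
def prefixOf (key : X.V → K) (t : X.sd.Simplex) : Finset X.V := Classical.choose (exists_prefix key t)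

theorem pre_prefixOf (t : X.sd.Simplex) : Pre key t (prefixOf key t) :=
  (Classical.choose_spec (exists_prefix key t)).1

theorem Pre.subset_prefixOf {t : X.sd.Simplex} {Q : Finset X.V} (h : Pre key t Q) :
    Q ⊆ prefixOf key t := (Classical.choose_spec (exists_prefix key t)).2 Q h

theorem Pre.prefixOf_eq {t : X.sd.Simplex} {P : Finset X.V} (h : Pre key t P)
    (h' : ∀ Q, Pre key t Q → Q ⊆ P) : prefixOf key t = P :=
  Finset.Subset.antisymm (h' _ (pre_prefixOf t)) h.subset_prefixOf

theorem prefixOf_subset_image (hr : IsMax key r) (t : X.sd.Simplex) :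
    prefixOf key t ⊆ (r.image t).1 := fun x hx => by
  obtain ⟨ρ, h1, h2⟩ := pre_prefixOf t x hx
  exact mem_image.2 ⟨ρ, h1, hr.of_eq_seg hx h2⟩

/-- If an element of `t` extends `P` properly without a larger vertex, then `P` is the prefix. -/
theorem Pre.prefixOf_eq_of_ssubset (hr : IsMax key r) {t : X.sd.Simplex} {P : Finset X.V}
    (h : Pre key t P) {R : X.Simplex} (hR : R ∈ t.1) (hPR : P ⊂ R.1) (hm : r.toFun R ∈ P) :
    prefixOf key t = P := by
  refine h.prefixOf_eq fun Q hQ => ?_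
  rcases hQ.total' h with h1 | h1
  · exact h1
  -- Let `m` be the largest vertex of `R`, which lies in `P`. If `R ⊆ Q`, then `R` is the segment of
  -- `Q` up to `m`, which is already a segment of `P`, against `P ⊂ R`. If `Q ⊆ R`, then `m` bounds
  -- `Q`, so `Q` is its own segment up to `m` and again lies in `P`.
  rcases hQ.total hR with h2 | h2
  · have h3 := hQ.eq_seg hr hR h2
    refine (hPR.2 fun z hz => ?_).elim
    obtain ⟨ρ, h4, h5⟩ := h _ hm
    have h6 := hQ.eq_seg hr h4 (by rw [h5]; exact seg_subset.trans h1)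
    rw [hr.of_eq_seg hm h5, ← h3] at h6
    rw [← h6, h5] at hz
    exact seg_subset hz
  · intro z hz
    obtain ⟨ρ, h4, h5⟩ := hQ z hz
    obtain ⟨ρ', h4', h5'⟩ := hQ _ (h1 hm)
    have hz' : z ∈ ρ'.1 := by
      rw [h5']
      exact mem_seg.2 ⟨hz, hr.le R z (h2 hz)⟩
    obtain ⟨π, h6, h7⟩ := h _ hm
    have h8 := hQ.eq_seg hr h6 (by rw [h7]; exact seg_subset.trans h1)
    rw [hr.of_eq_seg hm h7, ← h5', h7] at h8
    exact seg_subset (h8 ▸ hz')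

/-- The element of `t` following its prefix has the same largest vertex as the prefix. -/
def Doubled (key : X.V → K) (r : X.Approx) (t : X.sd.Simplex) : Prop :=
  ∃ R : X.Simplex, R ∈ t.1 ∧ prefixOf key t ⊂ R.1 ∧ r.toFun R ∈ prefixOf key t

/-- `y` is obtained from `t` by deleting the largest element of its prefix, whose largest vertex
is also that of the following element. -/
structure Match (key : X.V → K) (r : X.Approx) (y t : X.sd.Simplex) : Prop where
  doubled : Doubled key r t
  mem : ∀ ρ : X.Simplex, ρ ∈ y.1 ↔ ρ ∈ t.1 ∧ ρ.1 ≠ prefixOf key t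

theorem Doubled.exists_match {t : X.sd.Simplex} (h : Doubled key r t) : ∃ y, Match key r y t := by
  classical
  obtain ⟨R, hR, h1, -⟩ := id h
  let y : Finset X.Simplex := t.1.filter fun ρ : X.Simplex => ρ.1 ≠ prefixOf key t
  have hy : y ∈ X.sd.K.faces := mem_faces_of_subset (X := X.sd) t (Finset.filter_subset _ _)
    ⟨R, Finset.mem_filter.2 ⟨hR, h1.ne'⟩⟩
  exact ⟨⟨y, hy⟩, h, fun ρ => Finset.mem_filter⟩

/-- The prefix and the element `R` following it have the same largest vertex, so removing the prefix
keeps the image. The entry of `d'` for this pair is therefore an incidence number, a sign. -/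
theorem Match.del (hr : IsMax key r) {y t : X.sd.Simplex} (h : Match key r y t) :
    ∃ π : X.Simplex, π.1 = prefixOf key t ∧ Comb.Del r.toFun y.1 t.1 π := by
  obtain ⟨R, hR, h1, h2⟩ := h.doubled
  obtain ⟨π, h3, h4⟩ := (pre_prefixOf (key := key) t).exists_mem ⟨_, h2⟩
  have h5 : r.toFun π = r.toFun R := by
    refine hr.eq (h4 ▸ h2) fun z hz => ?_
    rw [h4] at hz
    exact hr.le R z (h1.1 hz)
  refine ⟨π, h4, h3, fun ρ => ?_, ?_⟩
  · refine (h.mem ρ).trans (and_congr_right fun _ => not_congr ⟨fun e => ?_, fun e => ?_⟩)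
    · exact Subtype.ext (e.trans h4.symm)
    · have e' : ρ = π := e
      rw [e', h4]
  · rw [h5]
    exact Comb.apply_mem_img (α := X.Simplex) r.toFun ((h.mem R).2 ⟨hR, h1.ne'⟩)

theorem Match.top_eq {y t : X.sd.Simplex} (h : Match key r y t) : top y = top t := by
  refine le_antisymm (le_top ((h.mem _).1 (top_mem y)).1) (le_top ((h.mem _).2 ⟨top_mem t, ?_⟩))
  intro e
  obtain ⟨R, hR, h1, h2⟩ := h.doubled
  have := le_top hR
  rw [← e] at h1
  exact h1.2 this

-- All proper initial segments of the prefix survive the deletion, and the prefix itself does not: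
-- exactly its largest vertex is lost.
open Classical in
theorem Match.prefixOf_eq (hr : IsMax key r) {y t : X.sd.Simplex} (h : Match key r y t) :
    ∃ m ∈ prefixOf key t, (∀ z ∈ prefixOf key t, key z ≤ key m) ∧
      prefixOf key y = (prefixOf key t).erase m := by
  obtain ⟨R, hR, h1, h2⟩ := h.doubled
  have hmax : ∀ z ∈ prefixOf key t, key z ≤ key (r.toFun R) := fun z hz => hr.le R z (h1.1 hz)
  refine ⟨_, h2, hmax, Pre.prefixOf_eq ?_ fun Q hQ => ?_⟩
  · have h3 : Pre key t ((prefixOf key t).erase (r.toFun R)) := by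
      refine (pre_prefixOf t).sub (Finset.erase_subset _ _) fun a ha z hz hza => ?_
      refine Finset.mem_erase.2 ⟨fun e => ?_, hz⟩
      obtain ⟨ha1, ha2⟩ := Finset.mem_erase.1 ha
      exact ha1 (hr.inj (le_antisymm (hmax a ha2) (e ▸ hza)))
    refine h3.mono fun ρ hρ hs => (h.mem ρ).2 ⟨hρ, fun e => ?_⟩
    rw [e] at hs
    exact Finset.notMem_erase _ _ (hs h2)
  · have h3 : Q ⊆ prefixOf key t := Pre.subset_prefixOf
      (hQ.mono fun ρ hρ _ => ((h.mem ρ).1 hρ).1)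
    refine Finset.subset_erase.2 ⟨h3, fun hm => ?_⟩
    obtain ⟨ρ, h4, h5⟩ := hQ _ hm
    obtain ⟨h6, h7⟩ := (h.mem ρ).1 h4
    refine h7 ?_
    have h8 : ρ.1 ⊆ prefixOf key t := h5 ▸ seg_subset.trans h3
    rw [(pre_prefixOf t).eq_seg hr h6 h8, hr.of_eq_seg hm h5]
    exact seg_eq_self hmax

theorem Match.card_prefixOf (hr : IsMax key r) {y t : X.sd.Simplex} (h : Match key r y t) :
    (prefixOf key t).card = (prefixOf key y).card + 1 := by
  classical
  obtain ⟨m, hm, -, e⟩ := h.prefixOf_eq hr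
  rw [e, Finset.card_erase_add_one hm]

theorem Match.unique_left {y y' t : X.sd.Simplex} (h : Match key r y t)
    (h' : Match key r y' t) : y = y' :=
  Subtype.ext (Finset.ext fun ρ => (h.mem ρ).trans (h'.mem ρ).symm)

/-- The elements following the two prefixes both lie in `y`. The prefixes have equal size, so each
is contained in both of these elements, and their largest vertices agree. Each prefix is the prefix
of `y` with that vertex added. -/
theorem Match.unique_right (hr : IsMax key r) {y t t' : X.sd.Simplex} (h : Match key r y t)
    (h' : Match key r y t') : t = t' := by
  classical
  obtain ⟨m, hm, hmax, e⟩ := h.prefixOf_eq hr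
  obtain ⟨m', hm', hmax', e'⟩ := h'.prefixOf_eq hr
  obtain ⟨R, hR, h1, h2⟩ := h.doubled
  obtain ⟨R', hR', h1', h2'⟩ := h'.doubled
  have eR : r.toFun R = m := hr.inj (le_antisymm (hmax _ h2) (hr.le R m (h1.1 hm)))
  have eR' : r.toFun R' = m' := hr.inj (le_antisymm (hmax' _ h2') (hr.le R' m' (h1'.1 hm')))
  have hRy : R ∈ y.1 := (h.mem R).2 ⟨hR, h1.ne'⟩
  have hRy' : R' ∈ y.1 := (h'.mem R').2 ⟨hR', h1'.ne'⟩
  have hc : (prefixOf key t).card = (prefixOf key t').card := by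
    rw [h.card_prefixOf hr, h'.card_prefixOf hr]
  have hRt : prefixOf key t ⊆ R'.1 := by
    rcases (pre_prefixOf (key := key) t).total ((h.mem R').1 hRy').1 with h3 | h3
    · have := Finset.card_le_card h3
      have := Finset.card_lt_card h1'
      omega
    · exact h3
  have hRt' : prefixOf key t' ⊆ R.1 := by
    rcases (pre_prefixOf (key := key) t').total ((h'.mem R).1 hRy).1 with h3 | h3
    · have := Finset.card_le_card h3
      have := Finset.card_lt_card h1
      omega
    · exact h3
  have emm : m = m' := hr.inj (le_antisymm (eR' ▸ hr.le R' m (hRt hm))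
    (eR ▸ hr.le R m' (hRt' hm')))
  have eP : prefixOf key t = prefixOf key t' := by
    rw [← Finset.insert_erase hm, ← Finset.insert_erase hm', ← e, ← e', emm]
  obtain ⟨π, e1, d⟩ := h.del hr
  obtain ⟨π', e1', d'⟩ := h'.del hr
  have eπ : π = π' := Subtype.ext (by rw [e1, e1', eP])
  refine Subtype.ext (Finset.ext fun ρ => ?_)
  by_cases hρ : ρ = π
  · rw [hρ]
    exact ⟨fun _ => eπ ▸ d'.mem, fun _ => d.mem⟩
  · have i1 := d.iff ρ
    have i2 := d'.iff ρ
    rw [← eπ] at i2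
    have hρ' : ¬ ρ = π := hρ
    tauto

/-- An element of the prefix whose largest vertex is shared by another element of the flag is the
last element of the prefix. -/
theorem doubled_of_subset_prefixOf (hr : IsMax key r) {t : X.sd.Simplex} {a b : X.Simplex}
    (ha : a ∈ t.1) (haP : a.1 ⊆ prefixOf key t) (hb : b ∈ t.1) (hba : b ≠ a)
    (e : r.toFun b = r.toFun a) : Doubled key r t ∧ a.1 = prefixOf key t := by
  have hP := pre_prefixOf (key := key) t
  have h1 := hP.eq_seg hr ha haP
  have hbP : ¬ b.1 ⊆ prefixOf key t := fun h => hba (Subtype.ext (by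
    rw [hP.eq_seg hr hb h, h1, e]))
  have hPb : prefixOf key t ⊂ b.1 :=
    ⟨(hP.total hb).resolve_left hbP, hbP⟩
  refine ⟨⟨b, hb, hPb, e ▸ haP (r.mem a)⟩, ?_⟩
  rw [h1]
  exact seg_eq_self fun z hz => e ▸ hr.le b z (hPb.1 hz)

theorem card_prefixOf_le_of_subset {t t' : X.sd.Simplex}
    (h : ∀ ρ : X.Simplex, ρ ∈ t.1 → ρ.1 ⊆ prefixOf key t → ρ ∈ t'.1) :
    (prefixOf key t).card ≤ (prefixOf key t').card :=
  Finset.card_le_card ((pre_prefixOf t).mono h).subset_prefixOf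

/-- Deleting from a doubled flag another element than that of the matching. -/
theorem Match.lt_of_del (hr : IsMax key r) {y t j : X.sd.Simplex} (h : Match key r y t)
    {a : X.Simplex} (ha : Comb.Del r.toFun j.1 t.1 a) (hj : j ≠ y) :
    (prefixOf key y).card < (prefixOf key j).card := by
  have h1 := h.card_prefixOf hr
  -- If the deleted element lay in the prefix, another element would share its largest vertex, so it
  -- would be the prefix itself and `j = y`. Hence the prefix of `t` survives in `j`.
  have h2 : (prefixOf key t).card ≤ (prefixOf key j).card := by
    refine card_prefixOf_le_of_subset fun ρ hρ hs => (ha.iff ρ).2 ⟨hρ, fun e => hj ?_⟩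
    have e' : ρ = a := e
    subst e'
    obtain ⟨b, hb, hba⟩ := Comb.mem_img.1 ha.im
    obtain ⟨hb1, hb2⟩ := (ha.iff b).1 hb
    obtain ⟨-, h3⟩ := doubled_of_subset_prefixOf hr hρ hs hb1 hb2 hba
    refine Subtype.ext (Finset.ext fun c => (ha.iff c).trans ((h.mem c).trans
      (and_congr_right fun _ => not_congr ?_)).symm)
    rw [← h3]
    exact Subtype.ext_iff.symm
  omega

/-- Deleting an element of a flag and then adding the matching one. -/
theorem Match.lt_of_del' (hr : IsMax key r) {y t j : X.sd.Simplex} (h : Match key r y j)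
    {a : X.Simplex} (ha : Comb.Del r.toFun y.1 t.1 a) (hj : j ≠ t) :
    (prefixOf key t).card < (prefixOf key j).card := by
  have h1 := h.card_prefixOf hr
  -- If `a` lay in the prefix of `t`, then `t` would be doubled with prefix `a`, and `y` would be
  -- matched with `t`, against `j ≠ t`.
  have h2 : (prefixOf key t).card ≤ (prefixOf key y).card := by
    refine card_prefixOf_le_of_subset fun ρ hρ hs => (ha.iff ρ).2 ⟨hρ, fun e => hj ?_⟩
    have e' : ρ = a := e
    subst e'
    obtain ⟨b, hb, hba⟩ := Comb.mem_img.1 ha.im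
    obtain ⟨hb1, hb2⟩ := (ha.iff b).1 hb
    obtain ⟨h4, h3⟩ := doubled_of_subset_prefixOf hr hρ hs hb1 hb2 hba
    refine h.unique_right hr ⟨h4, fun c => (ha.iff c).trans
      (and_congr_right fun _ => not_congr ?_)⟩
    rw [← h3]
    exact Subtype.ext_iff
  omega

/-- A flag consists of initial segments, or is one of the two members of a matched pair. -/
theorem full_or_doubled_or_match (hr : IsMax key r) (t : X.sd.Simplex) :
    t = full key (r.image t) ∨ Doubled key r t ∨ ∃ k, Match key r t k := by
  classical
  have hP := pre_prefixOf (key := key) t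
  by_cases hall : ∀ ρ : X.Simplex, ρ ∈ t.1 → ρ.1 ⊆ prefixOf key t
  · left
    have him : (r.image t).1 = prefixOf key t := by
      refine Finset.Subset.antisymm (fun x hx => ?_) (prefixOf_subset_image hr t)
      obtain ⟨ρ, hρ, rfl⟩ := mem_image.1 hx
      exact hall ρ hρ (r.mem ρ)
    refine Subtype.ext (Finset.ext fun ρ => ?_)
    rw [mem_full (ρ := ρ), him]
    constructor
    · exact fun hρ => ⟨_, hall ρ hρ (r.mem ρ), hP.eq_seg hr hρ (hall ρ hρ)⟩
    · rintro ⟨x, hx, h⟩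
      obtain ⟨ρ', h1, h2⟩ := hP x hx
      have : ρ = ρ' := Subtype.ext (h.trans h2.symm)
      rwa [this]
  right
  push Not at hall
  let S : Finset X.Simplex := t.1.filter fun ρ : X.Simplex => ¬ ρ.1 ⊆ prefixOf key t
  have hS : ∀ ρ : X.Simplex, ρ ∈ S ↔ ρ ∈ t.1 ∧ ¬ ρ.1 ⊆ prefixOf key t :=
    fun ρ => Finset.mem_filter
  -- `R` is the element that follows the prefix. The flag is doubled if the largest vertex of `R` is
  -- in the prefix; otherwise the partner is obtained by inserting the prefix extended by that
  -- vertex.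
  obtain ⟨R, hRS, hmin⟩ := S.exists_minimal (by
    obtain ⟨ρ, h1, h2⟩ := hall
    exact ⟨ρ, (hS ρ).2 ⟨h1, h2⟩⟩)
  obtain ⟨hR, hRP⟩ := (hS R).1 hRS
  have hPR : prefixOf key t ⊂ R.1 := ⟨(hP.total hR).resolve_left hRP, hRP⟩
  have hle : ∀ ρ : X.Simplex, ρ ∈ S → R.1 ⊆ ρ.1 := fun ρ hρ => by
    rcases flag_total ((hS ρ).1 hρ).1 hR with h | h
    · exact hmin hρ h
    · exact h
  by_cases hm : r.toFun R ∈ prefixOf key t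
  · exact Or.inl ⟨R, hR, hPR, hm⟩
  right
  let x : Finset X.V := insert (r.toFun R) (prefixOf key t)
  have hxR : x ⊆ R.1 := Finset.insert_subset (r.mem R) hPR.1
  have hxm : ∀ z ∈ x, key z ≤ key (r.toFun R) := fun z hz => hr.le R z (hxR hz)
  let ξ : X.Simplex := ⟨x, mem_faces_of_subset R hxR ⟨_, Finset.mem_insert_self _ _⟩⟩
  have hξ : r.toFun ξ = r.toFun R := hr.eq (Finset.mem_insert_self _ _) hxm
  have hsegx : ∀ z ∈ prefixOf key t, seg key x z = seg key (prefixOf key t) z := fun z hz =>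
    (seg_seg (Finset.subset_insert _ _) hz fun y hy c hc hcy => by
      rcases Finset.mem_insert.1 hc with rfl | h
      · exact (hm (hr.inj (le_antisymm hcy (hr.le R y (hPR.1 hy))) ▸ hy)).elim
      · exact h).symm
  -- Were it present, the prefix of `t` would be longer.
  have hxt : ξ ∉ t.1 := fun h => by
    refine hm (Pre.subset_prefixOf (Q := x) (fun z hz => ?_) (Finset.mem_insert_self _ _))
    rcases Finset.mem_insert.1 hz with rfl | hz'
    · exact ⟨ξ, h, (seg_eq_self hxm).symm⟩
    · rw [hsegx z hz']
      exact hP z hz'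
  have hcmp : ∀ ρ : X.Simplex, ρ ∈ t.1 → ρ.1 ⊆ x ∨ x ⊆ ρ.1 := fun ρ hρ => by
    by_cases h : ρ.1 ⊆ prefixOf key t
    · exact Or.inl (h.trans (Finset.subset_insert _ _))
    · exact Or.inr (hxR.trans (hle ρ ((hS ρ).2 ⟨hρ, h⟩)))
  let k : X.sd.Simplex := ⟨(insert ξ t.1 : Finset X.Simplex), by
    refine ⟨⟨ξ, Finset.mem_insert_self _ _⟩, fun a ha b hb _ => ?_⟩
    have ha' : a = ξ ∨ a ∈ t.1 := Finset.mem_insert.1 (Finset.mem_coe.1 ha)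
    have hb' : b = ξ ∨ b ∈ t.1 := Finset.mem_insert.1 (Finset.mem_coe.1 hb)
    rcases ha' with rfl | ha' <;> rcases hb' with rfl | hb'
    · exact Or.inl (le_refl _)
    · exact (hcmp b hb').symm
    · exact hcmp a ha'
    · exact flag_total ha' hb'⟩
  have hk : ∀ ρ : X.Simplex, ρ ∈ k.1 ↔ ρ = ξ ∨ ρ ∈ t.1 := fun ρ => Finset.mem_insert
  have hRx : x ⊂ R.1 := (Finset.ssubset_iff_subset_ne).2 ⟨hxR, fun e => hxt (by
    have : ξ = R := Subtype.ext e
    rwa [this])⟩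
  have hpre : Pre key k x := fun z hz => by
    rcases Finset.mem_insert.1 hz with rfl | hz'
    · exact ⟨ξ, (hk ξ).2 (Or.inl rfl), (seg_eq_self hxm).symm⟩
    · rw [hsegx z hz']
      obtain ⟨ρ, h1, h2⟩ := hP z hz'
      exact ⟨ρ, (hk ρ).2 (Or.inr h1), h2⟩
  have hpk : prefixOf key k = x := hpre.prefixOf_eq_of_ssubset hr ((hk R).2 (Or.inr hR)) hRx
    (Finset.mem_insert_self _ _)
  refine ⟨k, ⟨R, (hk R).2 (Or.inr hR), hpk ▸ hRx, hpk ▸ Finset.mem_insert_self _ _⟩, fun ρ => ?_⟩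
  rw [hk, hpk]
  constructor
  · exact fun h => ⟨Or.inr h, fun e => hxt (by
      have : ρ = ξ := Subtype.ext e
      rwa [← this])⟩
  · rintro ⟨h | h, h'⟩
    · exact (h' (by rw [h])).elim
    · exact h

/-- The prefix of `y` is that of `t` without its largest vertex `m`. An element of `y` that strictly
contains it is either inside the prefix of `t`, hence equal to it and so excluded, or contains `m`,
which is then not exceeded by its largest vertex. -/
theorem not_doubled_of_match (hr : IsMax key r) {y t : X.sd.Simplex} (h : Match key r y t) :
    ¬ Doubled key r y := by
  classical
  rintro ⟨b, hb, h1, h2⟩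
  obtain ⟨m, hm, hmax, e⟩ := h.prefixOf_eq hr
  obtain ⟨hbt, hbP⟩ := (h.mem b).1 hb
  rw [e] at h1 h2
  obtain ⟨h3, h4⟩ := Finset.mem_erase.1 h2
  rcases (pre_prefixOf (key := key) t).total hbt with h5 | h5
  · have h6 := Finset.card_lt_card h1
    rw [Finset.card_erase_of_mem hm] at h6
    refine hbP (Finset.eq_of_subset_of_card_le h5 ?_)
    omega
  · exact h3 (hr.inj (le_antisymm (hmax _ h4) (hr.le b m (h5 hm))))

theorem not_doubled_full (σ : X.Simplex) : ¬ Doubled key r (full key σ) := by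
  rintro ⟨R, hR, h1, -⟩
  obtain ⟨x, -, h⟩ := mem_full.1 hR
  refine h1.2 (Finset.Subset.trans ?_ (pre_full σ).subset_prefixOf)
  rw [h]
  exact seg_subset

theorem prefixOf_full (hr : IsMax key r) (σ : X.Simplex) : prefixOf key (full key σ) = σ.1 := by
  refine Finset.Subset.antisymm ?_ (pre_full σ).subset_prefixOf
  have := prefixOf_subset_image hr (full key σ)
  rwa [image_full hr] at this

theorem not_match_full (hr : IsMax key r) (σ : X.Simplex) (t : X.sd.Simplex) :
    ¬ Match key r (full key σ) t := by
  classical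
  intro h
  obtain ⟨m, hm, hmax, e⟩ := h.prefixOf_eq hr
  obtain ⟨R, hR, h1, h2⟩ := h.doubled
  have h3 : R ∈ (full key σ).1 := (h.mem R).2 ⟨hR, h1.ne'⟩
  obtain ⟨x, -, h4⟩ := mem_full.1 h3
  rw [prefixOf_full hr] at e
  have h5 : R.1 ⊆ (prefixOf key t).erase m := by
    rw [← e, h4]
    exact seg_subset
  exact h1.2 (h5.trans (Finset.erase_subset _ _))

/-- If the prefix were the whole image, `t` would contain all the initial segments of its image.
Depth zero leaves no room for other elements. -/
theorem card_prefixOf_lt (hr : IsMax key r) {t : X.sd.Simplex} (h0 : r.depth t = 0)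
    (ht : t ≠ full key (r.image t)) :
    (prefixOf key t).card < (prefixOf key (full key (r.image t))).card := by
  classical
  rw [prefixOf_full hr]
  refine Finset.card_lt_card ((Finset.ssubset_iff_subset_ne).2 ⟨prefixOf_subset_image hr t,
    fun e => ht ?_⟩)
  have hsub : (full key (r.image t)).1 ⊆ t.1 := fun (ρ : X.Simplex) hρ => by
    obtain ⟨x, hx, h⟩ := mem_full.1 hρ
    rw [← e] at hx h
    obtain ⟨ρ', h1, h2⟩ := pre_prefixOf t x hx
    have : ρ = ρ' := Subtype.ext (h.trans h2.symm)
    rwa [this]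
  have hf := depth_full hr (r.image t)
  unfold Approx.depth Comb.depth at h0 hf
  have h1 : Comb.img r.toFun (full key (r.image t)).1 = Comb.img r.toFun t.1 :=
    congrArg Subtype.val (image_full hr (r.image t))
  rw [h1] at hf
  exact (Subtype.ext (Finset.eq_of_subset_of_card_le hsub (by omega))).symm

end LFComplex

open LFComplex Fam

theorem LFComplex.depth_nonneg {X : LFComplex.{u}} (r : X.Approx) (t : X.sd.Simplex) :
    0 ≤ r.depth t := by
  classical
  have : (Comb.img r.toFun t.1).card ≤ t.1.card := Finset.card_image_le
  unfold Approx.depth Comb.depth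
  omega

/-! ### The deformation retraction of a subdivision -/

section Subdivision

variable {X : LFComplex.{u}} {B : Type w} [Category.{v} B] [Preadditive B] {I I' : Type u}

open Classical in
/-- `d'` is the differential of the subdivision of the differential object `(M, d)` of `X`-graded
objects, both written as families over all simplices and degrees: `p`, `p'` and `deg`, `deg'` give
the simplices and degrees of the indices, and the summand of the subdivision with index `i` is a
copy of the summand `q i` of `M`. -/
structure IsSubdivision (r : X.Approx) (o : X.VertexOrder) {M : I → B} (p : I → X.Simplex)
    (deg : I → ℤ) (q : I' → I) (p' : I' → X.sd.Simplex) (deg' : I' → ℤ) (ε : ℤ) (ψ : I' → ℤ)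
    (d : Fam.mk I M ⟶ Fam.mk I M)
    (d' : Fam.mk I' (fun i => M (q i)) ⟶ Fam.mk I' fun i => M (q i)) : Prop where
  compat : ∀ i, p (q i) = r.image (p' i)
  inj : ∀ i j, p' i = p' j → q i = q j → i = j
  surj : ∀ s i, p i = r.image s → ∃ i', p' i' = s ∧ q i' = i
  deg_eq : ∀ i, deg (q i) = deg' i + ε * r.depth (p' i)
  sign : ∀ i, ψ i * ψ i = 1
  ent_eq : ∀ j i : I', ent d' j i =
    (if r.IsParallel (p' j) (p' i) then ent d (q j) (q i) else 0) +
      (ψ i * r.incidence o (p' j) (p' i)) • idEntry M (q j) (q i)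
  supp : Supp d fun j i => p j ≤ p i ∧ deg j = deg i + ε
  sq : d ≫ d = 0
  sq' : d' ≫ d' = 0

namespace IsSubdivision

variable {K : Type*} [LinearOrder K] {key : X.V → K} {r : X.Approx} {o : X.VertexOrder} {M : I → B}
  {p : I → X.Simplex} {deg : I → ℤ} {q : I' → I} {p' : I' → X.sd.Simplex} {deg' : I' → ℤ} {ε : ℤ}
  {ψ : I' → ℤ} {d : Fam.mk I M ⟶ Fam.mk I M}
  {d' : Fam.mk I' (fun i => M (q i)) ⟶ Fam.mk I' fun i => M (q i)}

theorem of_ent (S : IsSubdivision r o p deg q p' deg' ε ψ d d') {j i : I'}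
    (h : ent d' j i ≠ 0) :
    (r.IsParallel (p' j) (p' i) ∧ ent d (q j) (q i) ≠ 0) ∨
      ((∃ a, Comb.Del r.toFun (p' j).1 (p' i).1 a) ∧ q i = q j) := by
  classical
  rw [S.ent_eq] at h
  by_cases h1 : r.IsParallel (p' j) (p' i) ∧ ent d (q j) (q i) ≠ 0
  · exact Or.inl h1
  right
  have h2 : (if r.IsParallel (p' j) (p' i) then ent d (q j) (q i) else 0) = 0 := by
    split_ifs with h3
    · by_contra h4
      exact h1 ⟨h3, h4⟩
    · rfl
  rw [h2, zero_add] at h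
  refine ⟨Comb.exists_del (fun a b : X.Simplex => a < b) o.lt fun h3 => h ?_, ?_⟩
  · have h4 : r.incidence o (p' j) (p' i) = 0 := h3
    rw [h4, mul_zero, zero_smul]
  · by_contra h3
    exact h (by rw [idEntry_ne M h3, smul_zero])

/-- A deletion lowers the depth by one and parallel flags have equal depth, so the two kinds of
entries of `d'` never overlap. -/
theorem ent_of_del (S : IsSubdivision r o p deg q p' deg' ε ψ d d') {j i : I'} {a : X.Simplex}
    (h : Comb.Del r.toFun (p' j).1 (p' i).1 a) :
    ent d' j i = (ψ i * r.incidence o (p' j) (p' i)) • idEntry M (q j) (q i) := by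
  rw [S.ent_eq, if_neg, zero_add]
  intro h1
  have h2 := h1.2
  rw [h.depth_eq] at h2
  omega

theorem ent_of_parallel (S : IsSubdivision r o p deg q p' deg' ε ψ d d') {j i : I'}
    (h : r.IsParallel (p' j) (p' i)) : ent d' j i = ent d (q j) (q i) := by
  rw [S.ent_eq, if_pos h]
  have : r.incidence o (p' j) (p' i) = 0 := by
    by_contra h1
    obtain ⟨a, ha⟩ := Comb.exists_del _ _ h1
    have h2 := h.2
    rw [ha.depth_eq] at h2
    omega
  rw [this, mul_zero, zero_smul, add_zero]

theorem incidence_sq {r : X.Approx} {o : X.VertexOrder} {t s : X.sd.Simplex} {a : X.Simplex}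
    (h : Comb.Del r.toFun t.1 s.1 a) : r.incidence o t s * r.incidence o t s = 1 := by
  unfold Approx.incidence
  rw [Comb.incidence_eq _ _ h, ← mul_pow]
  simp

theorem supp_d' (S : IsSubdivision r o p deg q p' deg' ε ψ d d') :
    Supp d' fun j i => top (p' j) ≤ top (p' i) ∧ deg' j = deg' i + ε := by
  intro j i h
  have e1 := S.deg_eq j
  have e2 := S.deg_eq i
  rcases S.of_ent h with ⟨h1, h2⟩ | ⟨⟨a, ha⟩, h2⟩
  · have h3 := (S.supp _ _ h2).2
    have h4 : r.depth (p' j) = r.depth (p' i) := h1.2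
    rw [h4] at e1
    exact ⟨top_mono h1.1, by change deg (q j) = deg (q i) + ε at h3; omega⟩
  · have h4 : r.depth (p' i) = r.depth (p' j) + 1 := ha.depth_eq
    rw [h2] at e2
    rw [h4, mul_add, mul_one] at e2
    exact ⟨top_mono ha.subset, by omega⟩

open Classical in
/-- The projection onto the summands of depth zero. -/
def proj (_S : IsSubdivision r o p deg q p' deg' ε ψ d d') :
    Fam.mk I' (fun i => M (q i)) ⟶ Fam.mk I M :=
  Fam.mk' (fun i i' => if r.depth (p' i') = 0 then idEntry M i (q i') else 0) fun i' =>
    (Set.finite_singleton (q i')).subset fun i hi => by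
      by_contra h
      refine hi ?_
      rw [idEntry_ne M fun e => h e.symm, ite_self]

theorem ent_proj (S : IsSubdivision r o p deg q p' deg' ε ψ d d') {i : I} {i' : I'}
    (h : r.depth (p' i') = 0) : ent S.proj i i' = idEntry M i (q i') := if_pos h

theorem of_ent_proj (S : IsSubdivision r o p deg q p' deg' ε ψ d d') {i : I} {i' : I'}
    (h : ent S.proj i i' ≠ 0) : r.depth (p' i') = 0 ∧ q i' = i := by
  classical
  have h1 : r.depth (p' i') = 0 := by
    by_contra h1
    exact h (if_neg h1)
  refine ⟨h1, ?_⟩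
  rw [S.ent_proj h1] at h
  by_contra h2
  exact h (idEntry_ne M h2)

open Classical in
/-- The inclusion of `M` as the summands over the flags of initial segments. -/
def incl (S : IsSubdivision r o p deg q p' deg' ε ψ d d') (key : X.V → K) :
    Fam.mk I M ⟶ Fam.mk I' fun i => M (q i) :=
  Fam.mk' (fun i' i => if p' i' = full key (p i) then idEntry M (q i') i else 0) fun i =>
    Set.Subsingleton.finite fun x hx y hy => by
      have h : ∀ z, (if p' z = full key (p i) then idEntry M (q z) i else 0) ≠ 0 →
          p' z = full key (p i) ∧ i = q z := fun z hz => by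
        by_cases h1 : p' z = full key (p i)
        · rw [if_pos h1] at hz
          refine ⟨h1, ?_⟩
          by_contra h2
          exact hz (idEntry_ne M h2)
        · exact (hz (if_neg h1)).elim
      obtain ⟨h1, h2⟩ := h x hx
      obtain ⟨h3, h4⟩ := h y hy
      exact S.inj _ _ (h1.trans h3.symm) (h2.symm.trans h4)

theorem ent_incl (S : IsSubdivision r o p deg q p' deg' ε ψ d d') {i : I} {i' : I'}
    (h : p' i' = full key (p i)) : ent (S.incl key) i' i = idEntry M (q i') i := if_pos h

theorem of_ent_incl (S : IsSubdivision r o p deg q p' deg' ε ψ d d') {i : I} {i' : I'}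
    (h : ent (S.incl key) i' i ≠ 0) : p' i' = full key (p i) ∧ i = q i' := by
  classical
  have h1 : p' i' = full key (p i) := by
    by_contra h1
    exact h (if_neg h1)
  refine ⟨h1, ?_⟩
  rw [S.ent_incl h1] at h
  by_contra h2
  exact h (idEntry_ne M h2)

open Classical in
/-- The homotopy given by the matching of flags. -/
def matching (S : IsSubdivision r o p deg q p' deg' ε ψ d d') (hr : IsMax key r) :
    Fam.mk I' (fun i => M (q i)) ⟶ Fam.mk I' fun i => M (q i) :=
  Fam.mk' (fun j i => if Match key r (p' i) (p' j) then
      (ψ j * r.incidence o (p' i) (p' j)) • idEntry M (q j) (q i) else 0) fun i =>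
    -- The partner of a flag is unique, so a column has at most one nonzero entry.
    Set.Subsingleton.finite fun x hx y hy => by
      have h : ∀ z, (if Match key r (p' i) (p' z) then
          (ψ z * r.incidence o (p' i) (p' z)) • idEntry M (q z) (q i) else 0) ≠ 0 →
          Match key r (p' i) (p' z) ∧ q i = q z := fun z hz => by
        by_cases h1 : Match key r (p' i) (p' z)
        · rw [if_pos h1] at hz
          refine ⟨h1, ?_⟩
          by_contra h2
          exact hz (by rw [idEntry_ne M h2, smul_zero])
        · exact (hz (if_neg h1)).elim
      obtain ⟨h1, h2⟩ := h x hx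
      obtain ⟨h3, h4⟩ := h y hy
      exact S.inj _ _ (h1.unique_right hr h3) (h2.symm.trans h4)

theorem ent_matching (S : IsSubdivision r o p deg q p' deg' ε ψ d d') (hr : IsMax key r)
    {j i : I'} (h : Match key r (p' i) (p' j)) : ent (S.matching hr) j i =
      (ψ j * r.incidence o (p' i) (p' j)) • idEntry M (q j) (q i) := if_pos h

theorem of_ent_matching (S : IsSubdivision r o p deg q p' deg' ε ψ d d') (hr : IsMax key r)
    {j i : I'} (h : ent (S.matching hr) j i ≠ 0) : Match key r (p' i) (p' j) ∧ q i = q j := by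
  classical
  have h1 : Match key r (p' i) (p' j) := by
    by_contra h1
    exact h (if_neg h1)
  refine ⟨h1, ?_⟩
  rw [S.ent_matching hr h1] at h
  by_contra h2
  exact h (by rw [idEntry_ne M h2, smul_zero])

theorem incl_proj (S : IsSubdivision r o p deg q p' deg' ε ψ d d') (hr : IsMax key r) :
    S.incl key ≫ S.proj = 𝟙 _ := by
  ext t s
  obtain ⟨j, h1, h2⟩ := S.surj (full key (p s)) s (image_full hr _).symm
  rw [ent_comp_single _ _ j fun j' h _ => S.inj _ _ ((S.of_ent_incl h).1.trans h1.symm)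
    ((S.of_ent_incl h).2.symm.trans h2.symm), S.ent_incl h1, S.ent_proj (h1 ▸ depth_full hr _)]
  exact idEntry_comp_app M (fun x => idEntry M t x) h2.symm

/-- The matching adds an element without changing the image, so it lands in positive depth. -/
theorem matching_proj (S : IsSubdivision r o p deg q p' deg' ε ψ d d') (hr : IsMax key r) :
    S.matching hr ≫ S.proj = 0 := by
  ext t s
  by_contra h
  obtain ⟨k, h1, h2⟩ := exists_of_ent_comp h
  obtain ⟨π, -, ha⟩ := (S.of_ent_matching hr h1).1.del hr
  have h3 := (S.of_ent_proj h2).1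
  have h4 : r.depth (p' k) = r.depth (p' s) + 1 := ha.depth_eq
  have := depth_nonneg r (p' s)
  omega

-- This is `Comb.sum_parallel_incidence` for `q = ∅`: the empty set is parallel to `t` precisely
-- when `t` has depth zero, and it is never a deletion of `t`, as this would have to preserve the
-- image.
open Classical in
theorem sum_incidence_depth_zero (r : X.Approx) (o : X.VertexOrder) (s : X.sd.Simplex) :
    ∑ t ∈ s.1.powerset, (if Comb.depth r.toFun t = 0 then
      Comb.incidence (β := X.V) r.toFun (fun a b : X.Simplex => a < b) o.lt t s.1 else 0) = 0 := by
  have h := Comb.sum_parallel_incidence (q := (∅ : Finset X.Simplex)) (s := s.1) s.1.powerset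
    (fun t _ h => Finset.mem_powerset.2 h) (Variance.tot_lt s) (Variance.tot_order (r := r) o s)
  have h0 : Comb.img r.toFun (∅ : Finset X.Simplex) = ∅ := by
    unfold Comb.img
    exact Finset.image_empty _
  refine Eq.trans (Finset.sum_congr rfl fun t ht => ?_) (h.symm.trans ?_)
  · refine if_congr ?_ rfl rfl
    unfold Comb.IsParallel
    have h1 : Comb.depth r.toFun (∅ : Finset X.Simplex) = 0 := by
      unfold Comb.depth
      rw [h0]
      simp
    rw [h1]
    exact ⟨fun e => ⟨Finset.empty_subset _, e.symm⟩, fun e => e.2.symm⟩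
  · refine Finset.sum_eq_zero fun t _ => ?_
    split_ifs
    · by_contra hne
      obtain ⟨a, ha⟩ := Comb.exists_del _ _ hne
      have := ha.im
      rw [h0] at this
      exact Finset.notMem_empty _ this
    · rfl

/-- From depth zero, only parallel faces contribute, and these correspond to the faces of the image.
From positive depth, only deletions reach depth zero, and their signs cancel. -/
theorem d'_proj (S : IsSubdivision r o p deg q p' deg' ε ψ d d') :
    d' ≫ S.proj = S.proj ≫ d := by
  classical
  ext i s
  have hR : ent (S.proj ≫ d) i s = if r.depth (p' s) = 0 then ent d i (q s) else 0 := by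
    rw [ent_comp_single _ _ (q s) fun k h _ => (S.of_ent_proj h).2.symm]
    split_ifs with h
    · rw [S.ent_proj h, idEntry_self]
      exact Category.id_comp _
    · have : ent S.proj (q s) s = 0 := by
        by_contra h1
        exact h (S.of_ent_proj h1).1
      rw [this, zero_comp]
  rw [hR]
  split_ifs with h0
  · have hz : ∀ k, ent d' k s ≠ 0 → ent S.proj i k ≠ 0 →
        r.IsParallel (p' k) (p' s) ∧ q k = i := fun k h1 h2 => by
      obtain ⟨h3, h4⟩ := S.of_ent_proj h2
      rcases S.of_ent h1 with ⟨h5, -⟩ | ⟨⟨a, ha⟩, -⟩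
      · exact ⟨h5, h4⟩
      · have h6 : r.depth (p' s) = r.depth (p' k) + 1 := ha.depth_eq
        omega
    by_cases hle : p i ≤ p (q s)
    · rw [S.compat] at hle
      -- At depth zero the empty set is parallel to the flag, so each face of the image is covered
      -- by exactly one parallel face.
      have he : Comb.IsParallel r.toFun (∅ : Finset X.Simplex) (p' s).1 := by
        refine ⟨Finset.empty_subset _, ?_⟩
        have h1 : Comb.depth r.toFun (p' s).1 = 0 := h0
        rw [h1]
        unfold Comb.depth Comb.img
        simp
      obtain ⟨t, ht1, ht2, ht3⟩ := Comb.exists_parallel r.toFun he (p i).1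
        (by
          unfold Comb.img
          rw [Finset.image_empty]
          exact Finset.empty_subset _) hle
      have hne : t.Nonempty := by
        obtain ⟨x, hx⟩ := (p i).nonempty
        rw [← ht3] at hx
        obtain ⟨a, ha, -⟩ := Comb.mem_img.1 hx
        exact ⟨a, ha⟩
      let t' : X.sd.Simplex := ⟨t, mem_faces_of_subset (X := X.sd) (p' s) ht2.1 hne⟩
      obtain ⟨j, hj1, hj2⟩ := S.surj t' i (Subtype.ext ht3.symm)
      have hj3 : r.IsParallel (p' j) (p' s) := by
        rw [hj1]
        exact ht2
      rw [ent_comp_single _ _ j fun k h1 h2 => by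
        obtain ⟨h3, h4⟩ := hz k h1 h2
        refine S.inj _ _ (Subtype.ext (h3.ext hj3 ?_)) (h4.trans hj2.symm)
        have e1 := S.compat k
        have e2 := S.compat j
        rw [h4] at e1
        rw [hj2] at e2
        exact congrArg Subtype.val (e1.symm.trans e2)]
      have hd : r.depth (p' j) = 0 := hj3.2.trans h0
      rw [S.ent_of_parallel hj3, S.ent_proj hd]
      exact app_comp_idEntry M (fun x => ent d x (q s)) hj2
    · have h1 : ent d i (q s) = 0 := by
        by_contra h1
        exact hle (S.supp _ _ h1).1
      rw [h1]
      by_contra h2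
      obtain ⟨k, h3, h4⟩ := exists_of_ent_comp h2
      obtain ⟨h5, h6⟩ := hz k h3 h4
      refine hle ?_
      rw [← h6, S.compat, S.compat]
      exact image_mono r h5.1
  -- At positive depth the right-hand side vanishes. On the left, parallel entries keep the depth
  -- positive, so only deletions remain and the sum is a multiple of that in
  -- `sum_incidence_depth_zero`.
  · have hz : ∀ k, ent d' k s ≠ 0 → ent S.proj i k ≠ 0 →
        (∃ a, Comb.Del r.toFun (p' k).1 (p' s).1 a) ∧ r.depth (p' k) = 0 ∧ q k = q s ∧ i = q s := by
      intro k h1 h2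
      obtain ⟨h3, h4⟩ := S.of_ent_proj h2
      rcases S.of_ent h1 with ⟨h5, -⟩ | ⟨ha, h6⟩
      · have : r.depth (p' k) = r.depth (p' s) := h5.2
        omega
      · exact ⟨ha, h3, h6.symm, h4.symm.trans h6.symm⟩
    by_cases hi : i = q s
    swap
    · by_contra h2
      obtain ⟨k, h3, h4⟩ := exists_of_ent_comp h2
      exact hi (hz k h3 h4).2.2.2
    subst hi
    let G : Finset X.Simplex → ℤ := fun t => if Comb.depth r.toFun t = 0 then
      Comb.incidence (β := X.V) r.toFun (fun a b : X.Simplex => a < b) o.lt t (p' s).1 else 0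
    have hterm : ∀ k, q k = q s → (∃ a, Comb.Del r.toFun (p' k).1 (p' s).1 a) →
        r.depth (p' k) = 0 → ent d' k s ≫ ent S.proj (q s) k =
          (ψ s * G (p' k).1) • 𝟙 (M (q s)) := fun k hk ⟨a, ha⟩ hd => by
      have hG : G (p' k).1 = r.incidence o (p' k) (p' s) := if_pos hd
      rw [S.ent_of_del ha, S.ent_proj hd, hG, Preadditive.zsmul_comp]
      congr 1
      rw [idEntry_comp_app M (fun x => idEntry M (q s) x) hk.symm, idEntry_self]
    have hfin := ent_comp_finite d' S.proj (q s) s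
    let Z := hfin.toFinset
    have hZ : ∀ k, k ∈ Z → (∃ a, Comb.Del r.toFun (p' k).1 (p' s).1 a) ∧
        r.depth (p' k) = 0 ∧ q k = q s := fun k hk => by
      have h1 : ent d' k s ≫ ent S.proj (q s) k ≠ 0 := (Set.Finite.mem_toFinset _).1 hk
      obtain ⟨h2, h3, h4, -⟩ := hz k (fun h => h1 (by rw [h, zero_comp]))
        (fun h => h1 (by rw [h, comp_zero]))
      exact ⟨h2, h3, h4⟩
    have hinj : Set.InjOn (fun k => (p' k).1) (Z : Set I') := fun k hk l hl e =>
      S.inj _ _ (Subtype.ext e) ((hZ k hk).2.2.trans (hZ l hl).2.2.symm)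
    rw [ent_comp, finsum_eq_sum_of_support_subset (s := Z) _ (by simp [Z])]
    calc ∑ k ∈ Z, ent d' k s ≫ ent S.proj (q s) k
        = ∑ k ∈ Z, (ψ s * G (p' k).1) • 𝟙 (M (q s)) := Finset.sum_congr rfl fun k hk =>
          hterm k (hZ k hk).2.2 (hZ k hk).1 (hZ k hk).2.1
      _ = ∑ t ∈ Z.image fun k => (p' k).1, (ψ s * G t) • 𝟙 (M (q s)) :=
          (Finset.sum_image (f := fun t => (ψ s * G t) • 𝟙 (M (q s))) hinj).symm
      _ = ∑ t ∈ (p' s).1.powerset, (ψ s * G t) • 𝟙 (M (q s)) := by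
          refine Finset.sum_subset (fun t ht => ?_) fun t ht hn => ?_
          · obtain ⟨k, hk, rfl⟩ := Finset.mem_image.1 ht
            obtain ⟨a, ha⟩ := (hZ k hk).1
            exact Finset.mem_powerset.2 ha.subset
          · by_contra hne
            have hG : G t ≠ 0 := fun h => hne (by rw [h, mul_zero, zero_smul])
            have hd : Comb.depth r.toFun t = 0 := by
              by_contra h
              exact hG (if_neg h)
            have hG' : G t = Comb.incidence (β := X.V) r.toFun
              (fun a b : X.Simplex => a < b) o.lt t (p' s).1 := if_pos hd
            obtain ⟨a, ha⟩ := Comb.exists_del _ _ (hG' ▸ hG)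
            obtain ⟨b, hb, -⟩ := Comb.mem_img.1 ha.im
            let t' : X.sd.Simplex :=
              ⟨t, mem_faces_of_subset (X := X.sd) (p' s) ha.subset ⟨b, hb⟩⟩
            obtain ⟨j, hj1, hj2⟩ := S.surj t' (q s)
              ((S.compat s).trans (Subtype.ext ha.img_eq.symm))
            have hj : (p' j).1 = t := congrArg Subtype.val hj1
            refine hn (Finset.mem_image.2 ⟨j, (Set.Finite.mem_toFinset _).2 ?_, hj⟩)
            change ent d' j s ≫ ent S.proj (q s) j ≠ 0
            rw [hterm j hj2 ⟨a, by rw [hj]; exact ha⟩ (by rw [hj1]; exact hd), hj]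
            exact hne
      _ = 0 := by
          rw [← Finset.sum_smul, ← Finset.mul_sum]
          have := sum_incidence_depth_zero r o (p' s)
          simp only [G]
          rw [this, mul_zero, zero_smul]

end IsSubdivision

end Subdivision

/-! ### The rank of flags and the invertibility of the perturbation -/

open LFComplex Fam

namespace IsSubdivision

variable {X : LFComplex.{u}} {B : Type w} [Category.{v} B] [Preadditive B] {I I' : Type u}
  {K : Type*} [LinearOrder K] {key : X.V → K} {r : X.Approx} {o : X.VertexOrder} {M : I → B}
  {p : I → X.Simplex} {deg : I → ℤ} {q : I' → I} {p' : I' → X.sd.Simplex} {deg' : I' → ℤ} {ε : ℤ}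
  {ψ : I' → ℤ} {d : Fam.mk I M ⟶ Fam.mk I M}
  {d' : Fam.mk I' (fun i => M (q i)) ⟶ Fam.mk I' fun i => M (q i)}

/-- Flags are ranked by the size of their images and then, in the opposite direction, by the size
of their prefixes. -/
def rank (key : X.V → K) (r : X.Approx) (m : ℕ) (t : X.sd.Simplex) : ℕ :=
  (r.image t).1.card * (m + 1) + (m - (prefixOf key t).card)

/-- The rank is lexicographic: its second summand is at most `m`, less than the weight `m + 1` of
the first. -/
theorem rank_lt_of_ssubset {m : ℕ} {t t' : X.sd.Simplex} (h : (r.image t').1 ⊂ (r.image t).1) :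
    rank key r m t' < rank key r m t := by
  have h1 := Finset.card_lt_card h
  have h2 : ((r.image t').1.card + 1) * (m + 1) ≤ (r.image t).1.card * (m + 1) :=
    Nat.mul_le_mul_right _ h1
  rw [add_mul, one_mul] at h2
  unfold rank
  omega

/-- A prefix lies in the image and so has at most `m` elements; hence the truncated subtraction in
the rank loses nothing. -/
theorem rank_lt_of_card_lt (hr : IsMax key r) {m : ℕ} (hm : ∀ s : X.Simplex, s.1.card ≤ m)
    {t t' : X.sd.Simplex} (h : (r.image t').1 = (r.image t).1)
    (h' : (prefixOf key t).card < (prefixOf key t').card) :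
    rank key r m t' < rank key r m t := by
  have h1 := Finset.card_le_card (prefixOf_subset_image hr t')
  have h2 := hm (r.image t')
  unfold rank
  rw [h]
  omega

theorem rank_lt {m : ℕ} (hm : ∀ s : X.Simplex, s.1.card ≤ m) (t : X.sd.Simplex) :
    rank key r m t < m * (m + 1) + m + 1 := by
  have h1 := Nat.mul_le_mul_right (m + 1) (hm (r.image t))
  unfold rank
  omega

theorem image_eq_of_del {t s : X.sd.Simplex} {a : X.Simplex} (h : Comb.Del r.toFun t.1 s.1 a) :
    (r.image t).1 = (r.image s).1 := h.img_eq

theorem image_eq_of_match (hr : IsMax key r) {t s : X.sd.Simplex} (h : Match key r t s) :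
    (r.image t).1 = (r.image s).1 := by
  obtain ⟨π, -, ha⟩ := h.del hr
  exact image_eq_of_del ha

/-- After the matching has lengthened the prefix, a parallel entry either keeps the flag or shrinks
the image. A deletion either undoes the matching, which gives the diagonal, or leaves a longer
prefix by `Match.lt_of_del`. -/
theorem of_ent_matching_d' (S : IsSubdivision r o p deg q p' deg' ε ψ d d') (hr : IsMax key r)
    {m : ℕ} (hm : ∀ s : X.Simplex, s.1.card ≤ m) {j i : I'}
    (h : ent (S.matching hr ≫ d') j i ≠ 0) :
    rank key r m (p' j) < rank key r m (p' i) ∨ (j = i ∧ ∃ k, Match key r (p' i) k) := by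
  obtain ⟨k, h1, h2⟩ := exists_of_ent_comp h
  obtain ⟨h3, h4⟩ := S.of_ent_matching hr h1
  have e := image_eq_of_match hr h3
  rcases S.of_ent h2 with ⟨h5, -⟩ | ⟨⟨a, ha⟩, h6⟩
  · left
    by_cases he : (r.image (p' j)).1 = (r.image (p' k)).1
    · have : p' j = p' k := Subtype.ext (Comb.IsParallel.ext h5 ⟨subset_rfl, rfl⟩ he)
      refine rank_lt_of_card_lt hr hm (he.trans e.symm) ?_
      rw [this, h3.card_prefixOf hr]
      exact Nat.lt_succ_self _
    · exact rank_lt_of_ssubset (e ▸ Finset.ssubset_iff_subset_ne.2 ⟨image_mono r h5.1, he⟩)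
  · by_cases hji : p' j = p' i
    · exact Or.inr ⟨S.inj _ _ hji (h6.symm.trans h4.symm), _, h3⟩
    · exact Or.inl (rank_lt_of_card_lt hr hm ((image_eq_of_del ha).trans e.symm)
        (h3.lt_of_del hr ha hji))

theorem of_ent_d'_matching (S : IsSubdivision r o p deg q p' deg' ε ψ d d') (hr : IsMax key r)
    {m : ℕ} (hm : ∀ s : X.Simplex, s.1.card ≤ m) {j i : I'}
    (h : ent (d' ≫ S.matching hr) j i ≠ 0) :
    rank key r m (p' j) < rank key r m (p' i) ∨ (j = i ∧ Doubled key r (p' i)) := by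
  obtain ⟨k, h1, h2⟩ := exists_of_ent_comp h
  obtain ⟨h3, h4⟩ := S.of_ent_matching hr h2
  have e := image_eq_of_match hr h3
  rcases S.of_ent h1 with ⟨h5, -⟩ | ⟨⟨a, ha⟩, h6⟩
  · left
    by_cases he : (r.image (p' k)).1 = (r.image (p' i)).1
    · have : p' k = p' i := Subtype.ext (Comb.IsParallel.ext h5 ⟨subset_rfl, rfl⟩ he)
      refine rank_lt_of_card_lt hr hm (e.symm.trans he) ?_
      rw [← this, h3.card_prefixOf hr]
      exact Nat.lt_succ_self _
    · exact rank_lt_of_ssubset (e ▸ Finset.ssubset_iff_subset_ne.2 ⟨image_mono r h5.1, he⟩)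
  · by_cases hji : p' j = p' i
    · exact Or.inr ⟨S.inj _ _ hji (h4.symm.trans h6.symm), hji ▸ h3.doubled⟩
    · exact Or.inl (rank_lt_of_card_lt hr hm (e.symm.trans (image_eq_of_del ha))
        (h3.lt_of_del' hr ha hji))

theorem of_ent_proj_incl (S : IsSubdivision r o p deg q p' deg' ε ψ d d') (hr : IsMax key r)
    {m : ℕ} (hm : ∀ s : X.Simplex, s.1.card ≤ m) {j i : I'}
    (h : ent (S.proj ≫ S.incl key) j i ≠ 0) :
    rank key r m (p' j) < rank key r m (p' i) ∨
      (j = i ∧ p' i = full key (r.image (p' i))) := by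
  obtain ⟨k, h1, h2⟩ := exists_of_ent_comp h
  obtain ⟨h3, h4⟩ := S.of_ent_proj h1
  obtain ⟨h5, h6⟩ := S.of_ent_incl h2
  rw [← h4, S.compat] at h5
  by_cases hf : p' i = full key (r.image (p' i))
  · exact Or.inr ⟨S.inj _ _ (h5.trans hf.symm) (h6.symm.trans h4.symm), hf⟩
  · left
    refine rank_lt_of_card_lt hr hm ?_ (h5 ▸ card_prefixOf_lt hr h3 hf)
    rw [h5, image_full hr]

/-- The same sign occurs in the matching and in `d'`, and its square is one. -/
theorem ent_matching_d'_self (S : IsSubdivision r o p deg q p' deg' ε ψ d d') (hr : IsMax key r)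
    {i : I'} {k : X.sd.Simplex} (h : Match key r (p' i) k) :
    ent (S.matching hr ≫ d') i i = 𝟙 _ := by
  obtain ⟨π, -, ha⟩ := h.del hr
  obtain ⟨j, rfl, hj⟩ := S.surj k (q i) ((S.compat i).trans (Subtype.ext ha.img_eq))
  rw [ent_comp_single _ _ j fun j' h1 _ => S.inj _ _
    ((S.of_ent_matching hr h1).1.unique_right hr h |>.symm ▸ rfl)
    ((S.of_ent_matching hr h1).2.symm.trans hj.symm), S.ent_matching hr h, S.ent_of_del ha,
    Preadditive.zsmul_comp, Preadditive.comp_zsmul, smul_smul,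
    idEntry_comp_app M (fun x => idEntry M (q i) x) hj.symm, idEntry_self, mul_mul_mul_comm,
    S.sign, incidence_sq ha, mul_one, one_smul]

theorem ent_d'_matching_self (S : IsSubdivision r o p deg q p' deg' ε ψ d d') (hr : IsMax key r)
    {i : I'} (h : Doubled key r (p' i)) : ent (d' ≫ S.matching hr) i i = 𝟙 _ := by
  obtain ⟨y, hy⟩ := h.exists_match
  obtain ⟨π, -, ha⟩ := hy.del hr
  obtain ⟨j, rfl, hj⟩ := S.surj y (q i) ((S.compat i).trans (Subtype.ext ha.img_eq.symm))
  rw [ent_comp_single _ _ j fun j' _ h1 => S.inj _ _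
    ((S.of_ent_matching hr h1).1.unique_left hy)
    ((S.of_ent_matching hr h1).2.trans hj.symm), S.ent_matching hr hy, S.ent_of_del ha,
    Preadditive.zsmul_comp, Preadditive.comp_zsmul, smul_smul,
    idEntry_comp_app M (fun x => idEntry M (q i) x) hj.symm, idEntry_self, mul_mul_mul_comm,
    S.sign, incidence_sq ha, mul_one, one_smul]

theorem ent_proj_incl_self (S : IsSubdivision r o p deg q p' deg' ε ψ d d') (hr : IsMax key r)
    {i : I'} (h : p' i = full key (r.image (p' i))) : ent (S.proj ≫ S.incl key) i i = 𝟙 _ := by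
  have h0 : r.depth (p' i) = 0 := by
    rw [h]
    exact depth_full hr _
  rw [ent_comp_single _ _ (q i) fun j h1 _ => (S.of_ent_proj h1).2.symm, S.ent_proj h0,
    S.ent_incl (h.trans (by rw [S.compat])), idEntry_self]
  exact Category.comp_id _

/-- Every flag is of exactly one of three kinds: full, doubled, or the smaller member of a matched
pair. On each kind exactly one of the three summands has diagonal entry the identity and the other
two have zero; off the diagonal all of them lower the rank. -/
theorem supp_one_sub (S : IsSubdivision r o p deg q p' deg' ε ψ d d') (hr : IsMax key r)
    {m : ℕ} (hm : ∀ s : X.Simplex, s.1.card ≤ m) :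
    Supp (𝟙 _ - (S.matching hr ≫ d' + d' ≫ S.matching hr + S.proj ≫ S.incl key))
      fun j i => rank key r m (p' j) < rank key r m (p' i) := by
  intro j i h
  by_contra hR
  refine h ?_
  rw [ent_sub, ent_add, ent_add, ent_id, sub_eq_zero]
  have z1 : ¬ (j = i ∧ ∃ k, Match key r (p' i) k) → ent (S.matching hr ≫ d') j i = 0 := fun hn => by
    by_contra h1
    exact (S.of_ent_matching_d' hr hm h1).elim hR hn
  have z2 : ¬ (j = i ∧ Doubled key r (p' i)) → ent (d' ≫ S.matching hr) j i = 0 := fun hn => by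
    by_contra h1
    exact (S.of_ent_d'_matching hr hm h1).elim hR hn
  have z3 : ¬ (j = i ∧ p' i = full key (r.image (p' i))) →
      ent (S.proj ≫ S.incl key) j i = 0 := fun hn => by
    by_contra h1
    exact (S.of_ent_proj_incl hr hm h1).elim hR hn
  by_cases hji : j = i
  · subst hji
    rw [idEntry_self]
    rcases full_or_doubled_or_match hr (p' j) with h1 | h1 | ⟨k, h1⟩
    · rw [z1 fun h2 => by
          obtain ⟨-, k, hk⟩ := h2
          rw [h1] at hk
          exact not_match_full hr _ _ hk,
        z2 fun h2 => not_doubled_full (key := key) (r := r) _ (h1 ▸ h2.2),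
        S.ent_proj_incl_self hr h1]
      simp
    · rw [z1 fun ⟨_, k, hk⟩ => not_doubled_of_match hr hk h1, z3 fun h2 =>
        not_doubled_full (key := key) (r := r) _ (h2.2 ▸ h1), S.ent_d'_matching_self hr h1]
      simp
    · rw [z2 fun h2 => not_doubled_of_match hr h1 h2.2, z3 fun h2 => by
          rw [h2.2] at h1
          exact not_match_full hr _ _ h1, S.ent_matching_d'_self hr h1]
      simp
  · rw [idEntry_ne _ (Ne.symm hji), z1 fun h1 => hji h1.1, z2 fun h1 => hji h1.1,
      z3 fun h1 => hji h1.1]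
    simp

theorem supp_proj (S : IsSubdivision r o p deg q p' deg' ε ψ d d') :
    Supp S.proj fun i i' => p i = r.image (p' i') ∧ deg i = deg' i' := fun i i' h => by
  obtain ⟨h1, rfl⟩ := S.of_ent_proj h
  refine ⟨S.compat i', ?_⟩
  rw [S.deg_eq, h1, mul_zero, add_zero]

theorem supp_incl (S : IsSubdivision r o p deg q p' deg' ε ψ d d') (hr : IsMax key r) :
    Supp (S.incl key) fun i' i => top (p' i') = p i ∧ deg' i' = deg i := fun i' i h => by
  obtain ⟨h1, rfl⟩ := S.of_ent_incl h
  refine ⟨h1 ▸ top_full _, ?_⟩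
  have h2 := S.deg_eq i'
  rw [h1, depth_full hr, mul_zero, add_zero] at h2
  exact h2.symm

theorem supp_matching (S : IsSubdivision r o p deg q p' deg' ε ψ d d') (hr : IsMax key r) :
    Supp (S.matching hr) fun j i => top (p' j) ≤ top (p' i) ∧ deg' j = deg' i - ε :=
  fun j i h => by
    obtain ⟨h1, h2⟩ := S.of_ent_matching hr h
    obtain ⟨π, -, ha⟩ := h1.del hr
    have h3 : r.depth (p' j) = r.depth (p' i) + 1 := ha.depth_eq
    have e1 := S.deg_eq j
    have e2 := S.deg_eq i
    rw [h2] at e2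
    rw [h3, mul_add, mul_one] at e1
    exact ⟨h1.top_eq.symm.le, by omega⟩

/-- The subdivision of a differential object retracts onto it, with control over the supports. -/
theorem exists_retract (S : IsSubdivision r o p deg q p' deg' ε ψ d d') (hr : IsMax key r)
    (hX : X.FiniteDimensional) :
    ∃ R : Retract d d', Supp R.up (fun i' i => top (p' i') ≤ p i ∧ deg' i' = deg i) ∧
      Supp R.down (fun i i' => p i = r.image (p' i') ∧ deg i = deg' i') ∧
      Supp R.htpy fun j i => top (p' j) ≤ top (p' i) ∧ deg' j = deg' i - ε := by
  obtain ⟨m, hn⟩ : ∃ m, ∀ s : X.Simplex, s.1.card ≤ m := hX.imp' _ fun _ h => h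
  have hsum : Supp (S.matching hr ≫ d' + d' ≫ S.matching hr + S.proj ≫ S.incl key)
      fun j i => top (p' j) ≤ top (p' i) ∧ deg' j = deg' i := by
    refine (((S.supp_matching hr).comp S.supp_d' ?_).add
      (S.supp_d'.comp (S.supp_matching hr) ?_)).add (S.supp_proj.comp (S.supp_incl hr) ?_)
    · exact fun _ _ _ h h' => ⟨h'.1.trans h.1, by omega⟩
    · exact fun _ _ _ h h' => ⟨h'.1.trans h.1, by omega⟩
    · exact fun _ _ _ h h' => ⟨h'.1.le.trans (h.1.le.trans (image_le_top _ _)), by omega⟩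
  obtain ⟨y, hy, hy', hsy⟩ := exists_inverse_of_rank
    (S.matching hr ≫ d' + d' ≫ S.matching hr + S.proj ≫ S.incl key)
    (fun i : I' => rank key r m (p' i)) _ (fun i : I' => rank_lt hn (p' i))
    (S.supp_one_sub hr hn)
    (ρ := fun j i : I' => top (p' j) ≤ top (p' i) ∧ deg' j = deg' i)
    (fun i : I' => ⟨le_refl _, rfl⟩)
    (fun (_ _ _ : I') h h' => ⟨h'.1.trans h.1, h'.2.trans h.2⟩) hsum
  let R := Retract.ofPerturbation S.sq S.sq' (S.incl key) S.proj (S.matching hr) y S.d'_proj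
    (S.incl_proj hr) (S.matching_proj hr) hy hy'
  have e1 : R.up = S.incl key - (S.incl key ≫ d' - d ≫ S.incl key) ≫ y ≫ S.matching hr := rfl
  have e2 : R.down = S.proj := rfl
  have e3 : R.htpy = y ≫ S.matching hr := rfl
  refine ⟨R, ?_, e2 ▸ S.supp_proj, ?_⟩
  · rw [e1]
    refine Supp.sub ((S.supp_incl hr).mono fun _ _ h => ⟨h.1.le, h.2⟩) ?_
    -- The correction of the inclusion is the defect, of degree `ε`, followed by a map of degree
    -- `-ε`. Both stay in carriers.
    have he : Supp (S.incl key ≫ d' - d ≫ S.incl key)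
        fun i' i => top (p' i') ≤ p i ∧ deg' i' = deg i + ε := by
      refine ((S.supp_incl hr).comp S.supp_d' ?_).sub (S.supp.comp (S.supp_incl hr) ?_)
      · exact fun _ _ _ h h' => ⟨h'.1.trans h.1.le, by omega⟩
      · exact fun _ _ _ h h' => ⟨h'.1.le.trans h.1, by omega⟩
    have hsm : Supp (y ≫ S.matching hr)
        fun j i => top (p' j) ≤ top (p' i) ∧ deg' j = deg' i - ε :=
      hsy.comp (S.supp_matching hr) fun _ _ _ h h' => ⟨h'.1.trans h.1, by omega⟩
    exact he.comp hsm fun _ _ _ h h' => ⟨h'.1.trans h.1, by omega⟩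
  · rw [e3]
    exact hsy.comp (S.supp_matching hr) fun _ _ _ h h' => ⟨h'.1.trans h.1, by omega⟩

end IsSubdivision

open LFComplex

/-! ### The total family of a complex of graded objects -/

section Total

variable {ι : Type u} {R : SuppRel ι} {A : Type w} [Category.{v} A] [Preadditive A]

/-- The objects of a complex of graded objects, as one family over all indices and degrees. -/
abbrev totObj (C : ChainComplex (Graded R A) ℤ) : ι × ℤ → A := fun i => (C.X i.2).obj i.1

/-- The total family of a complex of graded objects. -/
abbrev totFam (C : ChainComplex (Graded R A) ℤ) : Fam.{u} A := ⟨ι × ℤ, totObj C⟩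

/-- The matrix of a family of morphisms which is homogeneous of degree `e`. -/
def tot {C D : ChainComplex (Graded R A) ℤ} (e : ℤ) (φ : ∀ n m, C.X n ⟶ D.X m)
    (hφ : ∀ n m, m ≠ n + e → φ n m = 0) : totFam C ⟶ totFam D :=
  Fam.mk' (fun j i => Graded.Hom.f (φ i.2 j.2) j.1 i.1) fun i =>
    ((Graded.Hom.fin (φ i.2 (i.2 + e)) i.1).image fun t => (t, i.2 + e)).subset fun j hj => by
      have h : j.2 = i.2 + e := by
        by_contra h
        exact hj (by rw [hφ _ _ h]; rfl)
      refine ⟨j.1, ?_, Prod.ext rfl h.symm⟩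
      rw [← h]
      exact hj

variable {C D E : ChainComplex (Graded R A) ℤ}

theorem supp_tot {e : ℤ} {φ : ∀ n m, C.X n ⟶ D.X m} {hφ : ∀ n m, m ≠ n + e → φ n m = 0} :
    Fam.Supp (tot e φ hφ) fun j i => R.rel j.1 i.1 ∧ j.2 = i.2 + e := fun j i h => by
  refine ⟨?_, ?_⟩
  · by_contra h1
    exact h (Graded.Hom.supp (φ i.2 j.2) _ _ h1)
  · by_contra h1
    refine h ?_
    change Graded.Hom.f (φ i.2 j.2) j.1 i.1 = 0
    rw [hφ _ _ h1]
    rfl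

theorem ent_tot {e : ℤ} {φ : ∀ n m, C.X n ⟶ D.X m} {hφ : ∀ n m, m ≠ n + e → φ n m = 0}
    (t s : ι) (m n : ℤ) : Fam.ent (tot e φ hφ) (t, m) (s, n) = Graded.Hom.f (φ n m) t s := rfl

theorem ent_tot_comp {e : ℤ} {φ : ∀ n m, C.X n ⟶ D.X m} {hφ : ∀ n m, m ≠ n + e → φ n m = 0}
    {e' : ℤ} {χ : ∀ n m, D.X n ⟶ E.X m} {hχ : ∀ n m, m ≠ n + e' → χ n m = 0}
    (t s : ι) (m n k : ℤ) (hk : k = n + e) :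
    Fam.ent (tot e φ hφ ≫ tot e' χ hχ) (t, m) (s, n) = Graded.Hom.f (φ n k ≫ χ k m) t s := by
  classical
  let T := (Graded.Hom.fin (φ n k) s).toFinset
  rw [Graded.comp_f_eq_sum (φ n k) (χ k m) t s T fun x hx => (Set.Finite.mem_toFinset _).2 hx]
  -- By homogeneity only the intermediate degree `k` contributes, so the sum over pairs reduces to
  -- one over `T`.
  rw [Fam.ent_comp, finsum_eq_sum_of_support_subset
    (s := T.map ⟨fun x => (x, k), fun x y h => congrArg Prod.fst h⟩), Finset.sum_map]
  · rfl
  · rintro ⟨x, l⟩ hx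
    have h1 : Fam.ent (tot e φ hφ) (x, l) (s, n) ≠ 0 := fun h => hx (by
      change Fam.ent (tot e φ hφ) (x, l) (s, n) ≫ _ = 0
      rw [h, zero_comp])
    have h2 : l = k := (supp_tot _ _ h1).2.trans hk.symm
    subst h2
    exact Finset.mem_coe.2 (Finset.mem_map.2 ⟨x, (Set.Finite.mem_toFinset _).2 h1, rfl⟩)

/-- The total differential. -/
def totD (C : ChainComplex (Graded R A) ℤ) : totFam C ⟶ totFam C :=
  tot (-1) (fun n m => C.d n m) fun n m h => C.shape _ _ fun h' => h (by
    have : m + 1 = n := h'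
    omega)

theorem totD_sq (C : ChainComplex (Graded R A) ℤ) : totD C ≫ totD C = 0 := by
  ext ⟨t, m⟩ ⟨s, n⟩
  unfold totD
  rw [ent_tot_comp t s m n (n - 1) (by omega), C.d_comp_d]
  rfl

/-- The components of a chain map between all pairs of degrees. -/
def mapFamily (f : C ⟶ D) (n m : ℤ) : C.X n ⟶ D.X m :=
  if h : n = m then f.f n ≫ eqToHom (congrArg D.X h) else 0

@[simp]
theorem mapFamily_self (f : C ⟶ D) (n : ℤ) : mapFamily f n n = f.f n := by simp [mapFamily]

theorem mapFamily_ne (f : C ⟶ D) {n m : ℤ} (h : n ≠ m) : mapFamily f n m = 0 := dif_neg h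

/-- The matrix of a chain map. -/
def totMap (f : C ⟶ D) : totFam C ⟶ totFam D :=
  tot 0 (mapFamily f) fun n m h => mapFamily_ne f fun h' => h (by omega)

theorem totMap_comm (f : C ⟶ D) : totMap f ≫ totD D = totD C ≫ totMap f := by
  ext ⟨t, m⟩ ⟨s, n⟩
  unfold totMap totD
  rw [ent_tot_comp t s m n n (by omega), ent_tot_comp t s m n (n - 1) (by omega), mapFamily_self]
  by_cases h : m = n - 1
  · rw [h, mapFamily_self, f.comm]
  · rw [mapFamily_ne f (Ne.symm h), D.shape _ _ fun h' => h ?_, comp_zero, comp_zero]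
    have : m + 1 = n := h'
    omega

theorem totMap_comp (f : C ⟶ D) (g : D ⟶ E) : totMap (f ≫ g) = totMap f ≫ totMap g := by
  ext ⟨t, m⟩ ⟨s, n⟩
  unfold totMap
  rw [ent_tot_comp t s m n n (by omega), mapFamily_self, ent_tot]
  by_cases h : n = m
  · subst h
    rw [mapFamily_self, mapFamily_self, HomologicalComplex.comp_f]
  · rw [mapFamily_ne _ h, mapFamily_ne _ h, comp_zero]

theorem totMap_id (C : ChainComplex (Graded R A) ℤ) : totMap (𝟙 C) = 𝟙 (totFam C) := by
  classical
  ext ⟨t, m⟩ ⟨s, n⟩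
  rw [Fam.ent_id]
  unfold totMap
  rw [ent_tot]
  by_cases h : n = m
  · subst h
    rw [mapFamily_self, HomologicalComplex.id_f]
    change (if h : s = t then eqToHom (congrArg (C.X n).obj h) else 0) = _
    unfold Fam.idEntry
    by_cases hst : s = t
    · subst hst
      rw [dif_pos rfl, dif_pos rfl]
    · rw [dif_neg hst, dif_neg fun h => hst (congrArg Prod.fst h)]
  · rw [mapFamily_ne _ h, Fam.idEntry_ne _ fun h' => h (congrArg Prod.snd h')]
    rfl

/-- The matrix of a chain homotopy. -/
def totHtpy {f g : C ⟶ D} (h : Homotopy f g) : totFam C ⟶ totFam D :=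
  tot 1 h.hom fun n m hnm => h.zero _ _ fun h' => hnm (by
    have : n + 1 = m := h'
    omega)

theorem totHtpy_eq {f g : C ⟶ D} (h : Homotopy f g) :
    totHtpy h ≫ totD D + totD C ≫ totHtpy h = totMap f - totMap g := by
  ext ⟨t, m⟩ ⟨s, n⟩
  rw [Fam.ent_add, Fam.ent_sub]
  unfold totHtpy totD totMap
  rw [ent_tot_comp t s m n (n + 1) rfl, ent_tot_comp t s m n (n - 1) (by omega), ent_tot, ent_tot]
  by_cases hnm : n = m
  · subst hnm
    rw [mapFamily_self, mapFamily_self, h.comm n, dNext_eq h.hom (i' := n - 1) (by simp),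
      prevD_eq h.hom (j' := n + 1) (by simp), Graded.add_f, Graded.add_f]
    abel
  · rw [mapFamily_ne _ hnm, mapFamily_ne _ hnm, D.shape _ _ fun h' => hnm ?_, h.zero (n - 1) m
      fun h' => hnm ?_, comp_zero, comp_zero]
    · simp [Graded.zero_f]
    · have : n - 1 + 1 = m := h'
      omega
    · have : m + 1 = n + 1 := h'
      omega

/-! #### Chain maps and homotopies from matrices -/

/-- The morphisms of graded objects contained in a matrix with suitable support. -/
def untot (F : totFam C ⟶ totFam D) (h : Fam.Supp F fun j i => R.rel j.1 i.1) (n m : ℤ) :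
    C.X n ⟶ D.X m :=
  Graded.Hom.mk (fun t s => Fam.ent F (t, m) (s, n))
    (fun t s hts => by
      by_contra h1
      exact hts (h _ _ h1))
    fun s => ((Fam.ent_fin F (s, n)).preimage (f := fun t => (t, m))
      fun x _ y _ e => congrArg Prod.fst e)

theorem untot_zero {e : ℤ} (F : totFam C ⟶ totFam D) (h : Fam.Supp F fun j i => R.rel j.1 i.1)
    (h' : Fam.Supp F fun j i => j.2 = i.2 + e) (n m : ℤ) (hm : m ≠ n + e) :
    untot F h n m = 0 := by
  ext t s
  by_contra h1
  exact hm (h' _ _ h1)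

theorem tot_untot {e : ℤ} (F : totFam C ⟶ totFam D) (h : Fam.Supp F fun j i => R.rel j.1 i.1)
    (h' : Fam.Supp F fun j i => j.2 = i.2 + e) :
    tot e (untot F h) (untot_zero F h h') = F := rfl

/-- A homogeneous matrix of degree zero commuting with the differentials is a chain map. -/
def chainMap (F : totFam C ⟶ totFam D) (h : Fam.Supp F fun j i => R.rel j.1 i.1)
    (h' : Fam.Supp F fun j i => j.2 = i.2 + 0) (hF : F ≫ totD D = totD C ≫ F) : C ⟶ D where
  f n := untot F h n n
  comm' n m hnm := by
    have hnm' : m + 1 = n := hnm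
    ext t s
    have h1 := congrArg (fun G => Fam.ent G (t, m) (s, n)) hF
    simp only at h1
    rw [← tot_untot F h h'] at h1
    unfold totD at h1
    rw [ent_tot_comp t s m n n (by omega), ent_tot_comp t s m n m (by omega)] at h1
    exact h1

theorem totMap_chainMap (F : totFam C ⟶ totFam D) (h : Fam.Supp F fun j i => R.rel j.1 i.1)
    (h' : Fam.Supp F fun j i => j.2 = i.2 + 0) (hF : F ≫ totD D = totD C ≫ F) :
    totMap (chainMap F h h' hF) = F := by
  ext ⟨t, m⟩ ⟨s, n⟩
  unfold totMap
  rw [ent_tot]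
  by_cases hnm : n = m
  · subst hnm
    rw [mapFamily_self]
    rfl
  · rw [mapFamily_ne _ hnm]
    by_contra h1
    exact hnm ((h' (t, m) (s, n) fun h2 => h1 h2.symm).trans (add_zero n)).symm

/-- A homogeneous matrix of degree one with the right boundary is a chain homotopy. -/
def chainHtpy (f g : C ⟶ D) (H : totFam C ⟶ totFam D)
    (h : Fam.Supp H fun j i => R.rel j.1 i.1) (h' : Fam.Supp H fun j i => j.2 = i.2 + 1)
    (hH : H ≫ totD D + totD C ≫ H = totMap f - totMap g) : Homotopy f g where
  hom := untot H h
  zero n m hnm := untot_zero H h h' n m fun e => hnm e.symm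
  comm n := by
    rw [dNext_eq (untot H h) (i' := n - 1) (by simp), prevD_eq (untot H h) (j' := n + 1) (by simp)]
    ext t s
    have h1 := congrArg (fun G => Fam.ent G (t, n) (s, n)) hH
    simp only at h1
    rw [← tot_untot H h h', Fam.ent_add, Fam.ent_sub] at h1
    unfold totD totMap at h1
    rw [ent_tot_comp t s n n (n + 1) rfl, ent_tot_comp t s n n (n - 1) (by omega), ent_tot,
      ent_tot, mapFamily_self, mapFamily_self, eq_sub_iff_add_eq] at h1
    rw [Graded.add_f, Graded.add_f, ← h1]
    abel

end Total

/-! ### Transposition -/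

namespace Fam

section Transpose

variable {A : Type w} [Category.{v} A] [Preadditive A]

/-- The family of opposite objects. -/
abbrev opp (M : Fam.{u} A) : Fam.{u} Aᵒᵖ := ⟨M.ι, fun i => Opposite.op (M.obj i)⟩

/-- A matrix with finitely many nonzero entries in each row. -/
def RowFinite {M N : Fam.{u} A} (f : M ⟶ N) : Prop := ∀ t, {s | ent f t s ≠ 0}.Finite

/-- The transpose of a row-finite matrix. -/
def transpose {M N : Fam.{u} A} (f : M ⟶ N) (hf : RowFinite f) : opp N ⟶ opp M :=
  mk' (fun s t => (ent f t s).op) fun t => (hf t).subset fun s hs h => hs (by rw [h]; rfl)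

variable {M N P : Fam.{u} A}

theorem ent_transpose (f : M ⟶ N) (hf : RowFinite f) (t : N.ι) (s : M.ι) :
    ent (transpose f hf) s t = (ent f t s).op := rfl

theorem transpose_comp (f : M ⟶ N) (hf : RowFinite f) (g : N ⟶ P) (hg : RowFinite g)
    (hfg : RowFinite (f ≫ g)) : transpose g hg ≫ transpose f hf = transpose (f ≫ g) hfg := by
  ext s q
  let T := (ent_fin f s).toFinset
  rw [ent_transpose, ent_comp, ent_comp,
    finsum_eq_sum_of_support_subset (s := T), finsum_eq_sum_of_support_subset (s := T), op_sum]
  · rfl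
  · intro t ht
    exact Finset.mem_coe.2 ((Set.Finite.mem_toFinset _).2 fun h => ht (by
      change ent f t s ≫ _ = 0
      rw [h, zero_comp]))
  · intro t ht
    exact Finset.mem_coe.2 ((Set.Finite.mem_toFinset _).2 fun h => ht (by
      change _ ≫ ent (transpose f hf) s t = 0
      rw [ent_transpose f, h, op_zero, comp_zero]))

theorem RowFinite.comp {f : M ⟶ N} {g : N ⟶ P} (hf : RowFinite f) (hg : RowFinite g) :
    RowFinite (f ≫ g) := fun q => by
  refine ((hg q).biUnion fun t _ => hf t).subset fun s hs => ?_
  obtain ⟨t, h1, h2⟩ := exists_of_ent_comp hs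
  simp only [Set.mem_iUnion]
  exact ⟨t, h2, h1⟩

theorem RowFinite.add {f g : M ⟶ N} (hf : RowFinite f) (hg : RowFinite g) :
    RowFinite (f + g) := fun q => by
  refine ((hf q).union (hg q)).subset fun s hs => ?_
  by_contra h
  simp only [Set.mem_union, Set.mem_ofPred_eq, not_or, not_not] at h
  exact hs (by rw [ent_add, h.1, h.2, add_zero])

theorem RowFinite.sub {f g : M ⟶ N} (hf : RowFinite f) (hg : RowFinite g) :
    RowFinite (f - g) := fun q => by
  refine ((hf q).union (hg q)).subset fun s hs => ?_
  by_contra h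
  simp only [Set.mem_union, Set.mem_ofPred_eq, not_or, not_not] at h
  exact hs (by rw [ent_sub, h.1, h.2, sub_zero])

theorem RowFinite.id : RowFinite (𝟙 M) := fun t =>
  (Set.finite_singleton t).subset fun s hs => by
    by_contra h
    exact hs (idEntry_ne _ h)

theorem transpose_id : transpose (𝟙 M) RowFinite.id = 𝟙 (opp M) := by
  ext s t
  rw [ent_transpose, ent_id, ent_id]
  by_cases h : t = s
  · subst h
    rw [idEntry_self, idEntry_self]
    rfl
  · rw [idEntry_ne _ h, idEntry_ne _ (Ne.symm h)]
    rfl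

theorem transpose_injective {f g : M ⟶ N} {hf : RowFinite f} {hg : RowFinite g}
    (h : transpose f hf = transpose g hg) : f = g := by
  ext t s
  have := congrArg (fun F : opp N ⟶ opp M => ent F s t) h
  exact Quiver.Hom.op_inj this

theorem exists_transpose (F : opp N ⟶ opp M) (hF : RowFinite F) :
    ∃ (f : M ⟶ N) (hf : RowFinite f), transpose f hf = F := by
  refine ⟨mk' (fun t s => (ent F s t).unop) fun s => (hF s).subset fun t ht h => ht (by
    rw [h]; rfl), fun t => (ent_fin F t).subset fun s hs h => hs ?_, ?_⟩
  · rw [ent_mk', h]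
    rfl
  · ext s t
    rfl

theorem supp_of_transpose {f : M ⟶ N} {hf : RowFinite f} {ρ : M.ι → N.ι → Prop}
    (h : Supp (transpose f hf) ρ) : Supp f fun t s => ρ s t := fun t s hts =>
  h s t fun e => hts (Quiver.Hom.op_inj (by
    rw [ent_transpose] at e
    rw [e]
    rfl))

end Transpose

end Fam

/-- Retractions of transposed differential objects. -/
theorem exists_retract_of_transpose {A : Type w} [Category.{v} A] [Preadditive A]
    {M M' : Fam.{u} A} {d : M ⟶ M} {d' : M' ⟶ M'} (hd : Fam.RowFinite d) (hd' : Fam.RowFinite d')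
    (R : Retract (Fam.transpose d hd) (Fam.transpose d' hd')) (h1 : Fam.RowFinite R.up)
    (h2 : Fam.RowFinite R.down) (h3 : Fam.RowFinite R.htpy) {ρ₁ : M'.ι → M.ι → Prop}
    {ρ₂ : M.ι → M'.ι → Prop} {ρ₃ : M'.ι → M'.ι → Prop} (s1 : Fam.Supp R.up ρ₁)
    (s2 : Fam.Supp R.down ρ₂) (s3 : Fam.Supp R.htpy ρ₃) :
    ∃ S : Retract d d', Fam.Supp S.up (fun t s => ρ₂ s t) ∧ Fam.Supp S.down (fun t s => ρ₁ s t) ∧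
      Fam.Supp S.htpy fun t s => ρ₃ s t := by
  -- Transposition reverses arrows: the inclusion becomes the projection and conversely.
  obtain ⟨b, hb, eb⟩ := Fam.exists_transpose (M := M') (N := M) R.up h1
  obtain ⟨a, ha, ea⟩ := Fam.exists_transpose (M := M) (N := M') R.down h2
  obtain ⟨h, hh, eh⟩ := Fam.exists_transpose (M := M') (N := M') R.htpy h3
  have c1 := R.up_comm
  have c2 := R.down_comm
  have c3 := R.up_down
  have c4 := R.htpy_eq
  rw [← eb, Fam.transpose_comp _ _ _ _ (hb.comp hd), Fam.transpose_comp _ _ _ _ (hd'.comp hb)] at c1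
  rw [← ea, Fam.transpose_comp _ _ _ _ (hd.comp ha), Fam.transpose_comp _ _ _ _ (ha.comp hd')] at c2
  rw [← eb, ← ea, Fam.transpose_comp _ _ _ _ (ha.comp hb), ← Fam.transpose_id] at c3
  rw [← eh, ← ea, ← eb, Fam.transpose_comp _ _ _ _ (hh.comp hd'),
    Fam.transpose_comp _ _ _ _ (hd'.comp hh), Fam.transpose_comp _ _ _ _ (hb.comp ha),
    ← Fam.transpose_id] at c4
  have c4' : Fam.transpose (d' ≫ h + h ≫ d') ((hd'.comp hh).add (hh.comp hd')) =
      Fam.transpose (𝟙 M' - b ≫ a) (Fam.RowFinite.id.sub (hb.comp ha)) := by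
    refine Eq.trans ?_ (c4.trans ?_)
    · rfl
    · rfl
  exact ⟨⟨a, b, h, Fam.transpose_injective c2.symm, Fam.transpose_injective c1.symm,
    Fam.transpose_injective c3, (add_comm _ _).trans (Fam.transpose_injective c4')⟩,
    Fam.supp_of_transpose (hf := ha) (ea ▸ s2), Fam.supp_of_transpose (hf := hb) (eb ▸ s1),
    Fam.supp_of_transpose (hf := hh) (eh ▸ s3)⟩

open LFComplex Fam

/-! ### Subdivisions of chain complexes retract onto them -/

namespace LFComplex

theorem finite_flags {X : LFComplex.{u}} {F : Set X.Simplex} (hF : F.Finite) :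
    {t : X.sd.Simplex | ∀ ρ : X.Simplex, ρ ∈ t.1 → ρ ∈ F}.Finite := by
  refine ((hF.toFinset.powerset.finite_toSet).preimage
    (f := fun t : X.sd.Simplex => (t.1 : Finset X.Simplex)) Subtype.val_injective.injOn).subset ?_
  intro t ht
  exact Finset.mem_coe.2 (Finset.mem_powerset.2 fun ρ hρ => hF.mem_toFinset.2 (ht ρ hρ))

theorem finite_top_le {X : LFComplex.{u}} (σ : X.Simplex) : {t | top t ≤ σ}.Finite :=
  (finite_flags (finite_faces σ)).subset fun _ ht _ hρ => (le_top hρ).trans ht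

theorem finite_le_top {X : LFComplex.{u}} (σ : X.Simplex) : {t | σ ≤ top t}.Finite := by
  refine ((finite_cofaces σ).biUnion fun τ _ => finite_top_le τ).subset fun t ht => ?_
  simp only [Set.mem_iUnion]
  exact ⟨top t, ht, (le_refl (top t) : top t ≤ top t)⟩

/-- Every element of such a flag contains a vertex of `σ`, namely the one chosen by `r`, so local
finiteness applies. This makes the projection row-finite. -/
theorem finite_image_eq {X : LFComplex.{u}} (r : X.Approx) (σ : X.Simplex) :
    {t | σ = r.image t}.Finite := by
  refine (finite_flags (finite_meeting σ)).subset fun t ht ρ hρ => ?_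
  have ht' : σ = r.image t := ht
  exact ⟨r.toFun ρ, ht' ▸ mem_image.2 ⟨ρ, hρ, rfl⟩, r.mem ρ⟩

/-- The elements of a flag have different sizes, all between `1` and `m`. -/
theorem FiniteDimensional.sd {X : LFComplex.{u}} {m : ℕ} (h : ∀ s : X.Simplex, s.1.card ≤ m)
    (t : X.sd.Simplex) : t.1.card ≤ m := by
  have h1 : Set.InjOn (fun ρ : X.Simplex => ρ.1.card) (t.1 : Set X.Simplex) := by
    intro a ha b hb e
    rcases flag_total (Finset.mem_coe.1 ha) (Finset.mem_coe.1 hb) with h2 | h2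
    · exact Subtype.ext (Finset.eq_of_subset_of_card_le h2 (le_of_eq e.symm))
    · exact (Subtype.ext (Finset.eq_of_subset_of_card_le h2 (le_of_eq e))).symm
  have h2 := Finset.card_le_card_of_injOn (t := Finset.Icc 1 m)
    (fun ρ : X.Simplex => ρ.1.card) (fun ρ _ => Finset.mem_coe.2
      (Finset.mem_Icc.2 ⟨Finset.card_pos.2 (Simplex.nonempty ρ), h ρ⟩)) h1
  simpa using h2

theorem card_le_sdIter {X : LFComplex.{u}} {m : ℕ} (h : ∀ s : X.Simplex, s.1.card ≤ m) :
    ∀ j, ∀ s : (X.sdIter j).Simplex, s.1.card ≤ m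
  | 0 => h
  | j + 1 => FiniteDimensional.sd (card_le_sdIter h j)

/-- The approximation is given by the largest vertices for a linear order. -/
def Approx.IsOrdered {X : LFComplex.{u}} (r : X.Approx) : Prop :=
  ∃ (K : Type (u + 1)) (_ : LinearOrder K) (key : X.V → K), IsMax key r

end LFComplex

/-- One of two propositions, according to the variance. -/
def Variance.select (a : Variance) (p q : Prop) : Prop :=
  match a with
  | cov => p
  | contra => q

section Control

variable {A : Type w} [Category.{v} A] [Preadditive A]

/-- Bounds on the supports of the maps of a deformation retraction, with the arrows reversed for
`contra`. All maps are homogeneous. -/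
structure Controlled (a : Variance) {S T : Type u} {M : S × ℤ → A} {N : T × ℤ → A}
    {d : Fam.mk _ M ⟶ Fam.mk _ M} {d' : Fam.mk _ N ⟶ Fam.mk _ N} (R : Retract d d')
    (U : T → S → Prop) (D : S → T → Prop) (Θ : T → T → Prop) : Prop where
  up_deg : Supp R.up fun j i => j.2 = i.2
  down_deg : Supp R.down fun j i => j.2 = i.2
  htpy_deg : Supp R.htpy fun j i => j.2 = i.2 + 1
  up : Supp R.up fun j i => a.select (U j.1 i.1) (D i.1 j.1)
  down : Supp R.down fun j i => a.select (D j.1 i.1) (U i.1 j.1)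
  htpy : Supp R.htpy fun j i => a.select (Θ j.1 i.1) (Θ i.1 j.1)

theorem Controlled.refl (a : Variance) {S : Type u} {M : S × ℤ → A}
    (d : Fam.mk _ M ⟶ Fam.mk _ M) {U D Θ : S → S → Prop} (hU : ∀ s, U s s) (hD : ∀ s, D s s) :
    Controlled a (Retract.refl d) U D Θ where
  up_deg := Supp.id fun _ => rfl
  down_deg := Supp.id fun _ => rfl
  htpy_deg := Supp.zero
  up := Supp.id fun i => by cases a; exacts [hU _, hD _]
  down := Supp.id fun i => by cases a; exacts [hD _, hU _]
  htpy := Supp.zero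

/-- The homotopy of a composite has two terms, `R'.htpy` and `R'.down ≫ R.htpy ≫ R'.up`; the last
two hypotheses bound them. -/
theorem Controlled.trans {a : Variance} {S T V : Type u} {M : S × ℤ → A} {N : T × ℤ → A}
    {P : V × ℤ → A} {d : Fam.mk _ M ⟶ Fam.mk _ M} {d' : Fam.mk _ N ⟶ Fam.mk _ N}
    {d'' : Fam.mk _ P ⟶ Fam.mk _ P} {R : Retract d d'} {R' : Retract d' d''}
    {U : T → S → Prop} {D : S → T → Prop} {Θ : T → T → Prop}
    {U' : V → T → Prop} {D' : T → V → Prop} {Θ' : V → V → Prop}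
    {U'' : V → S → Prop} {D'' : S → V → Prop} {Θ'' : V → V → Prop}
    (h : Controlled a R U D Θ) (h' : Controlled a R' U' D' Θ')
    (hU : ∀ t x s, U x s → U' t x → U'' t s) (hD : ∀ t x s, D' x t → D s x → D'' s t)
    (hΘ : ∀ t s, Θ' t s → Θ'' t s) (hΘ' : ∀ t y x s, D' x s → Θ y x → U' t y → Θ'' t s) :
    Controlled a (R.trans R') U'' D'' Θ'' where
  up_deg := h.up_deg.comp h'.up_deg fun _ _ _ e e' => e'.trans e
  down_deg := h'.down_deg.comp h.down_deg fun _ _ _ e e' => e'.trans e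
  htpy_deg := by
    have h1 : Supp (R.htpy ≫ R'.up) fun j i => j.2 = i.2 + 1 :=
      h.htpy_deg.comp h'.up_deg fun _ _ _ e e' => e'.trans e
    exact h'.htpy_deg.add (h'.down_deg.comp h1 fun _ _ _ e e' => e'.trans (by rw [e]))
  up := by
    refine h.up.comp h'.up fun j k i e e' => ?_
    cases a
    · exact hU _ _ _ e e'
    · exact hD _ _ _ e' e
  down := by
    refine h'.down.comp h.down fun j k i e e' => ?_
    cases a
    · exact hD _ _ _ e e'
    · exact hU _ _ _ e' e
  htpy := by
    refine Supp.add ?_ ?_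
    · refine h'.htpy.mono fun j i e => ?_
      cases a
      · exact hΘ _ _ e
      · exact hΘ _ _ e
    · intro j i e
      obtain ⟨k, e1, e2⟩ := exists_of_ent_comp e
      obtain ⟨l, e2, e3⟩ := exists_of_ent_comp e2
      have f1 := h'.down _ _ e1
      have f2 := h.htpy _ _ e2
      have f3 := h'.up _ _ e3
      cases a
      · exact hΘ' _ _ _ _ f1 f2 f3
      · exact hΘ' _ _ _ _ f3 f2 f1

theorem idEntry_eq_transport {X : LFComplex.{u}} {a : Variance}
    (C : ChainComplex (ControlledCat a X A) ℤ) (k l : ℤ) (y z : X.Simplex) :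
    idEntry (totObj C) (z, l) (y, k) = transport C k y l z := by
  unfold idEntry transport
  by_cases h : k = l ∧ y = z
  · rw [dif_pos h, dif_pos (Prod.ext h.2 h.1)]
  · rw [dif_neg h, dif_neg fun e => h ⟨congrArg Prod.snd e, congrArg Prod.fst e⟩]

theorem rowFinite_of_supp {S T : Type u} {M : S × ℤ → A} {N : T × ℤ → A}
    {f : Fam.mk _ M ⟶ Fam.mk _ N} {ρ : T → S → Prop} {e : ℤ}
    (hf : Supp f fun j i => ρ j.1 i.1 ∧ j.2 = i.2 + e) (hρ : ∀ t, {s | ρ t s}.Finite) :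
    RowFinite f := fun j => by
  refine ((hρ j.1).image fun s => (s, j.2 - e)).subset fun i hi => ?_
  obtain ⟨h1, h2⟩ := hf _ _ hi
  exact ⟨i.1, h1, Prod.ext rfl (by change j.2 - e = i.2; omega)⟩

variable {X : LFComplex.{u}} {a : Variance}

theorem Variance.finite_rel' (a : Variance) (t : X.Simplex) : {s | (a.rel X).rel t s}.Finite := by
  cases a
  · exact finite_cofaces t
  · exact finite_faces t

theorem rowFinite_totD (C : ChainComplex (ControlledCat a X A) ℤ) : RowFinite (totD C) :=
  rowFinite_of_supp supp_tot a.finite_rel'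

theorem shift_bijOn (a : Variance) (r : X.Approx) (s : X.sd.Simplex) (y : X.Simplex) (k : ℤ)
    (h : y = r.image s) : ∃ i : X.sd.Simplex × ℤ, i.1 = s ∧ (r.image i.1, i.2 + a.shift r i.1) = (y, k) :=
  ⟨(s, k - a.shift r s), rfl, Prod.ext h.symm (sub_add_cancel _ _)⟩

theorem isSubdivision_cov (r : X.Approx) (o : X.VertexOrder)
    (C : ChainComplex (ControlledCat .cov X A) ℤ) :
    IsSubdivision (I := X.Simplex × ℤ) (I' := X.sd.Simplex × ℤ) r o (M := totObj C) Prod.fst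
      Prod.snd (fun i => (r.image i.1, i.2 + Variance.cov.shift r i.1)) Prod.fst Prod.snd (-1)
      (fun i => (i.2.negOnePow : ℤ)) (totD C) (totD (sdChain r o C)) where
  compat _ := rfl
  inj i j h h' := by
    obtain ⟨s, n⟩ := i
    obtain ⟨t, m⟩ := j
    obtain rfl : s = t := h
    exact Prod.ext rfl (add_right_cancel (congrArg Prod.snd h'))
  surj s i h := shift_bijOn _ r s i.1 i.2 h
  deg_eq i := by
    simp only [Variance.shift]
    ring
  sign i := by
    rw [← Units.val_mul]
    simp
  ent_eq j i := by
    rw [idEntry_eq_transport]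
    rfl
  supp := supp_tot
  sq := totD_sq C
  sq' := totD_sq (sdChain r o C)

/-- The columns of the transposed differential are indexed by the targets of the original one. Hence
the degree of the differential is `1` and the sign is taken in the column degree plus one. -/
theorem isSubdivision_contra (r : X.Approx) (o : X.VertexOrder)
    (C : ChainComplex (ControlledCat .contra X A) ℤ) :
    IsSubdivision (I := X.Simplex × ℤ) (I' := X.sd.Simplex × ℤ) r o
      (M := fun i => Opposite.op (totObj C i)) Prod.fst
      Prod.snd (fun i => (r.image i.1, i.2 + Variance.contra.shift r i.1)) Prod.fst Prod.snd 1
      (fun i => ((i.2 + 1).negOnePow : ℤ)) (transpose (totD C) (rowFinite_totD C))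
      (transpose (totD (sdChain r o C)) (rowFinite_totD _)) where
  compat _ := rfl
  inj i j h h' := by
    obtain ⟨s, n⟩ := i
    obtain ⟨t, m⟩ := j
    obtain rfl : s = t := h
    exact Prod.ext rfl (add_right_cancel (congrArg Prod.snd h'))
  surj s i h := shift_bijOn _ r s i.1 i.2 h
  deg_eq i := by
    simp only [Variance.shift]
    ring
  sign i := by
    rw [← Units.val_mul]
    simp
  ent_eq j i := by
    classical
    obtain ⟨s, n⟩ := j
    obtain ⟨t, m⟩ := i
    change (sdComponent r o C n m t s).op = _
    unfold sdComponent
    rw [op_add]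
    congr 1
    · change (if r.IsParallel s t then _ else _ : _ ⟶ _).op = if r.IsParallel s t then _ else _
      split_ifs
      · rfl
      · rfl
    · have e1 : (transport C (n + Variance.contra.shift r s) (r.image s)
          (m + Variance.contra.shift r t) (r.image t)).op =
          idEntry (fun i => Opposite.op (totObj C i))
            (r.image s, n + Variance.contra.shift r s)
            (r.image t, m + Variance.contra.shift r t) := by
        rw [← idEntry_eq_transport]
        unfold idEntry
        by_cases h : (r.image s, n + Variance.contra.shift r s) =
            (r.image t, m + Variance.contra.shift r t)
        · rw [dif_pos h, dif_pos h.symm, eqToHom_op]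
        · rw [dif_neg h, dif_neg (Ne.symm h), op_zero]
      rw [op_zsmul, e1]
      change ((n.negOnePow : ℤ) * r.incidence o s t) • _ =
        (((m + 1).negOnePow : ℤ) * r.incidence o s t) • _
      by_cases h0 : r.incidence o s t = 0
      · rw [h0, mul_zero, mul_zero]
      by_cases hq : (r.image t, m + Variance.contra.shift r t) =
          (r.image s, n + Variance.contra.shift r s)
      · have h1 := (Variance.of_incidence (v := .contra) (o := o) (t := t) (s := s) h0).2.2
        have h2 := congrArg Prod.snd hq
        simp only at h2
        have : n = m + 1 := by omega
        rw [this]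
      · rw [idEntry_ne _ hq, smul_zero, smul_zero]
  supp := fun j i h => by
    have h1 : ent (totD C) i j ≠ 0 := fun e => h (by rw [ent_transpose, e, op_zero])
    obtain ⟨h2, h3⟩ := supp_tot _ _ h1
    exact ⟨h2, by omega⟩
  sq := by
    rw [transpose_comp _ _ _ _ ((rowFinite_totD C).comp (rowFinite_totD C))]
    ext s t
    rw [ent_transpose, totD_sq]
    rfl
  sq' := by
    have h := totD_sq (sdChain r o C)
    refine (transpose_comp _ _ _ _ ((rowFinite_totD _).comp (rowFinite_totD _))).trans ?_
    ext s t
    rw [ent_transpose, h]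
    rfl

/-- The subdivision of a chain complex retracts onto it. -/
theorem exists_retract_sdChain {r : X.Approx} (hr : r.IsOrdered) (hX : X.FiniteDimensional)
    (o : X.VertexOrder) (C : ChainComplex (ControlledCat a X A) ℤ) :
    ∃ R : Retract (totD C) (totD (sdChain r o C)),
      Controlled a (S := X.Simplex) (T := X.sd.Simplex) R (fun t s => top t ≤ s)
        (fun s t => s = r.image t) fun t s => top t ≤ top s := by
  obtain ⟨K, _, key, hr⟩ := hr
  cases a
  · obtain ⟨R, h1, h2, h3⟩ := (isSubdivision_cov r o C).exists_retract hr hX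
    exact ⟨R, ⟨h1.mono fun _ _ h => h.2, h2.mono fun _ _ h => h.2,
      h3.mono fun _ _ h => h.2.trans (sub_neg_eq_add _ _), h1.mono fun _ _ h => h.1,
      h2.mono fun _ _ h => h.1, h3.mono fun _ _ h => h.1⟩⟩
  · obtain ⟨R, h1, h2, h3⟩ := (isSubdivision_contra r o C).exists_retract hr hX
    obtain ⟨S, g1, g2, g3⟩ := exists_retract_of_transpose (M := totFam C)
      (M' := totFam (sdChain r o C)) (rowFinite_totD C)
      (rowFinite_totD (sdChain r o C)) R
      (rowFinite_of_supp (e := 0) (ρ := fun t s => top t ≤ s)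
        (h1.mono fun _ _ h => ⟨h.1, h.2.trans (add_zero _).symm⟩) fun t => finite_cofaces (top t))
      (rowFinite_of_supp (e := 0) (ρ := fun s t => s = r.image t)
        (h2.mono fun _ _ h => ⟨h.1, h.2.trans (add_zero _).symm⟩) fun s => finite_image_eq r s)
      (rowFinite_of_supp (e := -1) (ρ := fun t s => top t ≤ top s)
        (h3.mono fun _ _ h => ⟨h.1, h.2.trans (sub_eq_add_neg _ _)⟩)
        fun t => finite_le_top (top t)) h1 h2 h3
    exact ⟨S, ⟨g1.mono fun _ _ h => h.2.symm, g2.mono fun _ _ h => h.2.symm,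
      g3.mono fun _ _ h => by have := h.2; omega, g1.mono fun _ _ h => h.1,
      g2.mono fun _ _ h => h.1, g3.mono fun _ _ h => h.1⟩⟩

end Control

/-! ### Iterated carriers and images -/

namespace LFComplex

variable {X : LFComplex.{u}}

/-- The carrier in `Sd^k X` of a simplex of `Sd^(k+n) X`. -/
def car (X : LFComplex.{u}) (k : ℕ) : ∀ n, (X.sdIter (k + n)).Simplex → (X.sdIter k).Simplex
  | 0 => fun t => t
  | n + 1 => fun t => car X k n (top (X := X.sdIter (k + n)) t)

/-- The image in `Sd^k X` of a simplex of `Sd^(k+n) X` under the composed approximation. -/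
def img (r : ∀ j, (X.sdIter j).Approx) (k : ℕ) :
    ∀ n, (X.sdIter (k + n)).Simplex → (X.sdIter k).Simplex
  | 0 => fun t => t
  | n + 1 => fun t => img r k n ((r (k + n)).image t)

theorem car_mono (k : ℕ) : ∀ n {t s : (X.sdIter (k + n)).Simplex}, t ≤ s → car X k n t ≤ car X k n s
  | 0 => fun h => h
  | n + 1 => fun h => car_mono k n (top_mono h)

theorem img_le_car (r : ∀ j, (X.sdIter j).Approx) (k : ℕ) :
    ∀ n (t : (X.sdIter (k + n)).Simplex), img r k n t ≤ car X k n t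
  | 0 => fun t => le_refl t
  | n + 1 => fun t => (img_le_car r k n _).trans (car_mono k n (image_le_top _ t))

end LFComplex

/-- The relation for the projection is an equality and not merely a bound by carriers: a projection
controlled only by carriers could not bring simplices near `σ` back into `σ`. -/
theorem exists_retract_iter {X : LFComplex.{u}} {A : Type w} [Category.{v} A] [Preadditive A]
    {a : Variance} {r : ∀ j, (X.sdIter j).Approx} (hr : ∀ j, (r j).IsOrdered)
    (hX : X.FiniteDimensional) (o : X.VertexOrder) (C : ChainComplex (ControlledCat a X A) ℤ)
    (k : ℕ) : ∀ n, ∃ R : Retract (totD (sdChainIter r o C k)) (totD (sdChainIter r o C (k + n))),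
      Controlled a R (fun t s => car X k n t ≤ s) (fun s t => s = img r k n t)
        fun t s => car X k n t ≤ car X k n s
  | 0 => ⟨Retract.refl _, Controlled.refl a _ (fun s => le_refl s) fun s => rfl⟩
  | n + 1 => by
    obtain ⟨R, hR⟩ := exists_retract_iter hr hX o C k n
    obtain ⟨m, hm⟩ := hX
    obtain ⟨S, hS⟩ := exists_retract_sdChain (hr (k + n))
      ⟨m, card_le_sdIter hm (k + n)⟩ (orderIter o (k + n)) (sdChainIter r o C (k + n))
    refine ⟨R.trans S, hR.trans hS ?_ ?_ ?_ ?_⟩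
    · exact fun t x s h h' => (car_mono k n h').trans h
    · exact fun t x s h h' => h'.trans (by rw [h]; rfl)
    · exact fun t s h => car_mono k n h
    -- The earlier homotopy is reached through the image `r(s)`, which lies in the top of `s`, so it
    -- still moves within the carrier of `s`.
    · intro t y x s h1 h2 h3
      refine (car_mono k n h3).trans (h2.trans (car_mono k n ?_))
      rw [h1]
      exact image_le_top _ s

/-! ### Means -/

section Mean

variable {α : Type*}

/-- The mean of the values of a function on a finite set. -/
def mean (s : Finset α) (f : α → ℝ) : ℝ := (s.card : ℝ)⁻¹ * ∑ a ∈ s, f a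

theorem card_mul_mean {s : Finset α} (hs : s.Nonempty) (f : α → ℝ) :
    s.card * mean s f = ∑ a ∈ s, f a := by
  have h : (s.card : ℝ) ≠ 0 := Nat.cast_ne_zero.2 hs.card_pos.ne'
  unfold mean
  rw [← mul_assoc, mul_inv_cancel₀ h, one_mul]

theorem mean_le {s : Finset α} (hs : s.Nonempty) {f : α → ℝ} {c : ℝ} (h : ∀ a ∈ s, f a ≤ c) :
    mean s f ≤ c := by
  have h0 : (0 : ℝ) < s.card := Nat.cast_pos.2 hs.card_pos
  have h1 := Finset.sum_le_card_nsmul s f c h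
  rw [← card_mul_mean hs, nsmul_eq_mul] at h1
  exact le_of_mul_le_mul_left h1 h0

theorem le_mean {s : Finset α} (hs : s.Nonempty) {f : α → ℝ} {c : ℝ} (h : ∀ a ∈ s, c ≤ f a) :
    c ≤ mean s f := by
  have h0 : (0 : ℝ) < s.card := Nat.cast_pos.2 hs.card_pos
  have h1 := Finset.card_nsmul_le_sum s f c h
  rw [← card_mul_mean hs, nsmul_eq_mul] at h1
  exact le_of_mul_le_mul_left h1 h0

theorem le_mul_mean {s : Finset α} {m : ℕ} (hm : s.card ≤ m) {f : α → ℝ} (hf : ∀ a ∈ s, 0 ≤ f a)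
    {a : α} (ha : a ∈ s) : f a ≤ m * mean s f := by
  have hs : s.Nonempty := ⟨a, ha⟩
  have h1 : f a ≤ ∑ a ∈ s, f a := Finset.single_le_sum hf ha
  rw [← card_mul_mean hs] at h1
  exact h1.trans (mul_le_mul_of_nonneg_right (Nat.cast_le.2 hm) (le_mean hs hf))

/-- Sum `mean s f - f b` over `b` in `t`. The terms with `b` in `s` add up to zero, so at most `|t|
- 1` terms of size at most `c` remain. -/
theorem abs_mean_sub_mean_le {s t : Finset α} (hs : s.Nonempty) (hst : s ⊆ t) {m : ℕ}
    (hm : t.card ≤ m) {f : α → ℝ} {c : ℝ} (h : ∀ a ∈ t, ∀ b ∈ t, |f a - f b| ≤ c) :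
    |mean s f - mean t f| ≤ (1 - (m : ℝ)⁻¹) * c := by
  classical
  have ht := hs.mono hst
  obtain ⟨a, ha⟩ := hs
  have hs : s.Nonempty := ⟨a, ha⟩
  have hc : 0 ≤ c := (abs_nonneg _).trans (h a (hst ha) a (hst ha))
  have h0 : (0 : ℝ) < t.card := Nat.cast_pos.2 ht.card_pos
  have h1 : ∀ b ∈ t, |mean s f - f b| ≤ c := fun b hb => by
    have h2 : mean s f ≤ f b + c := mean_le hs fun x hx => by
      have := (abs_le.1 (h x (hst hx) b hb)).2
      linarith
    have h3 : f b - c ≤ mean s f := le_mean hs fun x hx => by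
      have := (abs_le.1 (h x (hst hx) b hb)).1
      linarith
    exact abs_le.2 ⟨by linarith, by linarith⟩
  have h2 : t.card * (mean s f - mean t f) = ∑ b ∈ t \ s, (mean s f - f b) := by
    have e1 : ∑ b ∈ s, (mean s f - f b) = 0 := by
      rw [Finset.sum_sub_distrib, Finset.sum_const, nsmul_eq_mul, card_mul_mean hs, sub_self]
    have e2 := Finset.sum_sdiff (f := fun b => mean s f - f b) hst
    rw [e1, add_zero] at e2
    rw [e2, Finset.sum_sub_distrib, Finset.sum_const, nsmul_eq_mul, mul_sub, card_mul_mean ht]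
  have h3 : |t.card * (mean s f - mean t f)| ≤ (t.card - 1) * c := by
    rw [h2]
    refine (Finset.abs_sum_le_sum_abs _ _).trans ?_
    refine (Finset.sum_le_card_nsmul _ _ c fun b hb => h1 b (Finset.mem_sdiff.1 hb).1).trans ?_
    rw [nsmul_eq_mul]
    refine mul_le_mul_of_nonneg_right ?_ hc
    have e1 := Finset.card_sdiff_add_card_eq_card hst
    have e2 := hs.card_pos
    rw [le_sub_iff_add_le]
    exact_mod_cast (by omega : (t \ s).card + 1 ≤ t.card)
  rw [abs_mul, abs_of_pos h0] at h3
  have h4 : (m : ℝ)⁻¹ ≤ (t.card : ℝ)⁻¹ := inv_anti₀ h0 (Nat.cast_le.2 hm)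
  refine (le_of_mul_le_mul_left (h3.trans (le_of_eq ?_)) h0 :
    _ ≤ (1 - (t.card : ℝ)⁻¹) * c).trans (mul_le_mul_of_nonneg_right (by linarith) hc)
  field_simp

end Mean

namespace LFComplex

variable {X : LFComplex.{u}}

/-! ### The standard distance and barycentric coordinates -/

theorem abs_sub_le_euclDist (x y : X.V →₀ ℝ) (b : X.V) : |x b - y b| ≤ euclDist x y := by
  refine Real.abs_le_sqrt ?_
  rw [← Finsupp.sub_apply]
  by_cases h : b ∈ (x - y).support
  · exact Finset.single_le_sum (f := fun a => (x - y) a ^ 2) (fun _ _ => sq_nonneg _) h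
  · rw [Finsupp.notMem_support_iff.1 h]
    exact (by norm_num : (0 : ℝ) ^ 2 ≤ 0).trans (Finset.sum_nonneg fun _ _ => sq_nonneg _)

/-- Add up the change of the coordinate along a polygonal path. This bound is the only property of
the metric that the proof needs. -/
theorem ofReal_abs_sub_le_stdDist (x y : X.V →₀ ℝ) (b : X.V) :
    ENNReal.ofReal |x b - y b| ≤ X.stdDist x y := by
  refine le_iInf fun k => le_iInf fun p => le_iInf fun h => ?_
  obtain ⟨rfl, rfl, -⟩ := h
  induction k with
  | zero => simp
  | succ k ih =>
    rw [Finset.sum_range_succ]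
    calc ENNReal.ofReal |p 0 b - p (k + 1) b|
        ≤ ENNReal.ofReal (|p 0 b - p k b| + |p k b - p (k + 1) b|) :=
          ENNReal.ofReal_le_ofReal (abs_sub_le _ _ _)
      _ = ENNReal.ofReal |p 0 b - p k b| + ENNReal.ofReal |p k b - p (k + 1) b| :=
          ENNReal.ofReal_add (abs_nonneg _) (abs_nonneg _)
      _ ≤ _ := add_le_add ih (ENNReal.ofReal_le_ofReal (abs_sub_le_euclDist _ _ _))

theorem vertexPos_succ_apply (j : ℕ) (s : (X.sdIter j).Simplex) (b : X.V) :
    X.vertexPos (j + 1) s b = mean s.1 fun a => X.vertexPos j a b := by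
  change ((s.1.card : ℝ)⁻¹ • ∑ a ∈ s.1, X.vertexPos j a) b = _
  rw [Finsupp.smul_apply, Finsupp.finsetSum_apply, smul_eq_mul]
  rfl

theorem vertexPos_zero_self (b : X.V) : X.vertexPos 0 b b = 1 :=
  Finsupp.single_eq_same

theorem vertexPos_zero_ne {a b : X.V} (h : a ≠ b) : X.vertexPos 0 a b = 0 :=
  Finsupp.single_eq_of_ne h.symm

theorem vertexPos_nonneg : ∀ (j : ℕ) (v : (X.sdIter j).V) (b : X.V), 0 ≤ X.vertexPos j v b
  | 0 => fun v b => by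
    by_cases h : (v : X.V) = b
    · obtain rfl := h
      exact zero_le_one.trans (vertexPos_zero_self v).ge
    · exact (vertexPos_zero_ne h).ge
  | j + 1 => fun v b => (le_mean (Simplex.nonempty (X := X.sdIter j) v) fun a _ =>
      vertexPos_nonneg j a b).trans (vertexPos_succ_apply j v b).ge

/-- The vertices of a simplex lie in its carrier. -/
theorem vertexPos_le_of_car {k : ℕ} {b : X.V} {c : ℝ} : ∀ (n : ℕ) (t : (X.sdIter (k + n)).Simplex),
    (∀ w ∈ (car X k n t).1, X.vertexPos k w b ≤ c) → ∀ v ∈ t.1, X.vertexPos (k + n) v b ≤ c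
  | 0 => fun _ h => h
  | n + 1 => fun t h v hv => by
    have h1 := vertexPos_le_of_car n (top (X := X.sdIter (k + n)) t) h
    refine (vertexPos_succ_apply (k + n) v b).trans_le ?_
    exact mean_le (Simplex.nonempty (X := X.sdIter (k + n)) v) fun a ha =>
      h1 a (le_top (X := X.sdIter (k + n)) hv ha)

theorem le_vertexPos_of_car {k : ℕ} {b : X.V} {c : ℝ} : ∀ (n : ℕ) (t : (X.sdIter (k + n)).Simplex),
    (∀ w ∈ (car X k n t).1, c ≤ X.vertexPos k w b) → ∀ v ∈ t.1, c ≤ X.vertexPos (k + n) v b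
  | 0 => fun _ h => h
  | n + 1 => fun t h v hv => by
    have h1 := le_vertexPos_of_car n (top (X := X.sdIter (k + n)) t) h
    refine le_of_le_of_eq ?_ (vertexPos_succ_apply (k + n) v b).symm
    exact le_mean (Simplex.nonempty (X := X.sdIter (k + n)) v) fun a ha =>
      h1 a (le_top (X := X.sdIter (k + n)) hv ha)

theorem barycentre_apply (j : ℕ) (t : (X.sdIter j).Simplex) (b : X.V) :
    X.barycentre j t b = mean t.1 fun a => X.vertexPos j a b :=
  vertexPos_succ_apply j t b

theorem barycentre_le_of_car {k n : ℕ} {b : X.V} {c : ℝ} (t : (X.sdIter (k + n)).Simplex)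
    (h : ∀ w ∈ (car X k n t).1, X.vertexPos k w b ≤ c) : X.barycentre (k + n) t b ≤ c := by
  rw [barycentre_apply]
  exact mean_le t.nonempty (vertexPos_le_of_car n t h)

theorem le_barycentre_of_car {k n : ℕ} {b : X.V} {c : ℝ} (t : (X.sdIter (k + n)).Simplex)
    (h : ∀ w ∈ (car X k n t).1, c ≤ X.vertexPos k w b) : c ≤ X.barycentre (k + n) t b := by
  rw [barycentre_apply]
  exact le_mean t.nonempty (le_vertexPos_of_car n t h)

variable {m : ℕ}

/-- The vertex is the top of the flag: it is the barycentre of a simplex with at most `m` vertices,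
one of which has a large coordinate by induction. Each level costs a factor `m`. -/
theorem exists_le_vertexPos (hm : ∀ s : X.Simplex, s.1.card ≤ m) (b : X.V) :
    ∀ (j : ℕ) (u : (X.sdIter (0 + j)).Simplex), b ∈ (car X 0 j u).1 →
      ∃ w ∈ u.1, 1 ≤ (m : ℝ) ^ j * X.vertexPos (0 + j) w b
  | 0 => fun _ h => ⟨b, h, by rw [pow_zero, one_mul]; exact (vertexPos_zero_self b).ge⟩
  | j + 1 => fun u h => by
    obtain ⟨w, hw, h1⟩ := exists_le_vertexPos hm b j (top (X := X.sdIter (0 + j)) u) h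
    refine ⟨top (X := X.sdIter (0 + j)) u, top_mem _, h1.trans ?_⟩
    rw [pow_succ, mul_assoc]
    refine mul_le_mul_of_nonneg_left ?_ (by positivity)
    refine le_of_le_of_eq ?_ (congrArg _ (vertexPos_succ_apply (0 + j) _ b).symm)
    exact le_mul_mean (card_le_sdIter hm (0 + j) _)
      (f := fun a => X.vertexPos (0 + j) a b) (fun a _ => vertexPos_nonneg _ a b) hw

/-- Two vertices of a flag are barycentres of nested simplices, so each subdivision contracts the
variation by the factor of `abs_mean_sub_mean_le`. -/
theorem abs_vertexPos_sub_le (hm : ∀ s : X.Simplex, s.1.card ≤ m) (b : X.V) :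
    ∀ (j : ℕ) (u : (X.sdIter j).Simplex), ∀ v ∈ u.1, ∀ w ∈ u.1,
      |X.vertexPos j v b - X.vertexPos j w b| ≤ (1 - (m : ℝ)⁻¹) ^ j
  | 0 => fun u v _ w _ => by
    have h : ∀ v : X.V, X.vertexPos 0 v b ≤ 1 := fun v => by
      by_cases e : v = b
      · rw [e, vertexPos_zero_self]
      · rw [vertexPos_zero_ne e]
        exact zero_le_one
    have h1 := h v
    have h2 := h w
    have h3 := vertexPos_nonneg 0 v b
    have h4 := vertexPos_nonneg 0 w b
    rw [pow_zero, abs_le]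
    exact ⟨by linarith, by linarith⟩
  | j + 1 => fun u v hv w hw => by
    have key : ∀ σ τ : (X.sdIter j).Simplex, σ ≤ τ →
        |mean σ.1 (fun a => X.vertexPos j a b) - mean τ.1 fun a => X.vertexPos j a b| ≤
          (1 - (m : ℝ)⁻¹) ^ (j + 1) := fun σ τ h => by
      rw [pow_succ']
      exact abs_mean_sub_mean_le σ.nonempty h (card_le_sdIter hm j τ)
        (abs_vertexPos_sub_le hm b j τ)
    have e1 := vertexPos_succ_apply j v b
    have e2 := vertexPos_succ_apply j w b
    rw [e1, e2]
    rcases flag_total (X := X.sdIter j) (t := u) hv hw with h | h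
    · exact key _ _ h
    · rw [abs_sub_comm]
      exact key _ _ h

/-! ### The approximations -/

/-- The approximation choosing, in every simplex, a vertex at which `κ` is minimal. -/
theorem exists_approx (κ : X.V → ℕ) :
    ∃ r : X.Approx, r.IsOrdered ∧ ∀ s : X.Simplex, ∀ v ∈ s.1, κ (r.toFun s) ≤ κ v := by
  -- The order on the first component is reversed, so a largest key has minimal `κ`. An injection
  -- into cardinals breaks ties, as `IsMax` requires an injective key.
  let key : X.V → ℕᵒᵈ ×ₗ Cardinal.{u} := fun v => toLex (OrderDual.toDual (κ v), embeddingToCardinal v)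
  have h1 : ∀ s : X.Simplex, ∃ v ∈ s.1, ∀ w ∈ s.1, key w ≤ key v := fun s =>
    s.1.exists_max_image key s.nonempty
  choose f hf hmax using h1
  refine ⟨⟨f, hf⟩, ⟨_, inferInstance, key, ⟨fun v w e => ?_, fun s v hv => hmax s v hv⟩⟩,
    fun s v hv => ?_⟩
  · exact embeddingToCardinal.injective (congrArg (fun p => (ofLex p).2) e)
  · rcases Prod.Lex.le_iff.1 (hmax s v hv) with h | h
    · exact le_of_lt h
    · exact le_of_eq h.1.symm

/-- The numbers minimised by the approximations, and the approximations. They are reset at the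
levels `0` and `j₀`. -/
def levelKey (X : LFComplex.{u}) (j₀ : ℕ) : ∀ j, (X.sdIter j).V → ℕ
  | 0 => fun _ => 0
  | j + 1 => fun s =>
    if j = 0 ∨ j = j₀ then (s : (X.sdIter j).Simplex).1.card
    else levelKey X j₀ j ((exists_approx (X := X.sdIter j) (levelKey X j₀ j)).choose.toFun s)

/-- The approximations used for squeezing. -/
def squeezeApprox (X : LFComplex.{u}) (j₀ j : ℕ) : (X.sdIter j).Approx :=
  (exists_approx (levelKey X j₀ j)).choose

theorem squeezeApprox_isOrdered (j₀ j : ℕ) : (squeezeApprox X j₀ j).IsOrdered :=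
  (exists_approx (levelKey X j₀ j)).choose_spec.1

theorem levelKey_squeezeApprox_le {j₀ j : ℕ} (s : (X.sdIter j).Simplex) {v : (X.sdIter j).V}
    (hv : v ∈ s.1) : levelKey X j₀ j ((squeezeApprox X j₀ j).toFun s) ≤ levelKey X j₀ j v :=
  (exists_approx (levelKey X j₀ j)).choose_spec.2 s v hv

theorem levelKey_of_eq {j₀ j : ℕ} (h : j = 0 ∨ j = j₀) (s : (X.sdIter j).Simplex) :
    levelKey X j₀ (j + 1) s = s.1.card := if_pos h

theorem levelKey_of_ne {j₀ j : ℕ} (h : ¬ (j = 0 ∨ j = j₀)) (s : (X.sdIter j).Simplex) :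
    levelKey X j₀ (j + 1) s = levelKey X j₀ j ((squeezeApprox X j₀ j).toFun s) := if_neg h

/-- The simplex of `Sd^k X` to which a vertex of `Sd^(k+n+1) X` is sent by the approximations. -/
def descend (r : ∀ j, (X.sdIter j).Approx) (k : ℕ) :
    ∀ n, (X.sdIter (k + n)).Simplex → (X.sdIter k).Simplex
  | 0 => fun s => s
  | n + 1 => fun s => descend r k n ((r (k + n + 1)).toFun s)

/-- The vertices chosen in the elements of a flag all lie in its top, again a flag, so comparability
passes down level by level. -/
theorem descend_total (r : ∀ j, (X.sdIter j).Approx) (k : ℕ) :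
    ∀ (n : ℕ) (s : (X.sdIter (k + n + 1)).Simplex) (v w : (X.sdIter (k + n)).Simplex),
      v ∈ s.1 → w ∈ s.1 → descend r k n v ≤ descend r k n w ∨ descend r k n w ≤ descend r k n v
  | 0 => fun s _ _ hv hw => flag_total (X := X.sdIter k) (t := s) hv hw
  | n + 1 => fun s v w hv hw =>
    descend_total r k n (top (X := X.sdIter (k + n + 1)) s) _ _
      (le_top (X := X.sdIter (k + n + 1)) hv ((r (k + n + 1)).mem v))
      (le_top (X := X.sdIter (k + n + 1)) hw ((r (k + n + 1)).mem w))

/-- The hypothesis says that level `k` is a reset and that none occurs in the following levels up to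
`k + n`. Until then the key remembers the size of the simplex of `Sd^k X` that is finally reached.
-/
theorem levelKey_eq_card {j₀ k : ℕ} : ∀ n, (∀ l ≤ n, (k + l = 0 ∨ k + l = j₀) ↔ l = 0) →
    ∀ v : (X.sdIter (k + n)).Simplex,
      levelKey X j₀ (k + n + 1) v = (descend (squeezeApprox X j₀) k n v).1.card
  | 0 => fun h v => levelKey_of_eq ((h 0 le_rfl).2 rfl) v
  | n + 1 => fun h v => (levelKey_of_ne (fun e => by
      have := (h (n + 1) le_rfl).1 e
      omega) v).trans
    (levelKey_eq_card n (fun l hl => h l (hl.trans n.le_succ)) _)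

/-- The approximation minimises the size of the simplex reached in `Sd^k X`. The candidates are
nested, so the smallest is contained in all of them. -/
theorem descend_le {j₀ k n : ℕ} (h : ∀ l ≤ n, (k + l = 0 ∨ k + l = j₀) ↔ l = 0)
    (s : (X.sdIter (k + n + 1)).Simplex) {v : (X.sdIter (k + n)).Simplex} (hv : v ∈ s.1) :
    descend (squeezeApprox X j₀) k (n + 1) s ≤ descend (squeezeApprox X j₀) k n v := by
  have h1 := levelKey_squeezeApprox_le (j₀ := j₀) s hv
  have e1 := levelKey_eq_card n h ((squeezeApprox X j₀ (k + n + 1)).toFun s)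
  have e2 := levelKey_eq_card n h v
  rcases descend_total (squeezeApprox X j₀) k n s ((squeezeApprox X j₀ (k + n + 1)).toFun s) v
    ((squeezeApprox X j₀ (k + n + 1)).mem s) hv with h2 | h2
  · exact h2
  · have h3 := Finset.eq_of_subset_of_card_le h2 (by
      rw [← e1, ← e2]
      exact h1)
    exact le_of_eq (Subtype.ext h3.symm)

variable {j₀ k : ℕ}

/-- By `descend_le`, `w` lies in the simplex reached from every vertex `a` of `v`, so induction
gives each of these the lower bound `1/m` times the coordinate of `w`. Averaging preserves this
bound, so the factor `m` of the first level is paid only once. -/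
theorem vertexPos_le_of_mem_descend (hm : ∀ s : X.Simplex, s.1.card ≤ m) (b : X.V) :
    ∀ (n : ℕ), (∀ l < n, (k + l = 0 ∨ k + l = j₀) ↔ l = 0) → ∀ (v : (X.sdIter (k + n)).Simplex),
      ∀ w ∈ (descend (squeezeApprox X j₀) k n v).1,
        X.vertexPos k w b ≤ m * X.vertexPos (k + n + 1) v b
  | 0 => fun _ v w hw => by
    refine le_of_le_of_eq ?_ (congrArg _ (vertexPos_succ_apply k v b).symm)
    exact le_mul_mean (card_le_sdIter hm k v) (f := fun a => X.vertexPos k a b)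
      (fun a _ => vertexPos_nonneg _ a b) hw
  | n + 1 => fun h v w hw => by
    have h0 : (0 : ℝ) < m := Nat.cast_pos.2 (v.nonempty.card_pos.trans_le (card_le_sdIter hm _ v))
    rw [← div_le_iff₀' h0]
    refine le_of_le_of_eq ?_ (vertexPos_succ_apply (k + n + 1) v b).symm
    refine le_mean v.nonempty fun a ha => ?_
    rw [div_le_iff₀' h0]
    exact vertexPos_le_of_mem_descend hm b n (fun l hl => h l (hl.trans n.lt_succ_self)) a w
      (descend_le (fun l hl => h l (Nat.lt_succ_of_le hl)) v ha hw)

theorem exists_of_mem_img (r : ∀ j, (X.sdIter j).Approx) :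
    ∀ (n : ℕ) (t : (X.sdIter (k + n + 1)).Simplex), ∀ w ∈ (img r k (n + 1) t).1,
      ∃ v : (X.sdIter (k + n)).Simplex, v ∈ t.1 ∧ w ∈ (descend r k n v).1
  | 0 => fun t w hw => by
    obtain ⟨v, hv, rfl⟩ := mem_image.1 hw
    exact ⟨v, hv, (r k).mem v⟩
  | n + 1 => fun t w hw => by
    obtain ⟨v', hv', h⟩ := exists_of_mem_img r n _ w hw
    obtain ⟨v, hv, rfl⟩ := mem_image.1 hv'
    exact ⟨v, hv, h⟩

theorem vertexPos_le_mul_barycentre (hm : ∀ s : X.Simplex, s.1.card ≤ m) (b : X.V) {n : ℕ}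
    (h : ∀ l < n - 1, (k + l = 0 ∨ k + l = j₀) ↔ l = 0) (t : (X.sdIter (k + n)).Simplex)
    {w : (X.sdIter k).V} (hw : w ∈ (img (squeezeApprox X j₀) k n t).1) :
    ∃ v ∈ t.1, X.vertexPos k w b ≤ m * X.vertexPos (k + n) v b := by
  cases n with
  | zero =>
    have h0 : (1 : ℝ) ≤ m := Nat.one_le_cast.2 (t.nonempty.card_pos.trans_le (card_le_sdIter hm _ t))
    exact ⟨w, hw, le_mul_of_one_le_left (vertexPos_nonneg _ _ _) h0⟩
  | succ n =>
    obtain ⟨v, hv, h1⟩ := exists_of_mem_img _ n t w hw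
    exact ⟨v, hv, vertexPos_le_of_mem_descend hm b n h v w h1⟩

end LFComplex

open LFComplex Fam

/-! ### Control by the metric -/

namespace LFComplex

variable {X : LFComplex.{u}}

/-- The barycentres of two simplices have barycentric coordinates that differ by less than `ε`. -/
def Near (X : LFComplex.{u}) (ε : ℝ) {i : ℕ} (t s : (X.sdIter i).Simplex) : Prop :=
  ∀ b, |X.barycentre i s b - X.barycentre i t b| < ε

theorem Near.symm {ε : ℝ} {i : ℕ} {t s : (X.sdIter i).Simplex} (h : X.Near ε t s) :
    X.Near ε s t := fun b => by
  rw [abs_sub_comm]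
  exact h b

theorem near_of_stdDist_lt {ε : ℝ} {i : ℕ} {t s : (X.sdIter i).Simplex}
    (h : X.stdDist (X.barycentre i s) (X.barycentre i t) < ENNReal.ofReal ε) : X.Near ε t s :=
  fun b => by
    have h1 := (ofReal_abs_sub_le_stdDist _ _ b).trans_lt h
    exact (ENNReal.ofReal_lt_ofReal_iff (ENNReal.ofReal_pos.1 (bot_le.trans_lt h))).1 h1

variable {m j₀ d : ℕ}

/-- One factor `m` comes from the descent and the other from passing from a vertex of `t` to its
barycentre. Neither depends on `d`. -/
theorem vertexPos_le_sq_mul_barycentre (hm : ∀ s : X.Simplex, s.1.card ≤ m) (b : X.V)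
    (t : (X.sdIter (0 + j₀ + d)).Simplex) {w : (X.sdIter (0 + j₀)).V}
    (hw : w ∈ (img (squeezeApprox X j₀) (0 + j₀) d t).1) :
    X.vertexPos (0 + j₀) w b ≤ m * (m * X.barycentre (0 + j₀ + d) t b) := by
  obtain ⟨v, hv, h⟩ := vertexPos_le_mul_barycentre (j₀ := j₀) hm b (by omega) t hw
  refine h.trans (mul_le_mul_of_nonneg_left ?_ (Nat.cast_nonneg m))
  rw [barycentre_apply]
  exact le_mul_mean (card_le_sdIter hm _ t) (f := fun a => X.vertexPos (0 + j₀ + d) a b)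
    (fun a _ => vertexPos_nonneg _ a b) hv

/-- A vertex of the carrier outside `σ` would give the image a vertex with coordinate at least
`m^{-j₀}`, whereas coordinates grow at most by `m²` when passing to the image. -/
theorem car_img_le (hm : ∀ s : X.Simplex, s.1.card ≤ m) {σ : X.Simplex}
    {t : (X.sdIter (0 + j₀ + d)).Simplex}
    (h : ∀ b ∉ σ.1, (m : ℝ) ^ (j₀ + 2) * X.barycentre (0 + j₀ + d) t b < 1) :
    car X 0 j₀ (img (squeezeApprox X j₀) (0 + j₀) d t) ≤ σ := by
  intro b hb
  by_contra hbσ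
  obtain ⟨w, hw, h1⟩ := exists_le_vertexPos hm b j₀ _ hb
  have h2 := mul_le_mul_of_nonneg_left (vertexPos_le_sq_mul_barycentre hm b t hw)
    (pow_nonneg (Nat.cast_nonneg m) j₀ : (0 : ℝ) ≤ (m : ℝ) ^ j₀)
  have h3 := h b hbσ
  rw [pow_add] at h3
  linarith

/-- The descent from `Sd^{j₀} X` to `X` costs one further factor `m`, whatever `j₀` is. So `j₀` can
later be chosen in terms of `m³`. -/
theorem one_le_of_mem_img_img (hm : ∀ s : X.Simplex, s.1.card ≤ m) {b : X.V}
    {t : (X.sdIter (0 + j₀ + d)).Simplex}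
    (hb : b ∈ (img (squeezeApprox X j₀) 0 j₀ (img (squeezeApprox X j₀) (0 + j₀) d t)).1) :
    1 ≤ (m : ℝ) ^ 3 * X.barycentre (0 + j₀ + d) t b := by
  obtain ⟨w, hw, h1⟩ := vertexPos_le_mul_barycentre (j₀ := j₀) hm b (by omega) _ hb
  have h2 := mul_le_mul_of_nonneg_left (vertexPos_le_sq_mul_barycentre hm b t hw)
    (Nat.cast_nonneg m : (0 : ℝ) ≤ (m : ℝ))
  have h3 : X.vertexPos 0 b b = 1 := vertexPos_zero_self b
  rw [h3] at h1
  calc (1 : ℝ) ≤ _ := h1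
    _ ≤ _ := h2
    _ = _ := by ring

theorem barycentre_eq_zero {σ : X.Simplex} {t : (X.sdIter (0 + j₀ + d)).Simplex}
    (h : car X 0 j₀ (car X (0 + j₀) d t) ≤ σ) {b : X.V} (hb : b ∉ σ.1) :
    X.barycentre (0 + j₀ + d) t b ≤ 0 :=
  barycentre_le_of_car t (vertexPos_le_of_car j₀ _ fun w hw =>
    (vertexPos_zero_ne fun e : (w : X.V) = b => hb (e ▸ h hw)).le)

/-- Both barycentres are averages over vertices of one simplex of `Sd^{j₀} X`, the carrier of `t`,
on which the coordinate hardly varies. -/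
theorem barycentre_sub_le (hm : ∀ s : X.Simplex, s.1.card ≤ m) (b : X.V)
    {t s : (X.sdIter (0 + j₀ + d)).Simplex} (h : car X (0 + j₀) d s ≤ car X (0 + j₀) d t) :
    X.barycentre (0 + j₀ + d) s b ≤
      X.barycentre (0 + j₀ + d) t b + (1 - (m : ℝ)⁻¹) ^ (0 + j₀) := by
  refine barycentre_le_of_car s fun w hw => ?_
  rw [← sub_le_iff_le_add]
  refine le_barycentre_of_car t fun v hv => ?_
  have := (abs_le.1 (abs_vertexPos_sub_le hm b (0 + j₀) _ w (h hw) v hv)).2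
  linarith

/-- Nonzero components of morphisms of control less than `ε` do not leave a given simplex. -/
theorem exists_squeeze (hX : X.FiniteDimensional) :
    ∃ ε : ℝ, 0 < ε ∧ ∃ j₀ : ℕ, ∀ (d : ℕ) (σ : X.Simplex) (t₁ t₂ : (X.sdIter (0 + j₀ + d)).Simplex),
      car X 0 j₀ (car X (0 + j₀) d t₁) ≤ σ → X.Near ε t₂ t₁ →
      car X 0 j₀ (img (squeezeApprox X j₀) (0 + j₀) d t₂) ≤ σ ∧
      ∀ t₃ t₄ : (X.sdIter (0 + j₀ + d)).Simplex, car X (0 + j₀) d t₃ ≤ car X (0 + j₀) d t₂ →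
        X.Near ε t₄ t₃ →
        img (squeezeApprox X j₀) 0 j₀ (img (squeezeApprox X j₀) (0 + j₀) d t₄) ≤ σ := by
  obtain ⟨n, hm⟩ := hX
  set m := n + 1
  have h1 : (1 : ℝ) ≤ m := Nat.one_le_cast.2 n.succ_pos
  have h0 : (0 : ℝ) < m := by linarith
  -- Simplices of `Sd^{j₀} X` are to be so small that a homotopy inside them uses up less than half
  -- of the tolerance `m^{-3}` of `one_le_of_mem_img_img`.
  obtain ⟨j₀, hj⟩ := exists_pow_lt_of_lt_one (y := 1 - (m : ℝ)⁻¹)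
    (x := ((m : ℝ) ^ 3)⁻¹ / 2) (by positivity) (by linarith [inv_pos.2 h0])
  have hpos : 0 < ((m : ℝ) ^ (j₀ + 3))⁻¹ := by positivity
  have hε : ((m : ℝ) ^ (j₀ + 3))⁻¹ ≤ ((m : ℝ) ^ 3)⁻¹ :=
    inv_anti₀ (by positivity) (pow_le_pow_right₀ h1 (by omega))
  -- Two moves by this `ε` use at most the other half of `m^{-3}`, and one move stays below the
  -- bound `m^{-(j₀ + 2)}` needed for `car_img_le`.
  refine ⟨((m : ℝ) ^ (j₀ + 3))⁻¹ / 4, by linarith, j₀, fun d σ t₁ t₂ h hn => ?_⟩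
  have near : ∀ b ∉ σ.1, X.barycentre (0 + j₀ + d) t₂ b < ((m : ℝ) ^ (j₀ + 3))⁻¹ / 4 := fun b hb => by
    have e1 := barycentre_eq_zero h hb
    have e2 := (abs_lt.1 (hn b)).1
    linarith
  refine ⟨car_img_le hm fun b hb => ?_, fun t₃ t₄ h' hn' b hb => ?_⟩
  · have e1 := mul_lt_mul_of_pos_left (near b hb) (pow_pos h0 (j₀ + 2))
    have e2 : (m : ℝ) ^ (j₀ + 2) * (((m : ℝ) ^ (j₀ + 3))⁻¹ / 4) ≤ 1 := by
      rw [← mul_div_assoc, ← div_eq_mul_inv]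
      have := div_le_one_of_le₀ (pow_le_pow_right₀ h1 (by omega : j₀ + 2 ≤ j₀ + 3))
        (pow_nonneg h0.le _)
      linarith
    linarith
  · by_contra hbσ
    -- A vertex outside `σ` needs a coordinate of `t₄` of at least `m^{-3}`. It is less than `2ε`
    -- plus the variation on a simplex of `Sd^{j₀} X`.
    have e1 := one_le_of_mem_img_img hm hb
    have e2 := near b hbσ
    have e3 := barycentre_sub_le hm b h'
    have e4 := (abs_lt.1 (hn' b)).1
    have e5 : ((m : ℝ) ^ 3)⁻¹ ≤ X.barycentre (0 + j₀ + d) t₄ b :=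
      (inv_le_iff_one_le_mul₀' (pow_pos h0 3)).2 e1
    have e6 : (1 - (m : ℝ)⁻¹) ^ (0 + j₀) < ((m : ℝ) ^ 3)⁻¹ / 2 := by rwa [zero_add]
    linarith

end LFComplex

/-! ### Transfer of chain equivalences along retractions -/

/-- The compression of `h` is a homotopy for `R.up ≫ f ≫ g ≫ R.down`. Inserting `S.down ≫ S.up`
between `f` and `g` changes this by the boundary of the term with `S.htpy`. -/
theorem Retract.transfer {B : Type w} [Category.{v} B] [Preadditive B] {M M' N N' : B}
    {d : M ⟶ M} {d' : M' ⟶ M'} {e : N ⟶ N} {e' : N' ⟶ N'} (R : Retract d d') (S : Retract e e')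
    {f : M' ⟶ N'} {g : N' ⟶ M'} {h : M' ⟶ M'} (hf : f ≫ e' = d' ≫ f) (hg : g ≫ d' = e' ≫ g)
    (hh : h ≫ d' + d' ≫ h = f ≫ g - 𝟙 M') :
    (R.up ≫ h ≫ R.down - R.up ≫ f ≫ S.htpy ≫ g ≫ R.down) ≫ d +
      d ≫ (R.up ≫ h ≫ R.down - R.up ≫ f ≫ S.htpy ≫ g ≫ R.down) =
      (R.up ≫ f ≫ S.down) ≫ S.up ≫ g ≫ R.down - 𝟙 M := by
  have e1 : (R.up ≫ h ≫ R.down) ≫ d + d ≫ R.up ≫ h ≫ R.down =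
      R.up ≫ f ≫ g ≫ R.down - 𝟙 M := by
    calc _ = R.up ≫ (h ≫ d' + d' ≫ h) ≫ R.down := by
          simp only [Preadditive.add_comp, Preadditive.comp_add, Category.assoc, R.down_comm]
          rw [← Category.assoc d, R.up_comm, Category.assoc]
      _ = _ := by
          rw [hh]
          simp only [Preadditive.sub_comp, Preadditive.comp_sub, Category.assoc, Category.id_comp,
            R.up_down]
  -- All the outer maps commute with the differentials, so the boundary is computed on `S.htpy`
  -- alone.
  have e2 : (R.up ≫ f ≫ S.htpy ≫ g ≫ R.down) ≫ d + d ≫ R.up ≫ f ≫ S.htpy ≫ g ≫ R.down =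
      R.up ≫ f ≫ g ≫ R.down - (R.up ≫ f ≫ S.down) ≫ S.up ≫ g ≫ R.down := by
    calc _ = R.up ≫ f ≫ (S.htpy ≫ e' + e' ≫ S.htpy) ≫ g ≫ R.down := by
          simp only [Preadditive.add_comp, Preadditive.comp_add, Category.assoc, ← R.down_comm]
          rw [← Category.assoc d, R.up_comm, ← Category.assoc g, hg, ← Category.assoc f e', hf]
          simp only [Category.assoc]
      _ = _ := by
          rw [S.htpy_eq]
          simp only [Preadditive.sub_comp, Preadditive.comp_sub, Category.assoc, Category.id_comp]
  rw [Preadditive.sub_comp, Preadditive.comp_sub, sub_add_sub_comm, e1, e2]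
  abel

/-! ### Squeezing a controlled chain equivalence -/

section Final

variable {X : LFComplex.{u}} {A : Type w} [Category.{v} A] [Preadditive A] {i : ℕ}

theorem near_of_homBound_lt {M N : GradedCat (X.sdIter i) A} {f : M ⟶ N} {ε : ℝ}
    (h : homBound f < ENNReal.ofReal ε) {t s : (X.sdIter i).Simplex}
    (hts : Graded.Hom.f f t s ≠ 0) : X.Near ε t s :=
  near_of_stdDist_lt (((le_iSup (fun _ : Graded.Hom.f f t s ≠ 0 =>
    X.stdDist (X.barycentre i s) (X.barycentre i t)) hts).trans
    (le_iSup₂ (f := fun t s => ⨆ _ : Graded.Hom.f f t s ≠ 0,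
      X.stdDist (X.barycentre i s) (X.barycentre i t)) t s)).trans_lt h)

theorem supp_totMap_near {C D : ChainComplex (GradedCat (X.sdIter i) A) ℤ} {f : C ⟶ D} {ε : ℝ}
    (h : ⨆ n, homBound (f.f n) < ENNReal.ofReal ε) :
    Supp (totMap f) fun j i => X.Near ε j.1 i.1 := fun j k hjk => by
  obtain ⟨t, m⟩ := j
  obtain ⟨s, n⟩ := k
  have h1 : n = m := by
    have := (supp_tot _ _ hjk).2
    simp only at this
    omega
  subst h1
  change Graded.Hom.f (mapFamily f n n) t s ≠ 0 at hjk
  rw [mapFamily_self] at hjk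
  exact near_of_homBound_lt ((le_iSup (fun n => homBound (f.f n)) n).trans_lt h) hjk

theorem supp_totHtpy_near {C D : ChainComplex (GradedCat (X.sdIter i) A) ℤ} {f g : C ⟶ D}
    {h : Homotopy f g} {ε : ℝ} (hε : ⨆ (n) (m), homBound (h.hom n m) < ENNReal.ofReal ε) :
    Supp (totHtpy h) fun j i => X.Near ε j.1 i.1 := fun j k hjk =>
  near_of_homBound_lt ((le_iSup₂ (f := fun n m => homBound (h.hom n m)) k.2 j.2).trans_lt hε) hjk

variable {a : Variance}

/-- The supports of the retractions, and of matrices of small bound, are such that the transferred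
maps and homotopies have support in `a.rel X`. -/
theorem supp_transfer {T : Type u} {U : T → X.Simplex → Prop} {D : X.Simplex → T → Prop}
    {N Θ : T → T → Prop} (hN : ∀ t s, N t s → N s t)
    (hsq : ∀ σ t₁ t₂ t, U t₁ σ → N t₂ t₁ → D t t₂ → t ≤ σ)
    {M P : X.Simplex × ℤ → A} {M' P' : T × ℤ → A} {d : Fam.mk _ M ⟶ Fam.mk _ M}
    {d' : Fam.mk _ M' ⟶ Fam.mk _ M'} {e : Fam.mk _ P ⟶ Fam.mk _ P}
    {e' : Fam.mk _ P' ⟶ Fam.mk _ P'} {R : Retract d d'} {S : Retract e e'}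
    (hR : Controlled a R U D Θ) (hS : Controlled a S U D Θ)
    {f : Fam.mk _ M' ⟶ Fam.mk _ P'} (hf : Supp f fun j i => N j.1 i.1) :
    Supp (R.up ≫ f ≫ S.down) fun j i => (a.rel X).rel j.1 i.1 := fun j i h => by
  obtain ⟨k, h1, h⟩ := exists_of_ent_comp h
  obtain ⟨l, h2, h3⟩ := exists_of_ent_comp h
  have e1 := hR.up _ _ h1
  have e2 := hf _ _ h2
  have e3 := hS.down _ _ h3
  cases a
  · exact hsq _ _ _ _ e1 e2 e3
  -- With the arrows reversed, the path of indices is read backwards, which is why nearness has to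
  -- be symmetric.
  · exact hsq _ _ _ _ e3 (hN _ _ e2) e1

/-- This is the correction term of `Retract.transfer`, the only one with two moves by `f` and `g`
around a homotopy; hence the longer path in `hsq`. -/
theorem supp_transfer_htpy {T : Type u} {U : T → X.Simplex → Prop} {D : X.Simplex → T → Prop}
    {N Θ : T → T → Prop} (hN : ∀ t s, N t s → N s t)
    (hsq : ∀ σ t₁ t₂ t₃ t₄ t, U t₁ σ → N t₂ t₁ → Θ t₃ t₂ → N t₄ t₃ → D t t₄ → t ≤ σ)
    {M P : X.Simplex × ℤ → A} {M' P' : T × ℤ → A} {d : Fam.mk _ M ⟶ Fam.mk _ M}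
    {d' : Fam.mk _ M' ⟶ Fam.mk _ M'} {e : Fam.mk _ P ⟶ Fam.mk _ P}
    {e' : Fam.mk _ P' ⟶ Fam.mk _ P'} {R : Retract d d'} {S : Retract e e'}
    (hR : Controlled a R U D Θ) (hS : Controlled a S U D Θ)
    {f : Fam.mk _ M' ⟶ Fam.mk _ P'} (hf : Supp f fun j i => N j.1 i.1)
    {g : Fam.mk _ P' ⟶ Fam.mk _ M'} (hg : Supp g fun j i => N j.1 i.1) :
    Supp (R.up ≫ f ≫ S.htpy ≫ g ≫ R.down) fun j i => (a.rel X).rel j.1 i.1 := fun j i h => by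
  obtain ⟨k, h1, h⟩ := exists_of_ent_comp h
  obtain ⟨l, h2, h⟩ := exists_of_ent_comp h
  obtain ⟨p, h3, h⟩ := exists_of_ent_comp h
  obtain ⟨q, h4, h5⟩ := exists_of_ent_comp h
  have e1 := hR.up _ _ h1
  have e2 := hf _ _ h2
  have e3 := hS.htpy _ _ h3
  have e4 := hg _ _ h4
  have e5 := hR.down _ _ h5
  cases a
  · exact hsq _ _ _ _ _ _ e1 e2 e3 e4 e5
  · exact hsq _ _ _ _ _ _ e5 (hN _ _ e4) e3 (hN _ _ e2) e1

/-- Chain equivalences transfer along controlled retractions. -/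
theorem exists_homotopyEquiv_of_controlled {Y : LFComplex.{u}} {C D : ChainComplex (ControlledCat a X A) ℤ}
    {C' D' : ChainComplex (GradedCat Y A) ℤ} {U : Y.Simplex → X.Simplex → Prop}
    {E : X.Simplex → Y.Simplex → Prop} {N Θ : Y.Simplex → Y.Simplex → Prop}
    (hN : ∀ t s, N t s → N s t)
    (hsq : ∀ σ t₁ t₂ t, U t₁ σ → N t₂ t₁ → E t t₂ → t ≤ σ)
    (hsq' : ∀ σ t₁ t₂ t₃ t₄ t, U t₁ σ → N t₂ t₁ → Θ t₃ t₂ → N t₄ t₃ → E t t₄ → t ≤ σ)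
    {R : Retract (totD C) (totD C')} {S : Retract (totD D) (totD D')}
    (hR : Controlled a R U E Θ) (hS : Controlled a S U E Θ) (e : HomotopyEquiv C' D')
    (hf : Supp (totMap e.hom) fun j i => N j.1 i.1) (hg : Supp (totMap e.inv) fun j i => N j.1 i.1)
    (hh : Supp (totHtpy e.homotopyHomInvId) fun j i => N j.1 i.1)
    (hh' : Supp (totHtpy e.homotopyInvHomId) fun j i => N j.1 i.1) :
    Nonempty (HomotopyEquiv C D) := by
  have deg : ∀ {P Q : ChainComplex (GradedCat Y A) ℤ} (φ : P ⟶ Q),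
      Supp (totMap φ) fun j i => j.2 = i.2 := fun φ =>
    supp_tot.mono fun _ _ h => h.2.trans (add_zero _)
  have deg' : ∀ {P Q : ChainComplex (GradedCat Y A) ℤ} {φ χ : P ⟶ Q} (h : Homotopy φ χ),
      Supp (totHtpy h) fun j i => j.2 = i.2 + 1 := fun h => supp_tot.mono fun _ _ h => h.2
  have key : ∀ {P Q : ChainComplex (ControlledCat a X A) ℤ} {P' Q' : ChainComplex (GradedCat Y A) ℤ}
      {R : Retract (totD P) (totD P')} {S : Retract (totD Q) (totD Q')},
      Controlled a R U E Θ → Controlled a S U E Θ → ∀ φ : P' ⟶ Q',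
      (Supp (totMap φ) fun j i => N j.1 i.1) →
      ∃ ψ : P ⟶ Q, totMap ψ = R.up ≫ totMap φ ≫ S.down := by
    intro P Q P' Q' R S hR hS φ hφ
    refine ⟨chainMap (R.up ≫ totMap φ ≫ S.down) (supp_transfer hN hsq hR hS hφ) ?_ ?_,
      totMap_chainMap _ _ _ _⟩
    · have h1 : Supp (totMap φ ≫ S.down) fun j i => j.2 = i.2 :=
        (deg φ).comp hS.down_deg fun _ _ _ e e' => e'.trans e
      exact hR.up_deg.comp h1 fun _ _ _ e e' => (e'.trans e).trans (add_zero _).symm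
    · rw [Category.assoc, Category.assoc, ← S.down_comm, ← Category.assoc (totMap φ), totMap_comm,
        ← Category.assoc (totD P), R.up_comm]
      simp only [Category.assoc]
  have key' : ∀ {P Q : ChainComplex (ControlledCat a X A) ℤ} {P' Q' : ChainComplex (GradedCat Y A) ℤ}
      {R : Retract (totD P) (totD P')} {S : Retract (totD Q) (totD Q')},
      Controlled a R U E Θ → Controlled a S U E Θ → ∀ (φ : P' ⟶ Q') (χ : Q' ⟶ P')
      (h : Homotopy (φ ≫ χ) (𝟙 P')),
      (Supp (totMap φ) fun j i => N j.1 i.1) → (Supp (totMap χ) fun j i => N j.1 i.1) →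
      (Supp (totHtpy h) fun j i => N j.1 i.1) →
      ∀ (φ' : P ⟶ Q) (χ' : Q ⟶ P), totMap φ' = R.up ≫ totMap φ ≫ S.down →
        totMap χ' = S.up ≫ totMap χ ≫ R.down → Nonempty (Homotopy (φ' ≫ χ') (𝟙 P)) := by
    intro P Q P' Q' R S hR hS φ χ h hφ hχ hh φ' χ' e1 e2
    refine ⟨chainHtpy _ _ (R.up ≫ totHtpy h ≫ R.down -
      R.up ≫ totMap φ ≫ S.htpy ≫ totMap χ ≫ R.down) ?_ ?_ ?_⟩
    · exact (supp_transfer hN hsq hR hR hh).sub (supp_transfer_htpy hN hsq' hR hS hφ hχ)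
    · refine Supp.sub ?_ ?_
      · have h1 : Supp (totHtpy h ≫ R.down) fun j i => j.2 = i.2 + 1 :=
          (deg' h).comp hR.down_deg fun _ _ _ e e' => e'.trans e
        exact hR.up_deg.comp h1 fun _ _ _ e e' => e'.trans (by rw [e])
      · have h1 : Supp (totMap χ ≫ R.down) fun j i => j.2 = i.2 :=
          (deg χ).comp hR.down_deg fun _ _ _ e e' => e'.trans e
        have h2 : Supp (S.htpy ≫ totMap χ ≫ R.down) fun j i => j.2 = i.2 + 1 :=
          hS.htpy_deg.comp h1 fun _ _ _ e e' => e'.trans e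
        have h3 : Supp (totMap φ ≫ S.htpy ≫ totMap χ ≫ R.down) fun j i => j.2 = i.2 + 1 :=
          (deg φ).comp h2 fun _ _ _ e e' => e'.trans (by rw [e])
        exact hR.up_deg.comp h3 fun _ _ _ e e' => e'.trans (by rw [e])
    · rw [totMap_comp, totMap_id, e1, e2]
      refine R.transfer S (totMap_comm φ) (totMap_comm χ) ?_
      rw [totHtpy_eq, totMap_comp, totMap_id]
  obtain ⟨f, ef⟩ := key hR hS e.hom hf
  obtain ⟨g, eg⟩ := key hS hR e.inv hg
  obtain ⟨h⟩ := key' hR hS e.hom e.inv e.homotopyHomInvId hf hg hh f g ef eg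
  obtain ⟨h'⟩ := key' hS hR e.inv e.hom e.homotopyInvHomId hg hf hh' g f eg ef
  exact ⟨⟨f, g, h, h'⟩⟩

/-- It remains to match the supports of the two-stage retraction with the two conclusions of
`exists_squeeze`. -/
theorem exists_homotopyEquiv_of_equivBound_lt {ε : ℝ} {j₀ d : ℕ} (hX : X.FiniteDimensional)
    (hsq : ∀ (σ : X.Simplex) (t₁ t₂ : (X.sdIter (0 + j₀ + d)).Simplex),
      car X 0 j₀ (car X (0 + j₀) d t₁) ≤ σ → X.Near ε t₂ t₁ →
      car X 0 j₀ (img (squeezeApprox X j₀) (0 + j₀) d t₂) ≤ σ ∧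
      ∀ t₃ t₄ : (X.sdIter (0 + j₀ + d)).Simplex, car X (0 + j₀) d t₃ ≤ car X (0 + j₀) d t₂ →
        X.Near ε t₄ t₃ →
        img (squeezeApprox X j₀) 0 j₀ (img (squeezeApprox X j₀) (0 + j₀) d t₄) ≤ σ)
    (o : X.VertexOrder) (C D : ChainComplex (ControlledCat a X A) ℤ)
    (e : HomotopyEquiv (toGraded (sdChainIter (squeezeApprox X j₀) o C (0 + j₀ + d)))
      (toGraded (sdChainIter (squeezeApprox X j₀) o D (0 + j₀ + d))))
    (he : equivBound e < ENNReal.ofReal ε) : Nonempty (HomotopyEquiv C D) := by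
  have hr := squeezeApprox_isOrdered (X := X) j₀
  have key : ∀ C : ChainComplex (ControlledCat a X A) ℤ,
      ∃ R : Retract (totD C) (totD (sdChainIter (squeezeApprox X j₀) o C (0 + j₀ + d))),
        Controlled a R (fun t s => car X 0 j₀ (car X (0 + j₀) d t) ≤ s)
          (fun s t => s = img (squeezeApprox X j₀) 0 j₀ (img (squeezeApprox X j₀) (0 + j₀) d t))
          fun t s => car X (0 + j₀) d t ≤ car X (0 + j₀) d s ∨
            car X 0 j₀ (car X (0 + j₀) d t) ≤
              car X 0 j₀ (img (squeezeApprox X j₀) (0 + j₀) d s) := by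
    intro C
    -- The stages meet at `Sd^{j₀} C`. The homotopy of the upper stage stays in carriers in `Sd^{j₀}
    -- X`; that of the lower one is reached through the image in `Sd^{j₀} X`. These are the two
    -- alternatives of the disjunction.
    obtain ⟨R, hR⟩ := exists_retract_iter hr hX o C 0 j₀
    obtain ⟨S, hS⟩ := exists_retract_iter hr hX o C (0 + j₀) d
    refine ⟨R.trans S, hR.trans hS ?_ ?_ ?_ ?_⟩
    · exact fun t x s h h' => (car_mono 0 j₀ h').trans h
    · rintro t _ s rfl h
      exact h
    · exact fun t s h => Or.inl h
    · rintro t y _ s rfl h h'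
      exact Or.inr ((car_mono 0 j₀ h').trans h)
  obtain ⟨R, hR⟩ := key C
  obtain ⟨S, hS⟩ := key D
  simp only [equivBound, max_lt_iff] at he
  obtain ⟨⟨⟨h1, h2⟩, h3⟩, h4⟩ := he
  -- Forgetting the support conditions changes neither the total family nor its differential, so the
  -- retractions apply to the complexes of graded objects as they stand.
  refine exists_homotopyEquiv_of_controlled (C' := toGraded _) (D' := toGraded _)
    (N := X.Near ε) (fun t s => Near.symm) ?_ ?_ hR hS e (supp_totMap_near h1)
    (supp_totMap_near h2) (supp_totHtpy_near h3) (supp_totHtpy_near h4)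
  · rintro σ t₁ t₂ _ g1 g2 rfl
    exact (img_le_car _ 0 j₀ _).trans (hsq σ t₁ t₂ g1 g2).1
  · rintro σ t₁ t₂ t₃ t₄ _ g1 g2 g3 g4 rfl
    -- For the upper homotopy the second part of the squeezing estimate applies. For the lower one,
    -- `t₃` is again carried by `σ`, and the first part is used once more for `t₃` and `t₄`.
    rcases g3 with g3 | g3
    · exact (hsq σ t₁ t₂ g1 g2).2 t₃ t₄ g3 g4
    · exact (img_le_car _ 0 j₀ _).trans (hsq σ t₃ t₄ (g3.trans (hsq σ t₁ t₂ g1 g2).1) g4).1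

end Final

end Squeezing

end

theorem theorem10p2 (X : LFComplex.{u}) (hX : X.FiniteDimensional) :
    ∃ ε : ℝ, 0 < ε ∧ ∃ (i₀ : ℕ) (r : ∀ j, (X.sdIter j).Approx), ∀ i ≥ i₀,
      ∀ (o : X.VertexOrder) (A : Type w) [Category.{v} A] [Preadditive A] [HasFiniteBiproducts A]
        (a : Variance) (C D : ChainComplex (ControlledCat a X A) ℤ),
        IsFiniteComplex C → IsFiniteComplex D →
        (∃ e : HomotopyEquiv (toGraded (sdChainIter r o C i)) (toGraded (sdChainIter r o D i)),
          equivBound e < ENNReal.ofReal ε) →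
        Nonempty (HomotopyEquiv C D) := by
  obtain ⟨ε, hε, j₀, h⟩ := LFComplex.exists_squeeze hX
  -- The number `0 + j₀` is left unsimplified so that `i = 0 + j₀ + d` has the form in which the
  -- indices of the two stages occur.
  refine ⟨ε, hε, 0 + j₀, LFComplex.squeezeApprox X j₀, ?_⟩
  intro i hi o A _ _ _ a C D _ _ ⟨e, he⟩
  obtain ⟨d, rfl⟩ := Nat.exists_eq_add_of_le hi
  exact exists_homotopyEquiv_of_equivBound_lt hX (h d) o C D e he
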